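/- Let $J\ge 2$ be an integer and $\alpha>0$. *Confinement.* Let $\mathcal V_{J,\alpha}$ be the set of potentials $V(x)=\frac{\alpha}{2}x^2+\widetilde V(x)\ge 0$ such that $\widetilde V:\mathbb R\to\mathbb R$ is even, has polynomial growth, is in $C^J(\mathbb R)\setminus C^{J+1}(\mathbb R)$, has bounded derivatives $\widetilde V^{(j)}$ for $2\le j\le J$, and satisfies $C_V:=\alpha+\inf_x \widetilde V''(x)>0$. *Interaction.* Fix $V\in\mathcal V_{J,\alpha}$. Consider even functions $W\ge 0$ in $C^2(\mathbb R)$ with $W'$ bounded and in $L^1(\mathbb R)$, $W''$ bounded, $C_W:=-\inf_x W''(x)>0$ and $C_V-C_W>0$. Let $\pi=\pi_{V,W}$ be the probability density that solves $$\pi(x)=\frac1{Z_\pi}\exp\bigl(-2V(x)-(W\star\pi)(x)\bigr),\qquad Z_\pi=\int_{\mathbb R}\exp\bigl(-2V(x)-(W\star\pi)(x)\bigr)\,dx<\infty,$$ and let $\mathbb P^{\otimes N}_{V,W}$ be the law of $N$ i.i.d. random variables $X_1,\dots,X_N$ with density $\pi$. Put $\mathcal F(\varphi)(z)=\int_{\mathbb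 R}e^{izt}\varphi(t)\,dt$. For $p>0$ and $r=(r_1,\dots,r_6)\in\mathbb R_{>0}^6$ let $\mathcal A_{r,p,J}=\mathcal A_{r,p,J}(V)$ be the class of all such $W$ that satisfy $\|W'\|_\infty<\sqrt{C_V-C_W}$ and $$\inf_x W''(x)\in[-r_1,-r_2],\qquad \limsup_{x\to\infty}e^{2px^2}\int_{|y|>x}|W'(y)|^2\,dy\le r_3,\qquad \int_{\mathbb R}\left|\frac{\mathcal F(W')(z)}{\mathcal F(\pi)(z)}\right|^2dz\le r_4,$$ $$r_5\,(1\wedge|z|^{-J-2})\le|\mathcal F(\pi)(z)|\le r_6\,(1\wedge|z|^{-J-2})\qquad(z\in\mathbb R).$$ **Theorem.** There are $V\in\mathcal V_{J,\alpha}$ for which $\mathcal A_{r,p,J}(V)$ is non-empty for some $(p,r)\in\mathbb R_{>0}\times\mathbb R_{>0}^6$. For every such $V$ there exist $(p,r)\in\mathbb R_{>0}\times\mathbb R_{>0}^6$ and constants $c_0>0$, $\kappa>0$ such that for all $N\ge1$ $$\inf_{W'_N}\ \sup_{W\in\mathcal A_{r,p,J}(V)}\mathbb P^{\otimes N}_{V,W}\Bigl(\|W'_N-W'\|_{L^2(\mathbb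 R)}>c_0N^{-1/4}\Bigr)\ \ge\ \kappa ,$$ where the infimum is taken over all estimators $W'_N=W'_N(X_1,\dots,X_N;\cdot)$, that is, jointly measurable functions of the sample and of the space variable. -/

import Mathlib

open MeasureTheory Filter
open scoped ENNReal

noncomputable section

/-- The convolution `(f ⋆ g)(x) = ∫ f (x - y) g y dy` of real functions. -/
def conv (f g : ℝ → ℝ) (x : ℝ) : ℝ := ∫ y, f (x - y) * g y

/-- The Fourier transform `F(φ)(z) = ∫ exp(i z t) φ(t) dt` on the real line. -/
def fourierR (φ : ℝ → ℝ) (z : ℝ) : ℂ :=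
  ∫ t : ℝ, Complex.exp (Complex.I * (z : ℂ) * (t : ℂ)) * (φ t : ℂ)

/-- The confinement potential `V(x) = α x² / 2 + Vt(x)`. -/
def confinement (α : ℝ) (Vt : ℝ → ℝ) (x : ℝ) : ℝ := α / 2 * x ^ 2 + Vt x

/-- `C_V = α + inf Vt''`. -/
def constCV (α : ℝ) (Vt : ℝ → ℝ) : ℝ := α + ⨅ x, iteratedDeriv 2 Vt x

/-- `C_W = - inf W''`. -/
def constCW (W : ℝ → ℝ) : ℝ := -⨅ x, iteratedDeriv 2 W x

/-- The non-smooth confinement potentials of smoothness `J`: `V = α x² / 2 + Vt` is non-negative with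
`C_V > 0`, and `Vt` is even, of polynomial growth, `C^J` but not `C^{J+1}`, with bounded derivatives
of the orders `2, …, J`. -/
structure IsNonsmoothConfinement (J : ℕ) (α : ℝ) (Vt : ℝ → ℝ) : Prop where
  two_le : 2 ≤ J
  alpha_pos : 0 < α
  nonneg : ∀ x, 0 ≤ confinement α Vt x
  even : ∀ x, Vt (-x) = Vt x
  growth : ∃ (C : ℝ) (k : ℕ), ∀ x, |Vt x| ≤ C * (1 + |x|) ^ k
  contDiff : ContDiff ℝ (J : ℕ) Vt
  not_contDiff : ¬ ContDiff ℝ (J + 1 : ℕ) Vt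
  deriv_bdd : ∀ j, 2 ≤ j → j ≤ J → ∃ C : ℝ, ∀ x, |iteratedDeriv j Vt x| ≤ C
  constCV_pos : 0 < constCV α Vt

/-- The standing hypotheses on the interaction potential `W`, given the confinement potential:
`W` is non-negative, even and `C²`, `W'` is bounded and integrable, `W''` is bounded with
`inf W'' = -C_W < 0`, and `C_V - C_W > 0`. -/
structure IsInteraction (α : ℝ) (Vt W : ℝ → ℝ) : Prop where
  nonneg : ∀ x, 0 ≤ W x
  even : ∀ x, W (-x) = W x
  contDiff : ContDiff ℝ 2 W
  deriv_bdd : ∃ C : ℝ, ∀ x, |deriv W x| ≤ C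
  deriv_integrable : Integrable (deriv W)
  deriv2_bdd : ∃ C : ℝ, ∀ x, |iteratedDeriv 2 W x| ≤ C
  constCW_pos : 0 < constCW W
  constCW_lt : 0 < constCV α Vt - constCW W

/-- `dens` is a probability density solving the self-consistent equation
`dens(x) = Z⁻¹ exp(-2 V(x) - (W ⋆ dens)(x))`, `Z = ∫ exp(-2 V - W ⋆ dens) < ∞`. -/
structure IsInvariantDensity (V W dens : ℝ → ℝ) : Prop where
  nonneg : ∀ x, 0 ≤ dens x
  integrable : Integrable dens
  integral_eq_one : ∫ x, dens x = 1
  exp_integrable : Integrable (fun x => Real.exp (-2 * V x - conv W dens x))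
  eq : ∀ x, dens x =
    (∫ y, Real.exp (-2 * V y - conv W dens y))⁻¹ * Real.exp (-2 * V x - conv W dens x)

/-- The class `A_{r,p,J}` of interaction potentials for the confinement potential
`V = α x² / 2 + Vt`; the parameters `r₁, …, r₆` are `r 0, …, r 5`. Here `1 ∧ |z|^{-J-2}` (which is
`1` at `z = 0`) is written as `(max 1 |z|)^{-(J+2)}`. -/
structure InClass (α : ℝ) (Vt : ℝ → ℝ) (r : Fin 6 → ℝ) (p : ℝ) (J : ℕ) (W : ℝ → ℝ) : Prop where
  interaction : IsInteraction α Vt W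
  sup_deriv_lt : (⨆ x, |deriv W x|) < Real.sqrt (constCV α Vt - constCW W)
  inf_mem : (⨅ x, iteratedDeriv 2 W x) ∈ Set.Icc (-(r 0)) (-(r 1))
  tail : limsup (fun x : ℝ => ENNReal.ofReal (Real.exp (2 * p * x ^ 2)) *
      ∫⁻ y in {y : ℝ | x < |y|}, ‖deriv W y‖ₑ ^ 2) atTop ≤ ENNReal.ofReal (r 2)
  fourier : ∃ dens, IsInvariantDensity (confinement α Vt) W dens ∧
    (∫⁻ z : ℝ, ‖fourierR (deriv W) z / fourierR dens z‖ₑ ^ 2) ≤ ENNReal.ofReal (r 3) ∧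
    ∀ z : ℝ, r 4 * ((max 1 |z|) ^ (J + 2))⁻¹ ≤ ‖fourierR dens z‖ ∧
      ‖fourierR dens z‖ ≤ r 5 * ((max 1 |z|) ^ (J + 2))⁻¹

/-- The class `A_{r,p,J}` as a set of interaction potentials. -/
def interactionClass (α : ℝ) (Vt : ℝ → ℝ) (r : Fin 6 → ℝ) (p : ℝ) (J : ℕ) : Set (ℝ → ℝ) :=
  {W | InClass α Vt r p J W}

/-- The law of `N` i.i.d. real random variables with density `dens`. -/
def iidLaw (N : ℕ) (dens : ℝ → ℝ) : Measure (Fin N → ℝ) :=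
  Measure.pi fun _ => (volume : Measure ℝ).withDensity fun x => ENNReal.ofReal (dens x)

/-- The minimax probability
`inf_{Ŵ} sup_{W ∈ A_{r,p,J}} P_{V,W}^{⊗N} (‖Ŵ - W'‖_{L²} > s)`. An estimator is a jointly measurable
function `est` of the sample and of the space variable (the `L²` norm may be infinite). The density
that `W` determines enters as a second supremum, over the solutions of the self-consistent equation:
under the hypotheses on `(V, W)` there is exactly one. -/
def minimaxProb (α : ℝ) (Vt : ℝ → ℝ) (r : Fin 6 → ℝ) (p : ℝ) (J N : ℕ) (s : ℝ) : ℝ≥0∞ :=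
  ⨅ (est : (Fin N → ℝ) → ℝ → ℝ) (_ : Measurable (Function.uncurry est)),
    ⨆ (W : ℝ → ℝ) (_ : W ∈ interactionClass α Vt r p J)
      (dens : ℝ → ℝ) (_ : IsInvariantDensity (confinement α Vt) W dens),
      iidLaw N dens {x | ENNReal.ofReal s < eLpNorm (fun t => est x t - deriv W t) 2 volume}

end

/-! The lower bound is Le Cam's two-point method around an arbitrary member W of a non-empty class,
with invariant density π. Put k = J + 2 and let W₁ = W + 1 + w, where w(x) = a cos(Tx) exp(-x²/2).
The constant 1 only keeps W₁ ≥ 0; it changes neither W₁' nor the invariant density. The derivatives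
W₁' and W' are at L² distance of order aT. The law of the sample depends on W only through W ⋆ π.
The Fourier transform of w sits near ±T, where F(π) has size T^{-k}, so by inversion w ⋆ π is O(a
T^{-k}) and its derivative is O(a T^{-(k-1)}). Hence the likelihood ratio of the two invariant
densities is 1 + O(a T^{-(k-1)}). The constraint on F(W')/F(π) requires a T · T^k to stay bounded,
which suggests a = A T^{-(k+1)}. The ratio is then 1 + O(T^{-2k}), and N observations cannot
separate the two laws if N = T^{4k}. The separation aT is of order T^{-k} = N^{-1/4}, whatever J is.

The main work is to show that W₁ has an invariant density π₁ close to π and stays in the class. Two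
mechanisms are combined. (1) The map μ ↦ exp(-2V - W₁ ⋆ μ)/Z contracts in L¹. Along a path of
κ-strongly convex potentials, the variance bound 1/κ shows that an L-Lipschitz change of potential
moves the Gibbs density by at most L/√κ in L¹ (`integral_abs_gibbs_sub_le`). The bound ‖W'‖_∞ <
√(C_V - C_W), together with κ close to 2 C_V - C_W, makes the factor at most 3/4. (2) The functions
bounded by a multiple of max(1,|z|)^{-k} form an algebra under convolution. A potential change f
whose Fourier representation is small in this weighted norm therefore gives a tilt exp(-f) that
moves F(π) by a small multiple of the weight (`norm_fourierR_mul_exp_sub_le`). In the fixed-point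
equation, the part of f that comes from π₁ - π is controlled at low frequencies by the L¹ distance
of (1) and at high frequencies by the decay of the Fourier transform of the kernel. Picard iteration
preserves both estimates (`exists_perturbed_density`), so the two-sided bound on F(π₁) survives with
slightly worse constants.

Non-emptiness is obtained backwards. The density is prescribed as a multiple of exp(-αx²)(1 + εh),
where h has Fourier transform proportional to max(1,|z|)^{-J-2}; W is a small Gaussian; and V is
read off from the invariance equation. All Fourier terms are positive, which gives the two-sided
bound, and h fails to be C^{J+1} at the origin. -/

noncomputable section

/-! ### Polynomial weights -/

/-- The weight `max(1, |z|)^k`. -/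
def wt (k : ℕ) (z : ℝ) : ℝ := (max 1 |z|) ^ k

lemma one_le_wt (k : ℕ) (z : ℝ) : 1 ≤ wt k z := one_le_pow₀ (le_max_left _ _)

lemma wt_pos (k : ℕ) (z : ℝ) : 0 < wt k z := lt_of_lt_of_le one_pos (one_le_wt k z)

lemma wt_neg (k : ℕ) (z : ℝ) : wt k (-z) = wt k z := by simp [wt]

lemma continuous_wt (k : ℕ) : Continuous (wt k) := by unfold wt; fun_prop

lemma continuous_inv_wt (k : ℕ) : Continuous fun z => (wt k z)⁻¹ :=
  (continuous_wt k).inv₀ fun z => (wt_pos k z).ne'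

/-- Peetre's inequality. This product form moves the weight to the centre ±T of a Gaussian bump; the
sum form `wt_le_add'` serves convolutions. -/
lemma wt_le_add (k : ℕ) (y u : ℝ) : wt k (y + u) ≤ 2 ^ k * (wt k y * wt k u) := by
  unfold wt
  rw [← mul_pow, ← mul_pow]
  refine pow_le_pow_left₀ (by positivity) ?_ k
  have h1 := le_max_left 1 |y|
  have h2 := le_max_left 1 |u|
  have h3 := le_max_right 1 |y|
  have h4 := le_max_right 1 |u|
  have h5 := abs_add_le y u
  refine max_le (by nlinarith) (by nlinarith)

lemma wt_le_add' (k : ℕ) (y u : ℝ) : wt k (y + u) ≤ 2 ^ k * (wt k y + wt k u) := by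
  have key : max 1 |y + u| ≤ 2 * max (max 1 |y|) (max 1 |u|) := by
    have h1 := le_max_left (max 1 |y|) (max 1 |u|)
    have h2 := le_max_right (max 1 |y|) (max 1 |u|)
    have h3 := le_max_right 1 |y|
    have h4 := le_max_right 1 |u|
    have h6 := le_max_left 1 |u|
    have h5 := abs_add_le y u
    refine max_le (by linarith) (by linarith)
  calc wt k (y + u) ≤ (2 * max (max 1 |y|) (max 1 |u|)) ^ k :=
        pow_le_pow_left₀ (by positivity) key k
    _ = 2 ^ k * (max (max 1 |y|) (max 1 |u|)) ^ k := mul_pow _ _ _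
    _ ≤ _ := by
        gcongr
        rcases max_cases (max 1 |y|) (max 1 |u|) with h | h <;> rw [h.1]
        · exact le_add_of_nonneg_right (wt_pos k u).le
        · exact le_add_of_nonneg_left (wt_pos k y).le

lemma inv_wt_le (k : ℕ) (hk : 2 ≤ k) (z : ℝ) : (wt k z)⁻¹ ≤ 2 * (1 + z ^ 2)⁻¹ := by
  have h : 1 + z ^ 2 ≤ 2 * wt k z := by
    have h1 : wt 2 z ≤ wt k z := pow_le_pow_right₀ (le_max_left _ _) hk
    have h2 := le_max_left 1 |z|
    have h3 := le_max_right 1 |z|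
    have h4 : z ^ 2 ≤ wt 2 z := by rw [← sq_abs]; unfold wt; gcongr
    have h5 := one_le_wt 2 z
    linarith
  have h0 := wt_pos k z
  rw [← div_eq_mul_inv, inv_eq_one_div, div_le_div_iff₀ h0 (by positivity)]
  linarith

lemma integrable_inv_wt (k : ℕ) (hk : 2 ≤ k) : Integrable fun z => (wt k z)⁻¹ := by
  refine (integrable_inv_one_add_sq.const_mul 2).mono'
    (continuous_inv_wt k).aestronglyMeasurable (ae_of_all _ fun z => ?_)
  rw [Real.norm_of_nonneg (inv_nonneg.2 (wt_pos k z).le)]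
  exact inv_wt_le k hk z

/-- The constant in the convolution inequality for the weights. -/
def convC (k : ℕ) : ℝ := 2 ^ (k + 1) * ∫ z, (wt k z)⁻¹

lemma convC_nonneg (k : ℕ) : 0 ≤ convC k :=
  mul_nonneg (by positivity) (integral_nonneg fun z => (inv_nonneg.2 (wt_pos k z).le))

lemma integrable_inv_wt_sub (k : ℕ) (hk : 2 ≤ k) (z : ℝ) :
    Integrable fun y => (wt k (z - y))⁻¹ :=
  (integrable_inv_wt k hk).comp_sub_left z

/-- Since z = y + (z - y), one of the two arguments carries the weight of z up to the factor 2^k.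
What remains is integrable in y for k ≥ 2, so a bound by `wt k`⁻¹ is stable under convolution. -/
lemma inv_wt_mul_le (k : ℕ) (z y : ℝ) :
    (wt k y)⁻¹ * (wt k (z - y))⁻¹ ≤ 2 ^ k * ((wt k y)⁻¹ + (wt k (z - y))⁻¹) * (wt k z)⁻¹ := by
  have h := wt_le_add' k y (z - y)
  rw [add_sub_cancel] at h
  have h1 := wt_pos k y
  have h2 := wt_pos k (z - y)
  have h3 := wt_pos k z
  have e : 2 ^ k * ((wt k y)⁻¹ + (wt k (z - y))⁻¹) * (wt k z)⁻¹ =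
      (wt k y)⁻¹ * (wt k (z - y))⁻¹ * ((2 ^ k * (wt k y + wt k (z - y))) / wt k z) := by
    field_simp; ring
  rw [e]
  exact le_mul_of_one_le_right (by positivity) ((one_le_div h3).2 h)

lemma integrable_inv_wt_mul (k : ℕ) (hk : 2 ≤ k) (z : ℝ) :
    Integrable fun y => (wt k y)⁻¹ * (wt k (z - y))⁻¹ := by
  refine (integrable_inv_wt k hk).mono' ?_ (ae_of_all _ fun y => ?_)
  · exact ((continuous_inv_wt k).mul
      ((continuous_inv_wt k).comp (by fun_prop))).aestronglyMeasurable
  · have h1 := wt_pos k y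
    have h2 := wt_pos k (z - y)
    rw [Real.norm_of_nonneg (by positivity)]
    exact mul_le_of_le_one_right (by positivity) (inv_le_one_of_one_le₀ (one_le_wt _ _))

lemma integral_inv_wt_mul_le (k : ℕ) (hk : 2 ≤ k) (z : ℝ) :
    ∫ y, (wt k y)⁻¹ * (wt k (z - y))⁻¹ ≤ convC k * (wt k z)⁻¹ := by
  have h := integral_mono (integrable_inv_wt_mul k hk z)
    ((((integrable_inv_wt k hk).add (integrable_inv_wt_sub k hk z)).const_mul (2 ^ k)).mul_const
      ((wt k z)⁻¹)) (fun y => inv_wt_mul_le k z y)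
  refine h.trans (le_of_eq ?_)
  simp only [Pi.add_apply]
  rw [integral_mul_const, integral_const_mul, integral_add (integrable_inv_wt k hk)
    (integrable_inv_wt_sub k hk z), integral_sub_left_eq_self (fun y => (wt k y)⁻¹) volume z,
    convC, pow_succ]
  ring

/-! ### The Fourier transform -/

lemma norm_cexp_I_mul (z t : ℝ) : ‖Complex.exp (Complex.I * (z : ℂ) * (t : ℂ))‖ = 1 := by
  have : Complex.I * (z : ℂ) * (t : ℂ) = ((z * t : ℝ) : ℂ) * Complex.I := by push_cast; ring
  rw [this, Complex.norm_exp_ofReal_mul_I]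

lemma integrable_kernel {φ : ℝ → ℝ} (h : Integrable φ) (z : ℝ) :
    Integrable fun t : ℝ => Complex.exp (Complex.I * (z : ℂ) * (t : ℂ)) * (φ t : ℂ) := by
  refine h.ofReal.bdd_mul (c := 1) (by fun_prop) (ae_of_all _ fun t => ?_)
  rw [norm_cexp_I_mul]

lemma norm_fourierR_le (φ : ℝ → ℝ) (z : ℝ) : ‖fourierR φ z‖ ≤ ∫ x, |φ x| := by
  refine (norm_integral_le_integral_norm _).trans (le_of_eq ?_)
  simp [norm_cexp_I_mul]

lemma fourierR_add {f g : ℝ → ℝ} (hf : Integrable f) (hg : Integrable g) (z : ℝ) :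
    fourierR (fun x => f x + g x) z = fourierR f z + fourierR g z := by
  unfold fourierR
  rw [← integral_add (integrable_kernel hf z) (integrable_kernel hg z)]
  congr 1; ext t; push_cast; ring

lemma fourierR_sub {f g : ℝ → ℝ} (hf : Integrable f) (hg : Integrable g) (z : ℝ) :
    fourierR (fun x => f x - g x) z = fourierR f z - fourierR g z := by
  unfold fourierR
  rw [← integral_sub (integrable_kernel hf z) (integrable_kernel hg z)]
  congr 1; ext t; push_cast; ring

lemma fourierR_const_mul (c : ℝ) (f : ℝ → ℝ) (z : ℝ) :
    fourierR (fun x => c * f x) z = c * fourierR f z := by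
  unfold fourierR
  rw [← integral_const_mul]
  congr 1; ext t; push_cast; ring

lemma fourierR_zero (f : ℝ → ℝ) : fourierR f 0 = ((∫ x, f x : ℝ) : ℂ) := by
  unfold fourierR
  simp only [Complex.ofReal_zero, mul_zero, zero_mul, Complex.exp_zero, one_mul]
  exact integral_ofReal

-- Passage from the kernel exp(izt) to the normalisation exp(-2πi tξ), with ξ = -z/(2π).
open FourierTransform in
lemma fourierR_eq (φ : ℝ → ℝ) (z : ℝ) :
    fourierR φ z = 𝓕 (fun t => (φ t : ℂ)) (-z / (2 * Real.pi)) := by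
  rw [Real.fourier_real_eq_integral_exp_smul]
  unfold fourierR
  congr 1; ext t
  rw [smul_eq_mul]
  congr 2
  push_cast
  field_simp

lemma continuous_fourierR {φ : ℝ → ℝ} (h : Integrable φ) : Continuous (fourierR φ) := by
  refine continuous_of_dominated (bound := fun t => |φ t|)
    (fun z => (integrable_kernel h z).aestronglyMeasurable) (fun z => ae_of_all _ fun t => ?_) h.abs
    (ae_of_all _ fun t => by fun_prop)
  rw [norm_mul, norm_cexp_I_mul]; simp

lemma conv_eq_convolution (f g : ℝ → ℝ) (x : ℝ) :
    ((conv f g x : ℝ) : ℂ) =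
      (MeasureTheory.convolution (fun t => (f t : ℂ)) (fun t => (g t : ℂ))
        (ContinuousLinearMap.mul ℂ ℂ) volume) x := by
  unfold conv MeasureTheory.convolution
  refine (integral_ofReal (𝕜 := ℂ)).symm.trans ?_
  rw [← integral_sub_left_eq_self _ volume x]
  congr 1; ext t
  simp

lemma integrable_conv {f g : ℝ → ℝ} (hf : Integrable f) (hg : Integrable g) :
    Integrable (conv f g) := by
  have h := (hf.ofReal (𝕜 := ℂ)).integrable_convolution (ContinuousLinearMap.mul ℂ ℂ)
    (hg.ofReal (𝕜 := ℂ))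
  have h2 := h.re
  refine h2.congr (ae_of_all _ fun x => ?_)
  have := conv_eq_convolution f g x
  have h3 := congrArg Complex.re this
  simpa using h3.symm

open FourierTransform in
lemma fourierR_conv {f g : ℝ → ℝ} (hf : Integrable f) (hg : Integrable g)
    (z : ℝ) : fourierR (conv f g) z = fourierR f z * fourierR g z := by
  rw [fourierR_eq, fourierR_eq, fourierR_eq]
  have := Real.fourier_mul_convolution_eq (R := ℂ) (hf.ofReal (𝕜 := ℂ)) (hg.ofReal (𝕜 := ℂ))
    (ξ := -z / (2 * Real.pi))
  refine Eq.trans ?_ this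
  exact congrFun (congrArg (𝓕) (funext fun x => conv_eq_convolution f g x)) _

lemma continuous_conv {K ρ : ℝ → ℝ} (hK : Continuous K) {B : ℝ} (hB : ∀ x, |K x| ≤ B)
    (hρ : Integrable ρ) : Continuous (conv K ρ) := by
  refine continuous_of_dominated (bound := fun y => B * |ρ y|) (fun x => ?_)
    (fun x => ae_of_all _ fun y => ?_) (hρ.abs.const_mul B) (ae_of_all _ fun y => by fun_prop)
  · exact (Continuous.aestronglyMeasurable (by fun_prop)).mul hρ.aestronglyMeasurable
  · rw [Real.norm_eq_abs, abs_mul]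
    exact mul_le_mul_of_nonneg_right (hB _) (abs_nonneg _)

open FourierTransform in
/-- Fourier inversion for a convolution. -/
lemma conv_eq_integral_fourierR {K ρ : ℝ → ℝ} (hK : Integrable K) (hKc : Continuous K) {B : ℝ}
    (hB : ∀ x, |K x| ≤ B) (hρ : Integrable ρ)
    (hint : Integrable fun z => fourierR K z * fourierR ρ z) (x : ℝ) :
    ((conv K ρ x : ℝ) : ℂ) = ∫ z : ℝ, Complex.exp (-(Complex.I * (x : ℂ) * (z : ℂ))) *
      ((2 * Real.pi : ℝ)⁻¹ * (fourierR K z * fourierR ρ z)) := by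
  have hpi : (2 * Real.pi : ℝ) ≠ 0 := by positivity
  have hF : (𝓕 fun t => ((conv K ρ t : ℝ) : ℂ)) =
      fun v => fourierR K (v * -(2 * Real.pi)) * fourierR ρ (v * -(2 * Real.pi)) := by
    funext v
    rw [← fourierR_conv hK hρ, fourierR_eq]
    field_simp
  have h1 : Continuous fun t => ((conv K ρ t : ℝ) : ℂ) :=
    Complex.continuous_ofReal.comp (continuous_conv hKc hB hρ)
  have h2 := h1.fourierInv_fourier_eq ((integrable_conv hK hρ).ofReal) (by
    rw [hF]; exact hint.comp_mul_right' (neg_ne_zero.2 hpi))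
  have h3 := congrFun h2 x
  rw [← h3, hF, Real.fourierInv_eq']
  have h4 := Measure.integral_comp_mul_right (fun z : ℝ =>
    Complex.exp (-(Complex.I * (x : ℂ) * (z : ℂ))) *
      ((2 * Real.pi : ℝ)⁻¹ * (fourierR K z * fourierR ρ z))) (-(2 * Real.pi))
  have h5 : |(-(2 * Real.pi))⁻¹| = (2 * Real.pi)⁻¹ := by
    rw [inv_neg, abs_neg, abs_of_pos (by positivity)]
  rw [h5] at h4
  have h6 : ∀ w : ℂ, w = (2 * Real.pi : ℝ) • ((2 * Real.pi)⁻¹ • w) := fun w => by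
    rw [smul_smul, mul_inv_cancel₀ hpi, one_smul]
  refine Eq.trans ?_ (h6 _).symm
  rw [← h4, ← integral_smul]
  congr 1; ext v
  rw [Complex.real_smul, smul_eq_mul]
  have e : Complex.exp (-(Complex.I * (x : ℂ) * ((v * -(2 * Real.pi) : ℝ) : ℂ))) =
      Complex.exp (((2 * Real.pi * inner ℝ v x : ℝ) : ℂ) * Complex.I) := by
    congr 1; simp; ring
  rw [e]
  have hpi' : ((2 * Real.pi : ℝ) : ℂ) ≠ 0 := by exact_mod_cast hpi
  push_cast at hpi' ⊢
  field_simp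

/-! ### Multiplication by functions with a weighted Fourier representation -/

/-- `f` is the Fourier integral of `m`. -/
def HasFourierRep (f : ℝ → ℝ) (m : ℝ → ℂ) : Prop :=
  ∀ x : ℝ, ((f x : ℝ) : ℂ) = ∫ y : ℝ, Complex.exp (-(Complex.I * (x : ℂ) * (y : ℂ))) * m y

lemma norm_cexp_neg_I_mul (z t : ℝ) :
    ‖Complex.exp (-(Complex.I * (z : ℂ) * (t : ℂ)))‖ = 1 := by
  rw [Complex.exp_neg, norm_inv, norm_cexp_I_mul, inv_one]

/-- Fubini: multiplication by f is convolution with m on the Fourier side. The factor 1/(2π) of the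
inversion formula is already contained in m. -/
lemma fourierR_mul_of_rep {ρ f : ℝ → ℝ} {m : ℝ → ℂ} (hρ : Integrable ρ) (hm : Integrable m)
    (hf : HasFourierRep f m) (z : ℝ) :
    fourierR (fun x => ρ x * f x) z = ∫ y, m y * fourierR ρ (z - y) := by
  have hint : Integrable (Function.uncurry fun x y : ℝ =>
      Complex.exp (Complex.I * ((z - y : ℝ) : ℂ) * (x : ℂ)) * ((ρ x : ℂ) * m y))
      (volume.prod volume) := by
    refine (hρ.ofReal.mul_prod hm).bdd_mul (c := 1)
      (Continuous.aestronglyMeasurable (by fun_prop)) (ae_of_all _ fun p => ?_)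
    rw [norm_cexp_I_mul]
  have hl : fourierR (fun x => ρ x * f x) z = ∫ x : ℝ, ∫ y : ℝ,
      Complex.exp (Complex.I * ((z - y : ℝ) : ℂ) * (x : ℂ)) * ((ρ x : ℂ) * m y) := by
    unfold fourierR
    congr 1; ext x
    rw [Complex.ofReal_mul, hf x, ← mul_assoc, ← integral_const_mul]
    congr 1; ext y
    have : Complex.I * ((z - y : ℝ) : ℂ) * (x : ℂ) =
      Complex.I * z * x + -(Complex.I * (x : ℂ) * (y : ℂ)) := by push_cast; ring
    rw [this, Complex.exp_add]
    ring
  rw [hl, integral_integral_swap hint]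
  congr 1; ext y
  unfold fourierR
  rw [← integral_const_mul]
  congr 1; ext x
  ring

lemma norm_integral_mul_le {k : ℕ} (hk : 2 ≤ k) {m g : ℝ → ℂ} {A M : ℝ} (hA : 0 ≤ A)
    (hmb : ∀ y, ‖m y‖ ≤ A * (wt k y)⁻¹) (hg : ∀ y, ‖g y‖ ≤ M * (wt k y)⁻¹) (z : ℝ) :
    ‖∫ y, m y * g (z - y)‖ ≤ convC k * A * M * (wt k z)⁻¹ := by
  have hM : 0 ≤ M := by
    have h1 := (norm_nonneg _).trans (hg 0)
    exact nonneg_of_mul_nonneg_left h1 (inv_pos.2 (wt_pos k 0))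
  have h1 : ‖∫ y, m y * g (z - y)‖ ≤ ∫ y, A * M * ((wt k y)⁻¹ * (wt k (z - y))⁻¹) := by
    refine norm_integral_le_of_norm_le ((integrable_inv_wt_mul k hk z).const_mul _)
      (ae_of_all _ fun y => ?_)
    rw [norm_mul]
    have hw := wt_pos k y
    calc ‖m y‖ * ‖g (z - y)‖ ≤ (A * (wt k y)⁻¹) * (M * (wt k (z - y))⁻¹) := by
          gcongr
          · exact hmb y
          · exact hg _
      _ = _ := by ring
  rw [integral_const_mul] at h1
  refine h1.trans ?_
  have h2 := mul_le_mul_of_nonneg_left (integral_inv_wt_mul_le k hk z) (mul_nonneg hA hM)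
  linarith

lemma integrable_of_le_wt {k : ℕ} (hk : 2 ≤ k) {m : ℝ → ℂ} {A : ℝ}
    (hm : AEStronglyMeasurable m volume) (hmb : ∀ y, ‖m y‖ ≤ A * (wt k y)⁻¹) : Integrable m :=
  ((integrable_inv_wt k hk).const_mul A).mono' hm (ae_of_all _ hmb)

/-- Each factor f is one convolution with m, and each convolution multiplies the weighted norm by at
most `convC k * A`. -/
lemma norm_fourierR_mul_pow_le {k : ℕ} (hk : 2 ≤ k) {ρ f : ℝ → ℝ} {m : ℝ → ℂ} {A M B : ℝ}
    (hρ : Integrable ρ) (hm : AEStronglyMeasurable m volume) (hA : 0 ≤ A)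
    (hmb : ∀ y, ‖m y‖ ≤ A * (wt k y)⁻¹) (hf : HasFourierRep f m) (hfc : Continuous f)
    (hfb : ∀ x, |f x| ≤ B) (hM : ∀ y, ‖fourierR ρ y‖ ≤ M * (wt k y)⁻¹) (n : ℕ) :
    Integrable (fun x => ρ x * f x ^ n) ∧
    ∀ z, ‖fourierR (fun x => ρ x * f x ^ n) z‖ ≤ (convC k * A) ^ n * M * (wt k z)⁻¹ := by
  induction n with
  | zero => simpa using ⟨hρ, hM⟩
  | succ n ih =>
    have e : (fun x => ρ x * f x ^ (n + 1)) = fun x => (ρ x * f x ^ n) * f x := by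
      ext x; ring
    rw [e]
    refine ⟨ih.1.mul_bdd (c := B) hfc.aestronglyMeasurable (ae_of_all _ fun x => by
      simpa using hfb x), fun z => ?_⟩
    rw [fourierR_mul_of_rep ih.1 (integrable_of_le_wt hk hm hmb) hf]
    refine (norm_integral_mul_le hk hA hmb ih.2 z).trans (le_of_eq ?_)
    ring

/-- Multiplication by `exp(-f)` is a small perturbation in the weighted Fourier norm. -/
lemma norm_fourierR_mul_exp_sub_le {k : ℕ} (hk : 2 ≤ k) {ρ f : ℝ → ℝ} {m : ℝ → ℂ} {A M B : ℝ}
    (hρ : Integrable ρ) (hm : AEStronglyMeasurable m volume) (hA : 0 ≤ A)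
    (hmb : ∀ y, ‖m y‖ ≤ A * (wt k y)⁻¹) (hf : HasFourierRep f m) (hfc : Continuous f)
    (hfb : ∀ x, |f x| ≤ B) (hM : ∀ y, ‖fourierR ρ y‖ ≤ M * (wt k y)⁻¹) (z : ℝ) :
    ‖fourierR (fun x => ρ x * Real.exp (-f x)) z - fourierR ρ z‖ ≤
      (Real.exp (convC k * A) - 1) * M * (wt k z)⁻¹ := by
  have hn := norm_fourierR_mul_pow_le hk hρ hm hA hmb hf hfc hfb hM
  have hB : 0 ≤ B := (abs_nonneg _).trans (hfb 0)
  -- The exponential series of exp(-f), transformed term by term. The term n = 0 is the transform of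
  -- ρ, and the others add up to at most exp(convC k * A) - 1 in the weighted norm.
  let a : ℕ → ℂ := fun n => fourierR (fun x => ((-1) ^ n / n.factorial : ℝ) * (ρ x * f x ^ n)) z
  have hs : HasSum a (fourierR (fun x => ρ x * Real.exp (-f x)) z) := by
    refine hasSum_integral_of_dominated_convergence
      (bound := fun n x => |ρ x| * (B ^ n / n.factorial)) (fun n => ?_)
      (fun n => ae_of_all _ fun x => ?_) (ae_of_all _ fun x => ?_) ?_ (ae_of_all _ fun x => ?_)
    · exact (integrable_kernel ((hn n).1.const_mul _) z).aestronglyMeasurable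
    · rw [norm_mul, norm_cexp_I_mul, one_mul, Complex.norm_real, Real.norm_eq_abs, abs_mul,
        abs_mul, abs_div, abs_pow, abs_pow, abs_neg, abs_one, one_pow, Nat.abs_cast]
      have := pow_le_pow_left₀ (abs_nonneg _) (hfb x) n
      calc 1 / (n.factorial : ℝ) * (|ρ x| * |f x| ^ n)
          = |ρ x| * (|f x| ^ n / n.factorial) := by ring
        _ ≤ _ := by gcongr
    · exact (Real.summable_pow_div_factorial B).mul_left _
    · simp_rw [tsum_mul_left]
      exact hρ.abs.mul_const _
    · have h1 : HasSum (fun n : ℕ => (-f x) ^ n / n.factorial) (Real.exp (-f x)) := by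
        rw [Real.exp_eq_exp_ℝ]
        exact NormedSpace.expSeries_div_hasSum_exp (-f x)
      have h2 := (Complex.hasSum_ofReal.2 (h1.mul_left (ρ x))).mul_left
        (Complex.exp (Complex.I * (z : ℂ) * (x : ℂ)))
      refine h2.congr_fun ?_
      intro n
      congr 2
      rw [neg_pow]; ring
  have h0 : a 0 = fourierR ρ z := by simp [a]
  have hs1 : HasSum (fun n => a (n + 1)) (fourierR (fun x => ρ x * Real.exp (-f x)) z -
      fourierR ρ z) := by
    rw [← h0]
    have := (hasSum_nat_add_iff' (f := a) 1).2 hs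
    simpa using this
  have he : HasSum (fun n : ℕ => (convC k * A) ^ (n + 1) / (n + 1).factorial * M * (wt k z)⁻¹)
      ((Real.exp (convC k * A) - 1) * M * (wt k z)⁻¹) := by
    refine (HasSum.mul_right _ ?_).mul_right _
    have h1 : HasSum (fun n : ℕ => (convC k * A) ^ n / n.factorial) (Real.exp (convC k * A)) := by
      rw [Real.exp_eq_exp_ℝ]
      exact NormedSpace.expSeries_div_hasSum_exp _
    have := (hasSum_nat_add_iff' (f := fun n : ℕ => (convC k * A) ^ n / n.factorial) 1).2 h1
    simpa using this
  rw [← hs1.tsum_eq]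
  refine tsum_of_norm_bounded he fun n => ?_
  simp only [a]
  rw [fourierR_const_mul, norm_mul, Complex.norm_real, Real.norm_eq_abs, abs_div, abs_pow, abs_neg,
    abs_one, one_pow, Nat.abs_cast]
  have := (hn (n + 1)).2 z
  calc 1 / ((n + 1).factorial : ℝ) * ‖fourierR (fun x => ρ x * f x ^ (n + 1)) z‖
      ≤ 1 / ((n + 1).factorial : ℝ) * ((convC k * A) ^ (n + 1) * M * (wt k z)⁻¹) := by gcongr
    _ = _ := by ring

/-! ### Strongly log-concave Gibbs densities -/

/-- `U` is a `κ`-strongly convex potential with derivative `U'` of at most linear growth. -/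
structure StrongPot (κ : ℝ) (U U' : ℝ → ℝ) : Prop where
  deriv : ∀ x, HasDerivAt U (U' x) x
  cont : Continuous U'
  growth : ∃ B, ∀ x, |U' x| ≤ B * (1 + |x|)
  mono : ∀ x y, κ * (x - y) ^ 2 ≤ (x - y) * (U' x - U' y)
  coercive : ∃ c, 0 < c ∧ ∃ C, ∀ x, c * x ^ 2 - C ≤ U x

lemma StrongPot.continuous {κ : ℝ} {U U' : ℝ → ℝ} (h : StrongPot κ U U') : Continuous U :=
  continuous_iff_continuousAt.2 fun x => (h.deriv x).continuousAt

/-- Linear interpolation keeps the same κ, so the variance bound is uniform along the path between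
two potentials. -/
lemma StrongPot.segment {κ : ℝ} {U U' V V' : ℝ → ℝ} (hU : StrongPot κ U U')
    (hV : StrongPot κ V V') {t : ℝ} (h0 : 0 ≤ t) (h1 : t ≤ 1) :
    StrongPot κ (fun x => U x + t * (V x - U x)) (fun x => U' x + t * (V' x - U' x)) where
  deriv x := (hU.deriv x).add (((hV.deriv x).sub (hU.deriv x)).const_mul t)
  cont := hU.cont.add (continuous_const.mul (hV.cont.sub hU.cont))
  growth := by
    obtain ⟨B, hB⟩ := hU.growth
    obtain ⟨D, hD⟩ := hV.growth
    refine ⟨B + D, fun x => ?_⟩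
    have e : U' x + t * (V' x - U' x) = (1 - t) * U' x + t * V' x := by ring
    rw [e]
    refine (abs_add_le _ _).trans ?_
    rw [abs_mul, abs_mul, abs_of_nonneg h0, abs_of_nonneg (sub_nonneg.2 h1)]
    have a1 : (1 - t) * |U' x| ≤ 1 * |U' x| :=
      mul_le_mul_of_nonneg_right (by linarith) (abs_nonneg _)
    have a2 : t * |V' x| ≤ 1 * |V' x| := mul_le_mul_of_nonneg_right h1 (abs_nonneg _)
    linarith [hB x, hD x]
  mono x y := by
    have h2 := mul_le_mul_of_nonneg_left (hU.mono x y) (sub_nonneg.2 h1)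
    have h3 := mul_le_mul_of_nonneg_left (hV.mono x y) h0
    linarith
  coercive := by
    obtain ⟨c, hc, C, hC⟩ := hU.coercive
    obtain ⟨d, hd, D, hD⟩ := hV.coercive
    refine ⟨min c d, lt_min hc hd, (1 - t) * C + t * D, fun x => ?_⟩
    have h2 := mul_le_mul_of_nonneg_left (hC x) (sub_nonneg.2 h1)
    have h3 := mul_le_mul_of_nonneg_left (hD x) h0
    have h4 : (1 - t) * (min c d * x ^ 2) ≤ (1 - t) * (c * x ^ 2) := by
      have := min_le_left c d
      have := sub_nonneg.2 h1
      gcongr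
    have h5 : t * (min c d * x ^ 2) ≤ t * (d * x ^ 2) := by
      have := min_le_right c d
      gcongr
    linarith

lemma StrongPot.integrable_pow {κ : ℝ} {U U' : ℝ → ℝ} (h : StrongPot κ U U') (n : ℕ) :
    Integrable fun x => x ^ n * Real.exp (-U x) := by
  obtain ⟨c, hc, C, hC⟩ := h.coercive
  have hi := ((integrable_rpow_mul_exp_neg_mul_sq hc (s := n)
    (by have : (0 : ℝ) ≤ n := n.cast_nonneg
        linarith)).norm).const_mul (Real.exp C)
  refine hi.mono' ((continuous_id.pow n).mul
    (Real.continuous_exp.comp h.continuous.neg)).aestronglyMeasurable (ae_of_all _ fun x => ?_)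
  rw [Real.rpow_natCast, norm_mul, norm_mul, Real.norm_of_nonneg (Real.exp_pos _).le,
    Real.norm_of_nonneg (Real.exp_pos _).le]
  have : Real.exp (-U x) ≤ Real.exp C * Real.exp (-c * x ^ 2) := by
    rw [← Real.exp_add]
    exact Real.exp_le_exp.2 (by linarith [hC x])
  calc ‖x ^ n‖ * Real.exp (-U x) ≤ ‖x ^ n‖ * (Real.exp C * Real.exp (-c * x ^ 2)) := by gcongr
    _ = _ := by ring

lemma StrongPot.integrable_exp {κ : ℝ} {U U' : ℝ → ℝ} (h : StrongPot κ U U') :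
    Integrable fun x => Real.exp (-U x) := by
  simpa using h.integrable_pow 0

lemma StrongPot.integrable_id_exp {κ : ℝ} {U U' : ℝ → ℝ} (h : StrongPot κ U U') :
    Integrable fun x => x * Real.exp (-U x) := by
  simpa using h.integrable_pow 1

lemma integral_exp_pos' {U : ℝ → ℝ} (h : Integrable fun x => Real.exp (-U x)) :
    0 < ∫ x, Real.exp (-U x) := integral_exp_pos h

/-- The Gibbs density of a potential. -/
def gibbs (U : ℝ → ℝ) (x : ℝ) : ℝ := (∫ y, Real.exp (-U y))⁻¹ * Real.exp (-U x)

/-- Take m to be the mean. Integrating the derivative of (x - m) exp(-U) gives ∫ (x - m) U' exp(-U)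
= Z. Replacing U' by U' - U'(m) changes nothing because m is the mean, and strong monotonicity
bounds the integrand below by κ (x - m)² exp(-U). -/
lemma StrongPot.exists_variance_le {κ : ℝ} {U U' : ℝ → ℝ} (h : StrongPot κ U U') :
    ∃ m : ℝ, κ * ∫ x, (x - m) ^ 2 * Real.exp (-U x) ≤ ∫ x, Real.exp (-U x) := by
  have hZ := integral_exp_pos' h.integrable_exp
  set Z := ∫ x, Real.exp (-U x) with hZd
  set m := (∫ x, x * Real.exp (-U x)) / Z with hm
  have hc0 : Continuous fun x => Real.exp (-U x) := Real.continuous_exp.comp h.continuous.neg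
  have h1 : ∫ x, (x - m) * Real.exp (-U x) = 0 := by
    simp_rw [sub_mul]
    rw [integral_sub h.integrable_id_exp (h.integrable_exp.const_mul m), integral_const_mul, hm]
    field_simp; ring
  have i2 : Integrable fun x => (x - m) ^ 2 * Real.exp (-U x) := by
    have := ((h.integrable_pow 2).sub (h.integrable_id_exp.const_mul (2 * m))).add
      (h.integrable_exp.const_mul (m ^ 2))
    refine this.congr (ae_of_all _ fun x => ?_)
    simp only [Pi.add_apply, Pi.sub_apply]; ring
  have i1 : Integrable fun x => (x - m) * Real.exp (-U x) := by
    have := h.integrable_id_exp.sub (h.integrable_exp.const_mul m)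
    refine this.congr (ae_of_all _ fun x => ?_)
    simp only [Pi.sub_apply]; ring
  have iU : Integrable fun x => (x - m) * U' x * Real.exp (-U x) := by
    obtain ⟨B, hB⟩ := h.growth
    have hi : Integrable fun x =>
        B * ((1 + |m|) * (1 + 2 * x ^ 2 + 1) * Real.exp (-U x)) := by
      refine Integrable.const_mul ?_ B
      have := ((h.integrable_exp.const_mul 2).add ((h.integrable_pow 2).const_mul 2)).const_mul
        (1 + |m|)
      refine this.congr (ae_of_all _ fun x => ?_)
      simp only [Pi.add_apply]; ring
    refine hi.mono' (Continuous.aestronglyMeasurable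
      (((continuous_id.sub continuous_const).mul h.cont).mul hc0)) (ae_of_all _ fun x => ?_)
    rw [norm_mul, norm_mul, Real.norm_eq_abs, Real.norm_eq_abs,
      Real.norm_of_nonneg (Real.exp_pos _).le]
    have e : B * ((1 + |m|) * (1 + 2 * x ^ 2 + 1) * Real.exp (-U x)) =
        B * ((1 + |m|) * (1 + 2 * x ^ 2 + 1)) * Real.exp (-U x) := by ring
    rw [e]
    refine mul_le_mul_of_nonneg_right ?_ (Real.exp_pos _).le
    have hB0 : 0 ≤ B := by
      have := (abs_nonneg _).trans (hB 0)
      simpa using this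
    have a1 : |x - m| ≤ (1 + |m|) * (1 + |x|) := by
      have := abs_sub x m
      nlinarith [abs_nonneg x, abs_nonneg m]
    calc |x - m| * |U' x| ≤ ((1 + |m|) * (1 + |x|)) * (B * (1 + |x|)) := by
          gcongr
          exact hB x
      _ = B * ((1 + |m|) * (1 + |x|) ^ 2) := by ring
      _ ≤ _ := by
          gcongr
          nlinarith [sq_nonneg (|x| - 1), sq_abs x]
  have hparts : ∫ x, (Real.exp (-U x) - (x - m) * U' x * Real.exp (-U x)) = 0 := by
    refine integral_eq_zero_of_hasDerivAt_of_integrable (f := fun x => (x - m) * Real.exp (-U x))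
      (fun x => ?_) (h.integrable_exp.sub iU) i1
    have := ((hasDerivAt_id x).sub_const m).mul ((h.deriv x).neg.exp)
    refine this.congr_deriv ?_
    simp; ring
  rw [integral_sub h.integrable_exp iU, sub_eq_zero] at hparts
  refine ⟨m, ?_⟩
  have h2 : ∫ x, ((x - m) * U' x * Real.exp (-U x) - U' m * ((x - m) * Real.exp (-U x))) = Z := by
    rw [integral_sub iU (i1.const_mul _), integral_const_mul, h1, ← hparts]; ring
  rw [← integral_const_mul, ← h2]
  refine integral_mono (i2.const_mul _) (iU.sub (i1.const_mul _)) fun x => ?_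
  have h3 := mul_le_mul_of_nonneg_right (h.mono x m) (Real.exp_pos (-U x)).le
  simp only
  linarith

/-- The variance of f is at most its second moment around f(m), hence at most L² times that of the
identity, that is L²/κ after normalisation. The mean absolute deviation is then at most L/√κ. -/
lemma StrongPot.integral_abs_sub_le {κ : ℝ} {U U' : ℝ → ℝ} (h : StrongPot κ U U') (hκ : 0 < κ)
    {f : ℝ → ℝ} {L : ℝ} (hL : 0 < L) (hf : ∀ x y, |f x - f y| ≤ L * |x - y|)
    {B : ℝ} (hB : ∀ x, |f x| ≤ B) (hfc : Continuous f) :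
    ∫ x, |f x - (∫ y, f y * Real.exp (-U y)) / ∫ y, Real.exp (-U y)| * Real.exp (-U x) ≤
      L / √κ * ∫ x, Real.exp (-U x) := by
  obtain ⟨m, hm⟩ := h.exists_variance_le
  have hZ := integral_exp_pos' h.integrable_exp
  have hfi : ∀ g : ℝ → ℝ, Continuous g → (∃ D, ∀ x, |g x| ≤ D) →
      Integrable fun x => g x * Real.exp (-U x) := fun g hg ⟨D, hD⟩ =>
    h.integrable_exp.bdd_mul (c := D) hg.aestronglyMeasurable (ae_of_all _ fun x => by
      simpa using hD x)
  set Z := ∫ x, Real.exp (-U x) with hZd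
  set E := (∫ y, f y * Real.exp (-U y)) / Z with hE
  have hB0 : 0 ≤ B := (abs_nonneg _).trans (hB 0)
  have hb : ∀ c : ℝ, ∀ x, |f x - c| ≤ B + |c| := fun c x =>
    (abs_sub _ _).trans (by linarith [hB x])
  have i2 : ∀ c, Integrable fun x => (f x - c) ^ 2 * Real.exp (-U x) := fun c =>
    hfi (fun x => (f x - c) ^ 2) (by fun_prop) ⟨(B + |c|) ^ 2, fun x => by
      rw [abs_pow]; exact pow_le_pow_left₀ (abs_nonneg _) (hb c x) 2⟩
  have i1 : Integrable fun x => |f x - E| * Real.exp (-U x) :=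
    hfi (fun x => |f x - E|) (by fun_prop) ⟨B + |E|, fun x => by rw [abs_abs]; exact hb E x⟩
  have ifx := hfi f hfc ⟨B, hB⟩
  have hEE : ∫ x, f x * Real.exp (-U x) = E * Z := by rw [hE]; field_simp
  have hvar : ∫ x, (f x - E) ^ 2 * Real.exp (-U x) ≤
      ∫ x, (f x - f m) ^ 2 * Real.exp (-U x) := by
    have e : ∀ x, (f x - f m) ^ 2 * Real.exp (-U x) = (f x - E) ^ 2 * Real.exp (-U x) +
        (2 * (E - f m) * (f x * Real.exp (-U x)) +
          (f m ^ 2 - E ^ 2) * Real.exp (-U x)) := fun x => by ring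
    simp_rw [e]
    have i4 : Integrable fun x => 2 * (E - f m) * (f x * Real.exp (-U x)) +
        (f m ^ 2 - E ^ 2) * Real.exp (-U x) :=
      (ifx.const_mul _).add (h.integrable_exp.const_mul _)
    rw [integral_add (i2 E) i4,
      integral_add (ifx.const_mul _) (h.integrable_exp.const_mul _), integral_const_mul,
      integral_const_mul, hEE]
    have : 0 ≤ (E - f m) ^ 2 * Z := by positivity
    nlinarith
  have i3 : Integrable fun x => (x - m) ^ 2 * Real.exp (-U x) := by
    have := ((h.integrable_pow 2).sub (h.integrable_id_exp.const_mul (2 * m))).add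
      (h.integrable_exp.const_mul (m ^ 2))
    refine this.congr (ae_of_all _ fun x => ?_)
    simp only [Pi.add_apply, Pi.sub_apply]; ring
  have hlip : ∫ x, (f x - f m) ^ 2 * Real.exp (-U x) ≤
      L ^ 2 * ∫ x, (x - m) ^ 2 * Real.exp (-U x) := by
    rw [← integral_const_mul]
    refine integral_mono (i2 _) (i3.const_mul _) fun x => ?_
    simp only
    rw [← mul_assoc]
    refine mul_le_mul_of_nonneg_right ?_ (Real.exp_pos _).le
    have := pow_le_pow_left₀ (abs_nonneg _) (hf x m) 2
    rwa [mul_pow, sq_abs, sq_abs] at this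
  have hV : ∫ x, (f x - E) ^ 2 * Real.exp (-U x) ≤ (L / √κ) ^ 2 * Z := by
    rw [div_pow, Real.sq_sqrt hκ.le]
    calc _ ≤ L ^ 2 * ∫ x, (x - m) ^ 2 * Real.exp (-U x) := hvar.trans hlip
      _ = L ^ 2 / κ * (κ * ∫ x, (x - m) ^ 2 * Real.exp (-U x)) := by field_simp
      _ ≤ _ := by gcongr
  set s := L / √κ with hs
  have hs0 : 0 < s := div_pos hL (Real.sqrt_pos.2 hκ)
  -- In place of Cauchy–Schwarz: |y| ≤ s/2 + y²/(2s), with s = L/√κ the bound on the standard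
  -- deviation.
  have hAM : ∫ x, |f x - E| * Real.exp (-U x) ≤
      ∫ x, (s / 2 * Real.exp (-U x) + 1 / (2 * s) * ((f x - E) ^ 2 * Real.exp (-U x))) := by
    refine integral_mono i1 ((h.integrable_exp.const_mul _).add ((i2 E).const_mul _)) fun x => ?_
    simp only
    rw [← mul_assoc, ← add_mul]
    refine mul_le_mul_of_nonneg_right ?_ (Real.exp_pos _).le
    rw [← sq_abs (f x - E)]
    have : 0 ≤ (|f x - E| - s) ^ 2 / (2 * s) := by positivity
    have e : s / 2 + 1 / (2 * s) * |f x - E| ^ 2 - |f x - E| = (|f x - E| - s) ^ 2 / (2 * s) := by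
      field_simp; ring
    linarith
  rw [integral_add (h.integrable_exp.const_mul _) ((i2 E).const_mul _), integral_const_mul,
    integral_const_mul] at hAM
  refine hAM.trans ?_
  have := mul_le_mul_of_nonneg_left hV (show 0 ≤ 1 / (2 * s) by positivity)
  have e : 1 / (2 * s) * (s ^ 2 * Z) = s / 2 * Z := by field_simp
  linarith

/-- The weight s serves twice: s = 1 gives the normalising constant, and a sign function gives the
functional that computes an L¹ norm. -/
lemma hasDerivAt_integral_exp_tilt {U f s : ℝ → ℝ} {B : ℝ}
    (hU : Integrable fun x => Real.exp (-U x)) (hfc : Continuous f) (hB : ∀ x, |f x| ≤ B)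
    (hs : Measurable s) (hs1 : ∀ x, |s x| ≤ 1) (t : ℝ) :
    HasDerivAt (fun t => ∫ x, s x * Real.exp (-(U x + t * f x)))
      (∫ x, s x * (-f x * Real.exp (-(U x + t * f x)))) t := by
  have hB0 : 0 ≤ B := (abs_nonneg _).trans (hB 0)
  have hbd : ∀ r ∈ Metric.ball t 1, ∀ x, Real.exp (-(U x + r * f x)) ≤
      Real.exp ((|t| + 1) * B) * Real.exp (-U x) := fun r hr x => by
    rw [← Real.exp_add]
    refine Real.exp_le_exp.2 ?_
    have h1 : |r| ≤ |t| + 1 := by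
      have h2 : |r - t| < 1 := by simpa [Real.dist_eq] using hr
      have h3 := abs_sub_abs_le_abs_sub r t
      linarith
    have h2 : |r * f x| ≤ (|t| + 1) * B := by
      rw [abs_mul]; exact mul_le_mul h1 (hB x) (abs_nonneg _) (by positivity)
    linarith [neg_abs_le (r * f x)]
  have hmeas : ∀ r : ℝ, AEStronglyMeasurable (fun x => Real.exp (-(U x + r * f x))) volume :=
    fun r => by
    have : (fun x => Real.exp (-(U x + r * f x))) =
        fun x => Real.exp (-U x) * Real.exp (-(r * f x)) := by
      ext x; rw [← Real.exp_add]; ring_nf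
    rw [this]
    exact hU.aestronglyMeasurable.mul (Continuous.aestronglyMeasurable (by fun_prop))
  have hm2 : ∀ r : ℝ, AEStronglyMeasurable (fun x => s x * Real.exp (-(U x + r * f x))) volume :=
    fun r => hs.aestronglyMeasurable.mul (hmeas r)
  refine (hasDerivAt_integral_of_dominated_loc_of_deriv_le (Metric.ball_mem_nhds t one_pos)
    (F := fun t x => s x * Real.exp (-(U x + t * f x)))
    (F' := fun t x => s x * (-f x * Real.exp (-(U x + t * f x))))
    (bound := fun x => B * (Real.exp ((|t| + 1) * B) * Real.exp (-U x)))
    (Eventually.of_forall hm2) ?_ ?_ (ae_of_all _ fun x r hr => ?_)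
    ((hU.const_mul _).const_mul _) (ae_of_all _ fun x r _ => ?_)).2
  · refine ((hU.const_mul (Real.exp ((|t| + 1) * B)))).mono' (hm2 t) (ae_of_all _ fun x => ?_)
    rw [norm_mul, Real.norm_of_nonneg (Real.exp_pos _).le]
    refine le_trans ?_ (hbd t (Metric.mem_ball_self one_pos) x)
    exact mul_le_of_le_one_left (Real.exp_pos _).le (hs1 x)
  · exact hs.aestronglyMeasurable.mul (hfc.neg.aestronglyMeasurable.mul (hmeas t))
  · rw [norm_mul, norm_mul, Real.norm_of_nonneg (Real.exp_pos _).le, norm_neg]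
    refine (mul_le_of_le_one_left (by positivity) (hs1 x)).trans ?_
    exact mul_le_mul (hB x) (hbd r hr x) (Real.exp_pos _).le hB0
  · have h1 : HasDerivAt (fun t => -(U x + t * f x)) (-f x) r := by
      refine HasDerivAt.congr_deriv (((hasDerivAt_id r).mul_const (f x)).const_add (U x)).neg ?_
      simp
    refine (h1.exp.const_mul (s x)).congr_deriv ?_
    ring

lemma integrable_gibbs {U : ℝ → ℝ} (h : Integrable fun x => Real.exp (-U x)) :
    Integrable (gibbs U) := h.const_mul _

lemma integral_gibbs {U : ℝ → ℝ} (h : Integrable fun x => Real.exp (-U x)) :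
    ∫ x, gibbs U x = 1 := by
  unfold gibbs
  rw [integral_const_mul, inv_mul_cancel₀ (integral_exp_pos' h).ne']

lemma gibbs_nonneg (U : ℝ → ℝ) (x : ℝ) : 0 ≤ gibbs U x :=
  mul_nonneg (inv_nonneg.2 (integral_nonneg fun _ => (Real.exp_pos _).le)) (Real.exp_pos _).le

/-- Two Gibbs densities of strongly convex potentials whose difference is `L`-Lipschitz are at
`L¹`-distance at most `L / √κ`. -/
theorem integral_abs_gibbs_sub_le {κ : ℝ} (hκ : 0 < κ) {U U' V V' : ℝ → ℝ}
    (hU : StrongPot κ U U') (hV : StrongPot κ V V') {L : ℝ} (hL : ∀ x, |V' x - U' x| ≤ L)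
    {B : ℝ} (hB : ∀ x, |V x - U x| ≤ B) :
    ∫ x, |gibbs V x - gibbs U x| ≤ L / √κ := by
  have hκ' := Real.sqrt_pos.2 hκ
  rw [le_div_iff₀ hκ']
  -- Any L' > L is positive, as `StrongPot.integral_abs_sub_le` requires; L itself may vanish.
  refine le_of_forall_gt_imp_ge_of_dense fun L' hL' => ?_
  rw [← le_div_iff₀ hκ']
  have hL0 : 0 < L' := ((abs_nonneg _).trans (hL 0)).trans_lt hL'
  set f : ℝ → ℝ := fun x => V x - U x with hf
  have hfc : Continuous f := hV.continuous.sub hU.continuous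
  have hflip : ∀ x y, |f x - f y| ≤ L' * |x - y| := fun x y => by
    have := Convex.norm_image_sub_le_of_norm_hasDerivWithin_le (f := f)
      (f' := fun x => V' x - U' x) (s := Set.univ) (C := L') (x := y) (y := x)
      (fun z _ => ((hV.deriv z).sub (hU.deriv z)).hasDerivWithinAt)
      (fun z _ => (hL z).trans hL'.le) convex_univ trivial trivial
    simpa using this
  let d : ℝ → ℝ := fun x => gibbs V x - gibbs U x
  have hcU : Continuous fun x => Real.exp (-U x) := Real.continuous_exp.comp hU.continuous.neg
  have hcV : Continuous fun x => Real.exp (-V x) := Real.continuous_exp.comp hV.continuous.neg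
  have hdc : Continuous d := (continuous_const.mul hcV).sub (continuous_const.mul hcU)
  -- The sign of the final difference, kept fixed along the whole path, so that the increment of ∫ s
  -- dγ_t is exactly the L¹ distance.
  let s : ℝ → ℝ := fun x => if 0 ≤ d x then 1 else -1
  have hs : Measurable s := Measurable.ite (measurableSet_le measurable_const hdc.measurable)
    measurable_const measurable_const
  have hs1 : ∀ x, |s x| ≤ 1 := fun x => by
    simp only [s]; split_ifs <;> simp
  have hsd : ∀ x, s x * d x = |d x| := fun x => by
    simp only [s]; split_ifs with h
    · rw [one_mul, abs_of_nonneg h]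
    · rw [abs_of_neg (not_le.1 h)]; ring
  let Z : ℝ → ℝ := fun t => ∫ x, Real.exp (-(U x + t * f x))
  let N : ℝ → ℝ := fun t => ∫ x, s x * Real.exp (-(U x + t * f x))
  have hseg : ∀ t ∈ Set.Icc (0 : ℝ) 1, StrongPot κ (fun x => U x + t * f x)
      (fun x => U' x + t * (V' x - U' x)) := fun t ht => hU.segment hV ht.1 ht.2
  have hZpos : ∀ t ∈ Set.Icc (0 : ℝ) 1, 0 < Z t := fun t ht =>
    integral_exp_pos' (hseg t ht).integrable_exp
  have hN' : ∀ t, HasDerivAt N (∫ x, s x * (-f x * Real.exp (-(U x + t * f x)))) t := fun t =>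
    hasDerivAt_integral_exp_tilt hU.integrable_exp hfc hB hs hs1 t
  have hZ' : ∀ t, HasDerivAt Z (∫ x, -f x * Real.exp (-(U x + t * f x))) t := fun t => by
    simpa only [one_mul] using hasDerivAt_integral_exp_tilt (s := fun _ => 1) hU.integrable_exp hfc hB
      measurable_const (by simp) t
  -- The derivative of N/Z is minus the covariance of s and f under the Gibbs law at time t. After
  -- centring f at its mean E, the bound |s| ≤ 1 leaves the mean absolute deviation of f.
  have hG : ∀ t ∈ Set.Icc (0 : ℝ) 1, ‖((∫ x, s x * (-f x * Real.exp (-(U x + t * f x)))) * Z t -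
      N t * ∫ x, -f x * Real.exp (-(U x + t * f x))) / Z t ^ 2‖ ≤ L' / √κ := fun t ht => by
    have hp := hseg t ht
    have hZt := hZpos t ht
    have hkey := hp.integral_abs_sub_le hκ hL0 hflip hB hfc
    set E := (∫ y, f y * Real.exp (-(U y + t * f y))) / ∫ y, Real.exp (-(U y + t * f y)) with hE
    have hZE : ∫ x, -f x * Real.exp (-(U x + t * f x)) = -(E * Z t) := by
      simp_rw [neg_mul]; rw [integral_neg, hE, div_mul_cancel₀ _ hZt.ne']
    have isx : Integrable fun x => s x * Real.exp (-(U x + t * f x)) :=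
      hp.integrable_exp.bdd_mul (c := 1) hs.aestronglyMeasurable (ae_of_all _ hs1)
    have isf : Integrable fun x => s x * (-f x * Real.exp (-(U x + t * f x))) :=
      (hp.integrable_exp.bdd_mul (c := B) hfc.neg.aestronglyMeasurable (ae_of_all _ fun x => by
        simpa using hB x)).bdd_mul (c := 1) hs.aestronglyMeasurable (ae_of_all _ hs1)
    have e1 : (∫ x, s x * (-f x * Real.exp (-(U x + t * f x)))) * Z t -
        N t * ∫ x, -f x * Real.exp (-(U x + t * f x)) =
        (∫ x, s x * (-(f x - E) * Real.exp (-(U x + t * f x)))) * Z t := by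
      rw [hZE]
      have : ∫ x, s x * (-(f x - E) * Real.exp (-(U x + t * f x))) =
          (∫ x, s x * (-f x * Real.exp (-(U x + t * f x)))) + E * N t := by
        rw [← integral_const_mul, ← integral_add isf (isx.const_mul E)]
        congr 1; ext x; ring
      rw [this]; ring
    rw [e1, pow_two, mul_div_mul_right _ _ hZt.ne', norm_div, Real.norm_of_nonneg hZt.le,
      div_le_iff₀ hZt]
    refine le_trans ?_ hkey
    refine norm_integral_le_of_norm_le ?_ (ae_of_all _ fun x => ?_)
    · refine hp.integrable_exp.bdd_mul (c := B + |E|)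
        (Continuous.aestronglyMeasurable (by fun_prop)) (ae_of_all _ fun x => ?_)
      rw [Real.norm_eq_abs, abs_abs]
      exact (abs_sub _ _).trans (by linarith [hB x])
    · rw [norm_mul, norm_mul, norm_neg, Real.norm_of_nonneg (Real.exp_pos _).le]
      exact mul_le_of_le_one_left (by positivity) (hs1 x)
  have hmvt := norm_image_sub_le_of_norm_deriv_le_segment_01' (f := fun t => N t / Z t)
    (fun t ht => ((hN' t).div (hZ' t) (hZpos t ht).ne').hasDerivWithinAt)
    (fun t ht => hG t ⟨ht.1, ht.2.le⟩)
  have h1 : N 1 / Z 1 = ∫ x, s x * gibbs V x := by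
    have e : ∀ x, U x + 1 * f x = V x := fun x => by simp [hf]
    simp only [N, Z, e, gibbs]
    rw [div_eq_inv_mul, ← integral_const_mul]
    congr 1; ext x; ring
  have h0 : N 0 / Z 0 = ∫ x, s x * gibbs U x := by
    have e : ∀ x, U x + 0 * f x = U x := fun x => by simp
    simp only [N, Z, e, gibbs]
    rw [div_eq_inv_mul, ← integral_const_mul]
    congr 1; ext x; ring
  have isV : Integrable fun x => s x * gibbs V x :=
    (integrable_gibbs hV.integrable_exp).bdd_mul (c := 1) hs.aestronglyMeasurable (ae_of_all _ hs1)
  have isU : Integrable fun x => s x * gibbs U x :=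
    (integrable_gibbs hU.integrable_exp).bdd_mul (c := 1) hs.aestronglyMeasurable (ae_of_all _ hs1)
  simp only [h1, h0] at hmvt
  rw [← integral_sub isV isU] at hmvt
  have e : ∀ x, s x * gibbs V x - s x * gibbs U x = |gibbs V x - gibbs U x| := fun x => by
    rw [← mul_sub]; exact hsd x
  simp_rw [e] at hmvt
  exact (le_abs_self _).trans hmvt

/-! ### Convolutions -/

lemma integrable_mul_of_bdd {K ρ : ℝ → ℝ} (hK : Continuous K) {B : ℝ} (hB : ∀ x, |K x| ≤ B)
    (hρ : Integrable ρ) (x : ℝ) : Integrable fun y => K (x - y) * ρ y :=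
  hρ.bdd_mul (c := B) (Continuous.aestronglyMeasurable (by fun_prop))
    (ae_of_all _ fun y => by simpa using hB (x - y))

lemma abs_conv_le {K ρ : ℝ → ℝ} {B : ℝ} (hB : ∀ x, |K x| ≤ B) (hρ : Integrable ρ) (x : ℝ) :
    |conv K ρ x| ≤ B * ∫ y, |ρ y| := by
  unfold conv
  rw [← integral_const_mul, ← Real.norm_eq_abs]
  refine norm_integral_le_of_norm_le (hρ.abs.const_mul B) (ae_of_all _ fun y => ?_)
  rw [norm_mul]
  exact mul_le_mul_of_nonneg_right (hB _) (abs_nonneg _)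

lemma conv_sub_right {K μ ν : ℝ → ℝ} (hK : Continuous K) {B : ℝ} (hB : ∀ x, |K x| ≤ B)
    (hμ : Integrable μ) (hν : Integrable ν) (x : ℝ) :
    conv K (fun y => μ y - ν y) x = conv K μ x - conv K ν x := by
  unfold conv
  rw [← integral_sub (integrable_mul_of_bdd hK hB hμ x) (integrable_mul_of_bdd hK hB hν x)]
  congr 1; ext y; ring

lemma conv_add_left {K G μ : ℝ → ℝ} (hK : Continuous K) {B : ℝ} (hB : ∀ x, |K x| ≤ B)
    (hG : Continuous G) {D : ℝ} (hD : ∀ x, |G x| ≤ D) (hμ : Integrable μ) (x : ℝ) :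
    conv (fun y => K y + G y) μ x = conv K μ x + conv G μ x := by
  unfold conv
  rw [← integral_add (integrable_mul_of_bdd hK hB hμ x) (integrable_mul_of_bdd hG hD hμ x)]
  congr 1; ext y; ring

lemma conv_const_left (c : ℝ) (μ : ℝ → ℝ) (x : ℝ) : conv (fun _ => c) μ x = c * ∫ y, μ y := by
  unfold conv; rw [integral_const_mul]

lemma hasDerivAt_conv {K K' ρ : ℝ → ℝ} (hK : ∀ x, HasDerivAt K (K' x) x) (hc : Continuous K')
    {B L : ℝ} (hB : ∀ x, |K x| ≤ B) (hL : ∀ x, |K' x| ≤ L) (hρ : Integrable ρ) (x : ℝ) :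
    HasDerivAt (conv K ρ) (conv K' ρ x) x := by
  have hKc : Continuous K := continuous_iff_continuousAt.2 fun x => (hK x).continuousAt
  refine (hasDerivAt_integral_of_dominated_loc_of_deriv_le (s := Set.univ) univ_mem
    (F := fun x y => K (x - y) * ρ y) (F' := fun x y => K' (x - y) * ρ y)
    (bound := fun y => L * |ρ y|)
    (Eventually.of_forall fun x => (integrable_mul_of_bdd hKc hB hρ x).aestronglyMeasurable)
    (integrable_mul_of_bdd hKc hB hρ x)
    (integrable_mul_of_bdd hc hL hρ x).aestronglyMeasurable (ae_of_all _ fun y x _ => ?_)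
    (hρ.abs.const_mul L) (ae_of_all _ fun y x _ => ?_)).2
  · rw [norm_mul]
    exact mul_le_mul_of_nonneg_right (hL _) (abs_nonneg _)
  · exact ((hK (x - y)).comp_sub_const x y).mul_const _

/-! ### The potentials -/

lemma mul_sq_le_of_le_deriv {f : ℝ → ℝ} (hf : Differentiable ℝ f) {c : ℝ}
    (hc : ∀ x, c ≤ deriv f x) (x y : ℝ) : c * (x - y) ^ 2 ≤ (x - y) * (f x - f y) := by
  rcases le_total y x with h | h
  · have := mul_sub_le_image_sub_of_le_deriv hf hc h
    nlinarith [sub_nonneg.2 h]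
  · have := mul_sub_le_image_sub_of_le_deriv hf hc h
    nlinarith [sub_nonneg.2 h]

lemma IsNonsmoothConfinement.contDiff_two {J : ℕ} {α : ℝ} {Vt : ℝ → ℝ}
    (hV : IsNonsmoothConfinement J α Vt) : ContDiff ℝ 2 Vt :=
  hV.contDiff.of_le (by exact_mod_cast hV.two_le)

lemma iteratedDeriv_two (f : ℝ → ℝ) : iteratedDeriv 2 f = deriv (deriv f) := by
  rw [iteratedDeriv_succ', iteratedDeriv_one]

lemma ContDiff.deriv_two {f : ℝ → ℝ} (hf : ContDiff ℝ 2 f) :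
    Differentiable ℝ f ∧ Differentiable ℝ (deriv f) ∧ Continuous (deriv f) := by
  have h1 : ContDiff ℝ 1 (deriv f) := by
    have : ContDiff ℝ (1 + 1) f := by simpa [one_add_one_eq_two] using hf
    exact ((contDiff_succ_iff_deriv (n := 1)).1 this).2.2
  exact ⟨hf.differentiable (by simp), h1.differentiable (by simp), h1.continuous⟩

lemma IsNonsmoothConfinement.hasDerivAt {J : ℕ} {α : ℝ} {Vt : ℝ → ℝ}
    (hV : IsNonsmoothConfinement J α Vt) (x : ℝ) :
    HasDerivAt (confinement α Vt) (α * x + deriv Vt x) x := by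
  have h := (((hasDerivAt_id x).pow 2).const_mul (α / 2)).add
    (hV.contDiff_two.deriv_two.1 x).hasDerivAt
  refine h.congr_deriv ?_
  simp; ring

lemma IsNonsmoothConfinement.mono {J : ℕ} {α : ℝ} {Vt : ℝ → ℝ}
    (hV : IsNonsmoothConfinement J α Vt) (x y : ℝ) :
    constCV α Vt * (x - y) ^ 2 ≤ (x - y) * ((α * x + deriv Vt x) - (α * y + deriv Vt y)) := by
  have h2 := hV.contDiff_two.deriv_two
  obtain ⟨C, hC⟩ := hV.deriv_bdd 2 le_rfl hV.two_le
  have hb : BddBelow (Set.range fun x => iteratedDeriv 2 Vt x) :=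
    ⟨-C, by rintro _ ⟨x, rfl⟩; exact (abs_le.1 (hC x)).1⟩
  have h3 := mul_sq_le_of_le_deriv h2.2.1 (c := ⨅ x, iteratedDeriv 2 Vt x) (fun x => by
    have := ciInf_le hb x
    rwa [iteratedDeriv_two] at this ⊢) x y
  unfold constCV
  linarith

lemma IsNonsmoothConfinement.confinement_neg {J : ℕ} {α : ℝ} {Vt : ℝ → ℝ}
    (hV : IsNonsmoothConfinement J α Vt) (x : ℝ) :
    confinement α Vt (-x) = confinement α Vt x := by
  unfold confinement; rw [hV.even]; ring

/-- By evenness V'(0) = 0, so V - C_V x²/2 is nondecreasing on the half-line, and it starts from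
V(0) ≥ 0. -/
lemma IsNonsmoothConfinement.coercive {J : ℕ} {α : ℝ} {Vt : ℝ → ℝ}
    (hV : IsNonsmoothConfinement J α Vt) (x : ℝ) :
    constCV α Vt / 2 * x ^ 2 ≤ confinement α Vt x := by
  wlog hx : 0 ≤ x generalizing x
  · have := this (-x) (by linarith)
    rwa [hV.confinement_neg, neg_sq] at this
  have h0 : deriv Vt 0 = 0 := by
    have h1 := deriv_comp_neg Vt 0
    have h2 : (fun x => Vt (-x)) = Vt := funext hV.even
    rw [h2, neg_zero] at h1
    linarith
  have hd : ∀ z, HasDerivAt (fun z => confinement α Vt z - constCV α Vt / 2 * z ^ 2)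
      (α * z + deriv Vt z - constCV α Vt * z) z := fun z => by
    refine ((hV.hasDerivAt z).sub (((hasDerivAt_id z).pow 2).const_mul _)).congr_deriv ?_
    simp; ring
  have hmono : MonotoneOn (fun z => confinement α Vt z - constCV α Vt / 2 * z ^ 2)
      (Set.Ici 0) := by
    refine monotoneOn_of_deriv_nonneg (convex_Ici 0)
      (fun z _ => (hd z).continuousAt.continuousWithinAt)
      (fun z _ => (hd z).differentiableAt.differentiableWithinAt) fun z hz => ?_
    rw [(hd z).deriv]
    have hz' : 0 < z := by simpa using hz
    have := hV.mono z 0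
    rw [h0] at this
    simp only [sub_zero, mul_zero, add_zero] at this
    have h5 : 0 ≤ z * (α * z + deriv Vt z - constCV α Vt * z) := by nlinarith
    exact nonneg_of_mul_nonneg_right h5 hz'
  have h1 := hmono (Set.mem_Ici.2 le_rfl) (Set.mem_Ici.2 hx) hx
  have h2 := hV.nonneg 0
  simp only at h1
  linarith

lemma IsNonsmoothConfinement.growth' {J : ℕ} {α : ℝ} {Vt : ℝ → ℝ}
    (hV : IsNonsmoothConfinement J α Vt) :
    ∃ B, ∀ x, |α * x + deriv Vt x| ≤ B * (1 + |x|) := by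
  have h2 := hV.contDiff_two.deriv_two
  obtain ⟨C, hC⟩ := hV.deriv_bdd 2 le_rfl hV.two_le
  refine ⟨|α| + C + |deriv Vt 0|, fun x => ?_⟩
  have h3 := Convex.norm_image_sub_le_of_norm_deriv_le (f := deriv Vt) (s := Set.univ) (C := C)
    (x := 0) (y := x) (fun z _ => h2.2.1 z) (fun z _ => by
      have := hC z
      rwa [iteratedDeriv_two] at this) convex_univ trivial trivial
  rw [Real.norm_eq_abs, sub_zero, Real.norm_eq_abs] at h3
  have hC0 := (abs_nonneg _).trans (hC 0)
  have h4 : |α * x + deriv Vt x| ≤ |α| * |x| + (|deriv Vt x - deriv Vt 0| + |deriv Vt 0|) := by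
    have e : α * x + deriv Vt x = α * x + ((deriv Vt x - deriv Vt 0) + deriv Vt 0) := by ring
    rw [e, ← abs_mul]
    exact (abs_add_le _ _).trans (by gcongr; exact abs_add_le _ _)
  nlinarith [abs_nonneg x, abs_nonneg α, abs_nonneg (deriv Vt 0)]

section Interaction

variable {α : ℝ} {Vt W : ℝ → ℝ}

lemma IsInteraction.hasDerivAt (hW : IsInteraction α Vt W) (x : ℝ) :
    HasDerivAt W (deriv W x) x := (hW.contDiff.deriv_two.1 x).hasDerivAt

lemma IsInteraction.continuous_deriv (hW : IsInteraction α Vt W) : Continuous (deriv W) :=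
  hW.contDiff.deriv_two.2.2

lemma exists_abs_le_of_integrable_deriv {f : ℝ → ℝ} (hf : Differentiable ℝ f)
    (hi : Integrable (deriv f)) : ∃ B, ∀ x, |f x| ≤ B := by
  refine ⟨|f 0| + ∫ x, |deriv f x|, fun x => ?_⟩
  have h1 := intervalIntegral.integral_deriv_eq_sub (f := f) (a := 0) (b := x)
    (fun z _ => hf z) hi.intervalIntegrable
  have h2 : |f x - f 0| ≤ ∫ x, |deriv f x| := by
    rw [← h1, ← Real.norm_eq_abs]
    refine intervalIntegral.norm_integral_le_integral_norm_uIoc.trans ?_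
    exact setIntegral_le_integral hi.norm (ae_of_all _ fun _ => norm_nonneg _)
  have h3 := abs_add_le (f x - f 0) (f 0)
  rw [sub_add_cancel] at h3
  linarith

lemma IsInteraction.bdd (hW : IsInteraction α Vt W) : ∃ B, ∀ x, |W x| ≤ B :=
  exists_abs_le_of_integrable_deriv hW.contDiff.deriv_two.1 hW.deriv_integrable

lemma IsInteraction.mono (hW : IsInteraction α Vt W) (x y : ℝ) :
    -constCW W * (x - y) ^ 2 ≤ (x - y) * (deriv W x - deriv W y) := by
  obtain ⟨C, hC⟩ := hW.deriv2_bdd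
  have hb : BddBelow (Set.range fun x => iteratedDeriv 2 W x) :=
    ⟨-C, by rintro _ ⟨x, rfl⟩; exact (abs_le.1 (hC x)).1⟩
  refine mul_sq_le_of_le_deriv hW.contDiff.deriv_two.2.1 (fun x => ?_) x y
  have := ciInf_le hb x
  rw [← iteratedDeriv_two]
  unfold constCW
  linarith

end Interaction

/-! ### The self-consistent equation: stability and existence by iteration. -/

/-- `μ` is a probability density. -/
structure IsProbDensity (μ : ℝ → ℝ) : Prop where
  nonneg : ∀ x, 0 ≤ μ x
  integrable : Integrable μ
  integral_eq_one : ∫ x, μ x = 1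

lemma IsProbDensity.integral_abs {μ : ℝ → ℝ} (h : IsProbDensity μ) : ∫ x, |μ x| = 1 := by
  simp_rw [abs_of_nonneg (h.nonneg _)]; exact h.integral_eq_one

/-- The effective potential `2 V + W ⋆ μ`. -/
def pot (V W μ : ℝ → ℝ) (x : ℝ) : ℝ := 2 * V x + conv W μ x

lemma exp_neg_pot (V W μ : ℝ → ℝ) :
    (fun x => Real.exp (-2 * V x - conv W μ x)) = fun x => Real.exp (-pot V W μ x) := by
  ext x; unfold pot; ring_nf

lemma IsInvariantDensity.isProbDensity {V W μ : ℝ → ℝ} (h : IsInvariantDensity V W μ) :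
    IsProbDensity μ := ⟨h.nonneg, h.integrable, h.integral_eq_one⟩

lemma IsInvariantDensity.eq_gibbs {V W μ : ℝ → ℝ} (h : IsInvariantDensity V W μ) :
    μ = gibbs (pot V W μ) := by
  ext x
  have e := exp_neg_pot V W μ
  rw [h.eq x, e, congrFun e x, gibbs]

lemma isInvariantDensity_of_eq_gibbs {V W μ : ℝ → ℝ}
    (hi : Integrable fun x => Real.exp (-pot V W μ x)) (h : μ = gibbs (pot V W μ)) :
    IsInvariantDensity V W μ where
  nonneg x := by rw [h]; exact gibbs_nonneg _ x
  integrable := by rw [h]; exact integrable_gibbs hi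
  integral_eq_one := by rw [h]; exact integral_gibbs hi
  exp_integrable := by rw [exp_neg_pot]; exact hi
  eq x := by
    have e := exp_neg_pot V W μ
    rw [e, congrFun e x]
    exact congrFun h x

/-- Averaging W' over a probability density keeps its one-sided slope bound -C_W, while 2V
contributes 2 C_V. Any smaller κ is allowed, so that one κ can serve two interactions. -/
lemma strongPot_pot {J : ℕ} {α : ℝ} {Vt W μ : ℝ → ℝ} (hV : IsNonsmoothConfinement J α Vt)
    (hW : IsInteraction α Vt W) (hμ : IsProbDensity μ) {κ : ℝ}
    (hκ : κ ≤ 2 * constCV α Vt - constCW W) :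
    StrongPot κ (pot (confinement α Vt) W μ)
      (fun x => 2 * (α * x + deriv Vt x) + conv (deriv W) μ x) := by
  obtain ⟨B, hB⟩ := hW.bdd
  obtain ⟨L, hL⟩ := hW.deriv_bdd
  have hW' := hW.continuous_deriv
  refine ⟨fun x => ((hV.hasDerivAt x).const_mul 2).add
    (hasDerivAt_conv hW.hasDerivAt hW' hB hL hμ.integrable x), ?_, ?_, fun x y => ?_, ?_⟩
  · have h1 := hV.contDiff_two.deriv_two.2.2
    have h2 := continuous_conv hW' hL hμ.integrable
    fun_prop
  · obtain ⟨D, hD⟩ := hV.growth'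
    refine ⟨2 * D + L, fun x => ?_⟩
    have h1 := abs_conv_le hL hμ.integrable x
    rw [hμ.integral_abs, mul_one] at h1
    have h2 := abs_add_le (2 * (α * x + deriv Vt x)) (conv (deriv W) μ x)
    rw [abs_mul, abs_two] at h2
    have h3 := hD x
    have hL0 := (abs_nonneg _).trans (hL 0)
    have h4 := abs_nonneg x
    nlinarith
  · have h1 := hV.mono x y
    have h2 : -constCW W * (x - y) ^ 2 ≤
        (x - y) * (conv (deriv W) μ x - conv (deriv W) μ y) := by
      unfold conv
      have i1 := integrable_mul_of_bdd hW' hL hμ.integrable x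
      have i2 := integrable_mul_of_bdd hW' hL hμ.integrable y
      rw [← integral_sub i1 i2, ← integral_const_mul]
      have : -constCW W * (x - y) ^ 2 = ∫ z, -constCW W * (x - y) ^ 2 * μ z := by
        rw [integral_const_mul, hμ.integral_eq_one, mul_one]
      rw [this]
      refine integral_mono (hμ.integrable.const_mul _) ((i1.sub i2).const_mul _) fun z => ?_
      have h3 := mul_le_mul_of_nonneg_right (hW.mono (x - z) (y - z)) (hμ.nonneg z)
      simp only [sub_sub_sub_cancel_right] at h3
      simp only
      linarith
    have h3 := mul_le_mul_of_nonneg_right hκ (sq_nonneg (x - y))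
    nlinarith
  · refine ⟨constCV α Vt, hV.constCV_pos, B, fun x => ?_⟩
    have h1 := hV.coercive x
    have h2 := abs_conv_le hB hμ.integrable x
    rw [hμ.integral_abs, mul_one] at h2
    have h3 := neg_abs_le (conv W μ x)
    unfold pot
    linarith

lemma isProbDensity_gibbs {κ : ℝ} {U U' : ℝ → ℝ} (h : StrongPot κ U U') :
    IsProbDensity (gibbs U) :=
  ⟨gibbs_nonneg U, integrable_gibbs h.integrable_exp, integral_gibbs h.integrable_exp⟩

/-- Stability of the Gibbs map in the interaction potential and in the density. -/
lemma integral_abs_gibbs_pot_sub_le {J : ℕ} {α : ℝ} {Vt W G μ ν : ℝ → ℝ}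
    (hV : IsNonsmoothConfinement J α Vt) (hW : IsInteraction α Vt W) (hG : IsInteraction α Vt G)
    (hμ : IsProbDensity μ) (hν : IsProbDensity ν) {κ L η : ℝ} (hκ0 : 0 < κ)
    (hκW : κ ≤ 2 * constCV α Vt - constCW W) (hκG : κ ≤ 2 * constCV α Vt - constCW G)
    (hL : ∀ x, |deriv W x| ≤ L) (hη : ∀ x, |conv (fun y => deriv W y - deriv G y) ν x| ≤ η) :
    ∫ x, |gibbs (pot (confinement α Vt) W μ) x - gibbs (pot (confinement α Vt) G ν) x| ≤
      (η + L * ∫ x, |μ x - ν x|) / √κ := by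
  obtain ⟨B, hB⟩ := hW.bdd
  obtain ⟨D, hD⟩ := hG.bdd
  obtain ⟨M, hM⟩ := hG.deriv_bdd
  refine integral_abs_gibbs_sub_le hκ0 (strongPot_pot hV hG hν hκG) (strongPot_pot hV hW hμ hκW)
    (fun x => ?_) (B := B + D) (fun x => ?_)
  · have h1 := conv_sub_right hW.continuous_deriv hL hμ.integrable hν.integrable x
    have h2 := conv_add_left (hW.continuous_deriv) hL hG.continuous_deriv.neg
      (fun x => (abs_neg _).trans_le (hM x)) hν.integrable x
    have h3 : conv (fun y => -deriv G y) ν x = -conv (deriv G) ν x := by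
      unfold conv; rw [← integral_neg]; congr 1; ext y; ring
    have h4 : conv (fun y => deriv W y + -deriv G y) ν x =
        conv (fun y => deriv W y - deriv G y) ν x := by simp_rw [sub_eq_add_neg]
    have h5 := abs_conv_le hL (hμ.integrable.sub hν.integrable) x
    simp only [Pi.sub_apply] at h5
    -- W' ⋆ μ - G' ⋆ ν = (W' - G') ⋆ ν + W' ⋆ (μ - ν). The change of kernel is tested only against
    -- ν, whose Fourier decay can then be exploited; the second term carries the contraction factor.
    have h6 : 2 * (α * x + deriv Vt x) + conv (deriv W) μ x -
        (2 * (α * x + deriv Vt x) + conv (deriv G) ν x) =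
        conv (fun y => deriv W y - deriv G y) ν x + conv (deriv W) (fun y => μ y - ν y) x := by
      have h7 : conv (fun y => deriv W y + -deriv G y) ν x =
        conv (deriv W) ν x + conv (fun y => -deriv G y) ν x := h2
      rw [← h4, h7, h3, h1]; ring
    rw [h6]
    exact (abs_add_le _ _).trans (add_le_add (hη x) h5)
  · have h1 := abs_conv_le hB hμ.integrable x
    have h2 := abs_conv_le hD hν.integrable x
    rw [hμ.integral_abs, mul_one] at h1
    rw [hν.integral_abs, mul_one] at h2
    have e : pot (confinement α Vt) W μ x - pot (confinement α Vt) G ν x =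
        conv W μ x - conv G ν x := by unfold pot; ring
    rw [e]
    exact (abs_sub _ _).trans (add_le_add h1 h2)

/-- Existence of an invariant density by Picard iteration, with a property that is preserved by
the Gibbs map and by dominated pointwise limits. -/
theorem exists_invariantDensity {J : ℕ} {α : ℝ} {Vt W μ₀ : ℝ → ℝ}
    (hV : IsNonsmoothConfinement J α Vt) (hW : IsInteraction α Vt W) {L : ℝ}
    (hL : ∀ x, |deriv W x| ≤ L) (hlt : L < √(2 * constCV α Vt - constCW W))
    (P : (ℝ → ℝ) → Prop) (hμ₀ : IsProbDensity μ₀) (hP₀ : P μ₀)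
    (hPs : ∀ μ, IsProbDensity μ → P μ → P (gibbs (pot (confinement α Vt) W μ)))
    (hPc : ∀ (u : ℕ → ℝ → ℝ) (μ g : ℝ → ℝ), Integrable g → (∀ n, IsProbDensity (u n)) →
      (∀ n, P (u n)) → (∀ n x, |u n x| ≤ g x) →
      (∀ x, Tendsto (fun n => u n x) atTop (nhds (μ x))) → P μ) :
    ∃ μ, IsInvariantDensity (confinement α Vt) W μ ∧ P μ := by
  obtain ⟨B, hB⟩ := hW.bdd
  have hWc : Continuous W := hW.contDiff.continuous
  set V := confinement α Vt with hVd
  set κ := 2 * constCV α Vt - constCW W with hκ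
  have hL0 : 0 ≤ L := (abs_nonneg _).trans (hL 0)
  have hκs : 0 < √κ := hL0.trans_lt hlt
  have hκ0 : 0 < κ := Real.sqrt_pos.1 hκs
  set q := L / √κ with hq
  have hq1 : q < 1 := (div_lt_one hκs).2 hlt
  let u : ℕ → ℝ → ℝ := fun n => (fun μ => gibbs (pot V W μ))^[n] μ₀
  have us : ∀ n, u (n + 1) = gibbs (pot V W (u n)) := fun n => Function.iterate_succ_apply' _ _ _
  have hu : ∀ n, IsProbDensity (u n) := fun n => by
    induction n with
    | zero => exact hμ₀
    | succ n ih => rw [us]; exact isProbDensity_gibbs (strongPot_pot hV hW ih le_rfl)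
  have hPu : ∀ n, P (u n) := fun n => by
    induction n with
    | zero => exact hP₀
    | succ n ih => rw [us]; exact hPs _ (hu n) ih
  have hcontr : ∀ n, ∫ x, |u (n + 1) x - u n x| ≤ (∫ x, |u 1 x - u 0 x|) * q ^ n := fun n => by
    induction n with
    | zero => simp
    | succ n ih =>
      have h := integral_abs_gibbs_pot_sub_le hV hW hW (hu (n + 1)) (hu n) hκ0 le_rfl le_rfl hL
        (η := 0) (fun x => by simp [conv])
      rw [zero_add, mul_div_right_comm] at h
      rw [us (n + 1)]
      conv_lhs => rw [us n]
      rw [us n] at h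
      refine h.trans ?_
      rw [us n] at ih
      calc q * _ ≤ q * ((∫ x, |u 1 x - u 0 x|) * q ^ n) := by gcongr
        _ = _ := by ring
  -- Since W is bounded, L¹ contraction gives geometric pointwise convergence of W ⋆ uₙ. The limit
  -- potential defines the candidate density, and dominated convergence then identifies that
  -- potential with W ⋆ μ.
  let f : ℕ → ℝ → ℝ := fun n => conv W (u n)
  have hfB : ∀ n x, |f n x| ≤ B := fun n x => by
    have := abs_conv_le hB (hu n).integrable x
    rwa [(hu n).integral_abs, mul_one] at this
  have hB0 : 0 ≤ B := (abs_nonneg _).trans (hB 0)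
  have hcau : ∀ x, ∃ y, Tendsto (fun n => f n x) atTop (nhds y) := fun x => by
    refine cauchySeq_tendsto_of_complete (cauchySeq_of_le_geometric q
      (B * ∫ x, |u 1 x - u 0 x|) hq1 fun n => ?_)
    rw [dist_comm, Real.dist_eq]
    have h1 := conv_sub_right hWc hB (hu (n + 1)).integrable (hu n).integrable x
    have h2 := abs_conv_le hB ((hu (n + 1)).integrable.sub (hu n).integrable) x
    simp only [Pi.sub_apply] at h2
    have h3 : f (n + 1) x - f n x = conv W (fun y => u (n + 1) y - u n y) x := h1.symm
    rw [h3, mul_assoc]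
    exact h2.trans (mul_le_mul_of_nonneg_left (hcontr n) hB0)
  choose F hF using hcau
  have hiV : Integrable fun x => Real.exp (-(2 * V x)) := by
    have h := (strongPot_pot hV hW hμ₀ le_rfl).integrable_exp
    refine (h.const_mul (Real.exp B)).mono' ?_ (ae_of_all _ fun x => ?_)
    · have : Continuous V := continuous_iff_continuousAt.2 fun x => (hV.hasDerivAt x).continuousAt
      exact Continuous.aestronglyMeasurable (by fun_prop)
    · rw [Real.norm_of_nonneg (Real.exp_pos _).le, ← Real.exp_add]
      refine Real.exp_le_exp.2 ?_
      have := (abs_le.1 (hfB 0 x)).2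
      have h0 : f 0 x = conv W μ₀ x := rfl
      simp only [pot]
      linarith
  have hpt : ∀ x, Tendsto (fun n => Real.exp (-(pot V W (u n) x))) atTop
      (nhds (Real.exp (-(2 * V x + F x)))) := fun x =>
    (Real.continuous_exp.tendsto _).comp ((tendsto_const_nhds.add (hF x)).neg)
  have hdom : ∀ n x, Real.exp (-(pot V W (u n) x)) ≤ Real.exp B * Real.exp (-(2 * V x)) :=
    fun n x => by
    rw [← Real.exp_add]
    refine Real.exp_le_exp.2 ?_
    have := (abs_le.1 (hfB n x)).1
    have h0 : f n x = conv W (u n) x := rfl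
    simp only [pot]
    linarith
  have hmeas : ∀ n, AEStronglyMeasurable (fun x => Real.exp (-(pot V W (u n) x))) volume :=
    fun n => (strongPot_pot hV hW (hu n) le_rfl).integrable_exp.aestronglyMeasurable
  have hZ : Tendsto (fun n => ∫ x, Real.exp (-(pot V W (u n) x))) atTop
      (nhds (∫ x, Real.exp (-(2 * V x + F x)))) :=
    tendsto_integral_of_dominated_convergence _ hmeas (hiV.const_mul (Real.exp B))
      (fun n => ae_of_all _ fun x => by
        rw [Real.norm_of_nonneg (Real.exp_pos _).le]; exact hdom n x) (ae_of_all _ hpt)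
  have hFB : ∀ x, |F x| ≤ B := fun x =>
    le_of_tendsto ((hF x).abs) (Eventually.of_forall fun n => hfB n x)
  have hlow : Integrable fun x => Real.exp (-(2 * V x + F x)) := by
    refine (hiV.const_mul (Real.exp B)).mono'
      (aestronglyMeasurable_of_tendsto_ae atTop hmeas (ae_of_all _ hpt)) (ae_of_all _ fun x => ?_)
    rw [Real.norm_of_nonneg (Real.exp_pos _).le, ← Real.exp_add]
    refine Real.exp_le_exp.2 ?_
    have := (abs_le.1 (hFB x)).1
    linarith
  set Z := ∫ x, Real.exp (-(2 * V x + F x)) with hZd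
  have hZ0 : 0 < Z := integral_exp_pos' hlow
  let μ : ℝ → ℝ := gibbs fun x => 2 * V x + F x
  have hlim : ∀ x, Tendsto (fun n => u (n + 1) x) atTop (nhds (μ x)) := fun x => by
    have h := (hZ.inv₀ hZ0.ne').mul (hpt x)
    refine h.congr fun n => ?_
    rw [us n]; rfl
  set Z0 := ∫ x, Real.exp (-(2 * V x)) with hZ0d
  have hZ0p : 0 < Z0 := integral_exp_pos' hiV
  -- One integrable majorant for all iterates: |W ⋆ uₙ| ≤ B changes both numerator and normaliser by
  -- at most a factor exp(B). The index starts at 1 because u 0 = μ₀ need not be a Gibbs density.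
  have hg : ∀ n x, |u (n + 1) x| ≤
      (Real.exp (-B) * Z0)⁻¹ * (Real.exp B * Real.exp (-(2 * V x))) := fun n x => by
    rw [abs_of_nonneg ((hu (n + 1)).nonneg x), us n]
    unfold gibbs
    refine mul_le_mul ?_ (hdom n x) (Real.exp_pos _).le (by positivity)
    refine inv_anti₀ (by positivity) ?_
    rw [hZ0d, ← integral_const_mul]
    refine integral_mono (hiV.const_mul _) (strongPot_pot hV hW (hu n) le_rfl).integrable_exp
      fun y => ?_
    simp only
    rw [← Real.exp_add]
    refine Real.exp_le_exp.2 ?_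
    have := (abs_le.1 (hfB n y)).2
    have h0 : f n y = conv W (u n) y := rfl
    simp only [pot]
    linarith
  have hgi : Integrable fun x => (Real.exp (-B) * Z0)⁻¹ * (Real.exp B * Real.exp (-(2 * V x))) :=
    (hiV.const_mul _).const_mul _
  have hFc : ∀ x, F x = conv W μ x := fun x => by
    refine tendsto_nhds_unique ((tendsto_add_atTop_iff_nat 1).2 (hF x)) ?_
    refine tendsto_integral_of_dominated_convergence
      (fun y => B * ((Real.exp (-B) * Z0)⁻¹ * (Real.exp B * Real.exp (-(2 * V y)))))
      (fun n => (integrable_mul_of_bdd hWc hB (hu (n + 1)).integrable x).aestronglyMeasurable)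
      (hgi.const_mul B) (fun n => ae_of_all _ fun y => ?_)
      (ae_of_all _ fun y => (hlim y).const_mul _)
    rw [norm_mul]
    exact mul_le_mul (hB _) (hg n y) (abs_nonneg _) hB0
  have hpot : (fun x => 2 * V x + F x) = pot V W μ := by ext x; rw [hFc x]; rfl
  refine ⟨μ, isInvariantDensity_of_eq_gibbs ?_ ?_, ?_⟩
  · rw [← hpot]; exact hlow
  · exact congrArg gibbs hpot
  · exact hPc (fun n => u (n + 1)) μ _ hgi (fun n => hu (n + 1)) (fun n => hPu (n + 1)) hg hlim

/-! ### Modulated Gaussians -/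

/-- The modulated Gaussian `A cos(T x) exp(-x²/2)`. -/
def gaussCos (A T x : ℝ) : ℝ := A * (Real.cos (T * x) * Real.exp (-x ^ 2 / 2))

/-- The derivative of `gaussCos`. -/
def gaussCos' (A T x : ℝ) : ℝ :=
  A * ((-T * Real.sin (T * x) - x * Real.cos (T * x)) * Real.exp (-x ^ 2 / 2))

/-- The second derivative of `gaussCos`. -/
def gaussCos'' (A T x : ℝ) : ℝ :=
  A * ((-T ^ 2 * Real.cos (T * x) + 2 * T * x * Real.sin (T * x) +
    (x ^ 2 - 1) * Real.cos (T * x)) * Real.exp (-x ^ 2 / 2))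

lemma hasDerivAt_exp_neg_sq_half (x : ℝ) :
    HasDerivAt (fun x => Real.exp (-x ^ 2 / 2)) (-x * Real.exp (-x ^ 2 / 2)) x := by
  have h : HasDerivAt (fun x : ℝ => -x ^ 2 / 2) (-x) x := by
    refine (((hasDerivAt_id x).pow 2).neg.div_const 2).congr_deriv ?_
    simp; ring
  exact h.exp.congr_deriv (by ring)

lemma hasDerivAt_cos_mul (T x : ℝ) :
    HasDerivAt (fun x => Real.cos (T * x)) (-T * Real.sin (T * x)) x := by
  have h := ((hasDerivAt_id x).const_mul T).cos
  refine h.congr_deriv ?_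
  simp; ring

lemma hasDerivAt_sin_mul (T x : ℝ) :
    HasDerivAt (fun x => Real.sin (T * x)) (T * Real.cos (T * x)) x := by
  have h := ((hasDerivAt_id x).const_mul T).sin
  refine h.congr_deriv ?_
  simp; ring

lemma hasDerivAt_gaussCos (A T x : ℝ) : HasDerivAt (gaussCos A T) (gaussCos' A T x) x := by
  refine (((hasDerivAt_cos_mul T x).mul (hasDerivAt_exp_neg_sq_half x)).const_mul A).congr_deriv ?_
  unfold gaussCos'; ring

lemma hasDerivAt_gaussCos' (A T x : ℝ) : HasDerivAt (gaussCos' A T) (gaussCos'' A T x) x := by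
  have h1 := ((hasDerivAt_sin_mul T x).const_mul (-T)).sub
    ((hasDerivAt_id x).mul (hasDerivAt_cos_mul T x))
  refine ((h1.mul (hasDerivAt_exp_neg_sq_half x)).const_mul A).congr_deriv ?_
  simp only [gaussCos'', id, Pi.sub_apply, Pi.mul_apply]; ring

lemma deriv_gaussCos (A T : ℝ) : deriv (gaussCos A T) = gaussCos' A T :=
  funext fun x => (hasDerivAt_gaussCos A T x).deriv

lemma iteratedDeriv_two_gaussCos (A T : ℝ) : iteratedDeriv 2 (gaussCos A T) = gaussCos'' A T := by
  rw [iteratedDeriv_two, deriv_gaussCos]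
  exact funext fun x => (hasDerivAt_gaussCos' A T x).deriv

lemma contDiff_gaussCos (A T : ℝ) {n : WithTop ℕ∞} : ContDiff ℝ n (gaussCos A T) := by
  unfold gaussCos; fun_prop

lemma continuous_gaussCos' (A T : ℝ) : Continuous (gaussCos' A T) := by
  unfold gaussCos'; fun_prop

lemma gaussCos_neg (A T x : ℝ) : gaussCos A T (-x) = gaussCos A T x := by
  simp [gaussCos]

lemma abs_gaussCos_le {A : ℝ} (hA : 0 ≤ A) (T x : ℝ) :
    |gaussCos A T x| ≤ A * Real.exp (-x ^ 2 / 2) := by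
  unfold gaussCos
  rw [abs_mul, abs_mul, abs_of_nonneg hA, abs_of_pos (Real.exp_pos _)]
  have := mul_le_of_le_one_left (Real.exp_pos (-x ^ 2 / 2)).le (Real.abs_cos_le_one (T * x))
  gcongr

lemma abs_gaussCos_le' {A : ℝ} (hA : 0 ≤ A) (T x : ℝ) : |gaussCos A T x| ≤ A :=
  (abs_gaussCos_le hA T x).trans (mul_le_of_le_one_right hA
    (Real.exp_le_one_iff.2 (by nlinarith [sq_nonneg x])))

/-- Half of the Gaussian exponent absorbs the linear factor; the other half remains as the tail of
the derivative of the perturbation. -/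
lemma one_add_abs_mul_exp_le (x : ℝ) :
    (1 + |x|) * Real.exp (-x ^ 2 / 2) ≤ 2 * Real.exp (-(1 / 4) * x ^ 2) := by
  have e : Real.exp (-x ^ 2 / 2) = Real.exp (-(1 / 4) * x ^ 2) * (Real.exp (x ^ 2 / 4))⁻¹ := by
    rw [← Real.exp_neg, ← Real.exp_add]; ring_nf
  rw [e]
  have h := Real.add_one_le_exp (x ^ 2 / 4)
  have h2 : 1 + |x| ≤ 2 * Real.exp (x ^ 2 / 4) := by
    nlinarith [sq_nonneg (|x| - 1), sq_abs x]
  have h3 : (1 + |x|) * (Real.exp (x ^ 2 / 4))⁻¹ ≤ 2 := by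
    rw [← div_eq_mul_inv, div_le_iff₀ (Real.exp_pos _)]; exact h2
  calc (1 + |x|) * (Real.exp (-(1 / 4) * x ^ 2) * (Real.exp (x ^ 2 / 4))⁻¹)
      = ((1 + |x|) * (Real.exp (x ^ 2 / 4))⁻¹) * Real.exp (-(1 / 4) * x ^ 2) := by ring
    _ ≤ _ := by gcongr

lemma abs_gaussCos'_le {A T : ℝ} (hA : 0 ≤ A) (hT : 0 ≤ T) (x : ℝ) :
    |gaussCos' A T x| ≤ 2 * A * (1 + T) * Real.exp (-(1 / 4) * x ^ 2) := by
  unfold gaussCos'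
  rw [abs_mul, abs_mul, abs_of_nonneg hA, abs_of_pos (Real.exp_pos _)]
  have h1 : |-T * Real.sin (T * x) - x * Real.cos (T * x)| ≤ (1 + T) * (1 + |x|) := by
    refine (abs_sub _ _).trans ?_
    rw [abs_mul, abs_mul, abs_neg, abs_of_nonneg hT]
    have h2 := mul_le_of_le_one_right hT (Real.abs_sin_le_one (T * x))
    have h3 := mul_le_of_le_one_right (abs_nonneg x) (Real.abs_cos_le_one (T * x))
    nlinarith [mul_nonneg hT (abs_nonneg x)]
  have h4 := one_add_abs_mul_exp_le x
  calc A * (|-T * Real.sin (T * x) - x * Real.cos (T * x)| * Real.exp (-x ^ 2 / 2))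
      ≤ A * ((1 + T) * (1 + |x|) * Real.exp (-x ^ 2 / 2)) := by gcongr
    _ = A * (1 + T) * ((1 + |x|) * Real.exp (-x ^ 2 / 2)) := by ring
    _ ≤ A * (1 + T) * (2 * Real.exp (-(1 / 4) * x ^ 2)) := by gcongr
    _ = _ := by ring

lemma abs_gaussCos'_le' {A T : ℝ} (hA : 0 ≤ A) (hT : 0 ≤ T) (x : ℝ) :
    |gaussCos' A T x| ≤ 2 * A * (1 + T) :=
  (abs_gaussCos'_le hA hT x).trans (mul_le_of_le_one_right (by positivity)
    (Real.exp_le_one_iff.2 (by nlinarith [sq_nonneg x])))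

lemma abs_gaussCos''_le {A T : ℝ} (hA : 0 ≤ A) (hT : 0 ≤ T) (x : ℝ) :
    |gaussCos'' A T x| ≤ 4 * A * (1 + T) ^ 2 := by
  unfold gaussCos''
  rw [abs_mul, abs_mul, abs_of_nonneg hA, abs_of_pos (Real.exp_pos _)]
  have hx := abs_nonneg x
  have h1 : |-T ^ 2 * Real.cos (T * x) + 2 * T * x * Real.sin (T * x) +
      (x ^ 2 - 1) * Real.cos (T * x)| ≤ (1 + T) ^ 2 * (2 + 2 * x ^ 2) := by
    have a1 : |-T ^ 2 * Real.cos (T * x)| ≤ T ^ 2 := by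
      rw [abs_mul, abs_neg, abs_of_nonneg (sq_nonneg T)]
      exact mul_le_of_le_one_right (sq_nonneg T) (Real.abs_cos_le_one _)
    have a2 : |2 * T * x * Real.sin (T * x)| ≤ 2 * T * |x| := by
      rw [abs_mul, abs_mul, abs_of_nonneg (by positivity : 0 ≤ 2 * T)]
      exact mul_le_of_le_one_right (by positivity) (Real.abs_sin_le_one _)
    have a3 : |(x ^ 2 - 1) * Real.cos (T * x)| ≤ x ^ 2 + 1 := by
      rw [abs_mul]
      refine (mul_le_of_le_one_right (abs_nonneg _) (Real.abs_cos_le_one _)).trans ?_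
      rw [abs_le]; constructor <;> nlinarith [sq_nonneg x]
    refine (abs_add_le _ _).trans ((add_le_add ((abs_add_le _ _).trans (add_le_add a1 a2))
      a3).trans ?_)
    nlinarith [sq_abs x, mul_nonneg hT (sq_nonneg (|x| - 1)), mul_nonneg hT hx,
      mul_nonneg (sq_nonneg T) (sq_nonneg x), mul_nonneg hT (sq_nonneg x)]
  have h2 : (2 + 2 * x ^ 2) * Real.exp (-x ^ 2 / 2) ≤ 4 := by
    have h := Real.add_one_le_exp (x ^ 2 / 2)
    have e : Real.exp (-x ^ 2 / 2) = (Real.exp (x ^ 2 / 2))⁻¹ := by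
      rw [← Real.exp_neg]; ring_nf
    rw [e, ← div_eq_mul_inv, div_le_iff₀ (Real.exp_pos _)]
    linarith
  calc A * (|_| * Real.exp (-x ^ 2 / 2))
      ≤ A * ((1 + T) ^ 2 * (2 + 2 * x ^ 2) * Real.exp (-x ^ 2 / 2)) := by gcongr
    _ = A * (1 + T) ^ 2 * ((2 + 2 * x ^ 2) * Real.exp (-x ^ 2 / 2)) := by ring
    _ ≤ A * (1 + T) ^ 2 * 4 := by gcongr
    _ = _ := by ring

lemma integrable_exp_neg_sq_half : Integrable fun x : ℝ => Real.exp (-x ^ 2 / 2) := by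
  refine (integrable_exp_neg_mul_sq (b := 1 / 2) (by norm_num)).congr (ae_of_all _ fun x => ?_)
  simp only; ring_nf

lemma integrable_gaussCos {A : ℝ} (hA : 0 ≤ A) (T : ℝ) : Integrable (gaussCos A T) :=
  (integrable_exp_neg_sq_half.const_mul A).mono'
    (contDiff_gaussCos A T (n := 0)).continuous.aestronglyMeasurable
    (ae_of_all _ (abs_gaussCos_le hA T))

lemma integrable_gaussCos' {A T : ℝ} (hA : 0 ≤ A) (hT : 0 ≤ T) : Integrable (gaussCos' A T) :=
  ((integrable_exp_neg_mul_sq (b := 1 / 4) (by norm_num)).const_mul (2 * A * (1 + T))).mono'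
    (continuous_gaussCos' A T).aestronglyMeasurable (ae_of_all _ (abs_gaussCos'_le hA hT))

open FourierTransform in
lemma fourierR_deriv {f : ℝ → ℝ} (hf : Integrable f) (hd : Differentiable ℝ f)
    (hf' : Integrable (deriv f)) (z : ℝ) :
    fourierR (deriv f) z = -(Complex.I * z) * fourierR f z := by
  have e : deriv (fun t => (f t : ℂ)) = fun t => ((deriv f t : ℝ) : ℂ) :=
    funext fun t => ((hd t).hasDerivAt.ofReal_comp).deriv
  have h := Real.fourier_deriv (f := fun t => (f t : ℂ)) hf.ofReal
    (fun t => ((hd t).hasDerivAt.ofReal_comp).differentiableAt) (by rw [e]; exact hf'.ofReal)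
  rw [fourierR_eq, fourierR_eq, ← e, h]
  simp only [smul_eq_mul]
  congr 1
  push_cast
  have : (Real.pi : ℂ) ≠ 0 := by exact_mod_cast Real.pi_ne_zero
  field_simp

lemma fourierR_gauss (z : ℝ) : fourierR (fun x => Real.exp (-x ^ 2 / 2)) z =
    ((√(2 * Real.pi) * Real.exp (-z ^ 2 / 2) : ℝ) : ℂ) := by
  have h := fourierIntegral_gaussian (b := (1 / 2 : ℂ)) (by norm_num) (z : ℂ)
  have hp : ((Real.pi : ℂ) / (1 / 2)) ^ (1 / 2 : ℂ) = ((√(2 * Real.pi) : ℝ) : ℂ) := by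
    rw [Real.sqrt_eq_rpow, Complex.ofReal_cpow (by positivity)]
    push_cast; congr 1; ring
  rw [hp] at h
  push_cast at h ⊢
  refine Eq.trans ?_ (h.trans ?_)
  · unfold fourierR
    congr 1; ext t
    push_cast
    congr 2; ring
  · congr 2; ring

/-- The cosine splits the Gaussian into two bumps at ±T. The transform is positive and localised
there, so T acts as the frequency at which the density is probed. -/
lemma fourierR_gaussCos (A T z : ℝ) : fourierR (gaussCos A T) z =
    ((A * √(2 * Real.pi) / 2 *
      (Real.exp (-(z - T) ^ 2 / 2) + Real.exp (-(z + T) ^ 2 / 2)) : ℝ) : ℂ) := by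
  have h1 := fourierR_gauss (z - T)
  have h2 := fourierR_gauss (z + T)
  have e : ((A * √(2 * Real.pi) / 2 *
      (Real.exp (-(z - T) ^ 2 / 2) + Real.exp (-(z + T) ^ 2 / 2)) : ℝ) : ℂ) =
      (A / 2 : ℂ) * ((√(2 * Real.pi) * Real.exp (-(z - T) ^ 2 / 2) : ℝ) : ℂ) +
      (A / 2 : ℂ) * ((√(2 * Real.pi) * Real.exp (-(z + T) ^ 2 / 2) : ℝ) : ℂ) := by
    push_cast; ring
  rw [e, ← h1, ← h2]
  unfold fourierR
  rw [← integral_const_mul, ← integral_const_mul, ← integral_add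
    ((integrable_kernel integrable_exp_neg_sq_half _).const_mul _)
    ((integrable_kernel integrable_exp_neg_sq_half _).const_mul _)]
  congr 1; ext t
  have e1 : Complex.I * ((z - T : ℝ) : ℂ) * t = Complex.I * z * t + -(T * t * Complex.I) := by
    push_cast; ring
  have e2 : Complex.I * ((z + T : ℝ) : ℂ) * t = Complex.I * z * t + T * t * Complex.I := by
    push_cast; ring
  unfold gaussCos
  rw [e1, e2, Complex.exp_add, Complex.exp_add, Complex.ofReal_mul, Complex.ofReal_mul,
    Complex.ofReal_cos, Complex.cos]
  push_cast
  ring_nf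

lemma norm_fourierR_gaussCos {A : ℝ} (hA : 0 ≤ A) (T z : ℝ) : ‖fourierR (gaussCos A T) z‖ =
    A * √(2 * Real.pi) / 2 * (Real.exp (-(z - T) ^ 2 / 2) + Real.exp (-(z + T) ^ 2 / 2)) := by
  rw [fourierR_gaussCos, Complex.norm_real, Real.norm_of_nonneg (by positivity)]

lemma norm_fourierR_gaussCos_le {A : ℝ} (hA : 0 ≤ A) (T z : ℝ) :
    ‖fourierR (gaussCos A T) z‖ ≤ A * √(2 * Real.pi) := by
  rw [norm_fourierR_gaussCos hA]
  have h1 : Real.exp (-(z - T) ^ 2 / 2) ≤ 1 :=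
    Real.exp_le_one_iff.2 (by nlinarith [sq_nonneg (z - T)])
  have h2 : Real.exp (-(z + T) ^ 2 / 2) ≤ 1 :=
    Real.exp_le_one_iff.2 (by nlinarith [sq_nonneg (z + T)])
  have h3 : 0 ≤ A * √(2 * Real.pi) := by positivity
  nlinarith

lemma norm_fourierR_gaussCos' {A T : ℝ} (hA : 0 ≤ A) (hT : 0 ≤ T) (z : ℝ) :
    ‖fourierR (gaussCos' A T) z‖ = |z| * ‖fourierR (gaussCos A T) z‖ := by
  rw [← deriv_gaussCos, fourierR_deriv (integrable_gaussCos hA T)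
    (fun x => (hasDerivAt_gaussCos A T x).differentiableAt)
    (by rw [deriv_gaussCos]; exact integrable_gaussCos' hA hT), norm_mul, norm_neg, norm_mul,
    Complex.norm_I, one_mul, Complex.norm_real, Real.norm_eq_abs]

/-- The `L²`-norm of the derivative of a modulated Gaussian is at least of the order `A T`. -/
lemma sq_le_integral_gaussCos'_sq {A T : ℝ} (hA : 0 ≤ A) (hT : 0 ≤ T) :
    A ^ 2 * T ^ 2 / 4 ≤ ∫ x, gaussCos' A T x ^ 2 := by
  have hg : Integrable fun x : ℝ => Real.exp (-1 * x ^ 2) := integrable_exp_neg_mul_sq one_pos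
  have hbd : ∀ φ : ℝ → ℝ, Continuous φ → (∀ x, |φ x| ≤ T + |x|) →
      Integrable fun x => φ x * Real.exp (-1 * x ^ 2) := fun φ hφ hb => by
    have h1 := (hg.const_mul T).add (integrable_rpow_mul_exp_neg_mul_sq one_pos (s := (1 : ℕ))
      (by norm_num)).norm
    refine h1.mono' (Continuous.aestronglyMeasurable (by fun_prop)) (ae_of_all _ fun x => ?_)
    simp only [Pi.add_apply]
    rw [Real.rpow_natCast, pow_one, norm_mul, norm_mul, Real.norm_of_nonneg (Real.exp_pos _).le,
      ← add_mul]
    exact mul_le_mul_of_nonneg_right (hb x) (Real.exp_pos _).le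
  set s : ℝ → ℝ := fun x => Real.sin (T * x) with hs
  set c : ℝ → ℝ := fun x => Real.cos (T * x) with hc
  have hs1 : ∀ x, |s x| ≤ 1 := fun x => Real.abs_sin_le_one _
  have hc1 : ∀ x, |c x| ≤ 1 := fun x => Real.abs_cos_le_one _
  have hsc : ∀ x, s x ^ 2 + c x ^ 2 = 1 := fun x => Real.sin_sq_add_cos_sq _
  have hcs : Continuous s := by fun_prop
  have hcc : Continuous c := by fun_prop
  have hxsc : ∀ x, |x * s x * c x| ≤ |x| := fun x => by
    rw [abs_mul, abs_mul, mul_assoc]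
    exact mul_le_of_le_one_right (abs_nonneg _)
      (mul_le_one₀ (hs1 x) (abs_nonneg _) (hc1 x))
  have i1 : Integrable fun x => (T * s x ^ 2 + x * s x * c x) * Real.exp (-1 * x ^ 2) := by
    refine hbd _ (by fun_prop) fun x => ?_
    refine (abs_add_le _ _).trans (add_le_add ?_ (hxsc x))
    rw [abs_of_nonneg (by positivity)]
    exact mul_le_of_le_one_right hT (by nlinarith [hsc x, sq_nonneg (c x)])
  have i2 : Integrable fun x => (T * (c x ^ 2 - s x ^ 2) / 2 - x * s x * c x) *
      Real.exp (-1 * x ^ 2) := by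
    refine hbd _ (by fun_prop) fun x => ?_
    refine (abs_sub _ _).trans (add_le_add ?_ (hxsc x))
    rw [abs_le]; constructor <;> nlinarith [hsc x, sq_nonneg (c x), sq_nonneg (s x),
      mul_nonneg hT (sq_nonneg (c x)), mul_nonneg hT (sq_nonneg (s x))]
  -- The integrand is the derivative of sin(Tx) cos(Tx) exp(-x²)/2. Adding it turns T sin² + x sin
  -- cos into the constant T/2.
  have hpart : ∫ x, (T * (c x ^ 2 - s x ^ 2) / 2 - x * s x * c x) * Real.exp (-1 * x ^ 2) = 0 := by
    refine integral_eq_zero_of_hasDerivAt_of_integrable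
      (f := fun x => s x * c x / 2 * Real.exp (-1 * x ^ 2)) (fun x => ?_) i2 ?_
    · have h1 : HasDerivAt (fun x : ℝ => Real.exp (-1 * x ^ 2))
          (-2 * x * Real.exp (-1 * x ^ 2)) x := by
        have h : HasDerivAt (fun x : ℝ => -1 * x ^ 2) (-2 * x) x := by
          refine (((hasDerivAt_id x).pow 2).const_mul (-1)).congr_deriv ?_
          simp
        exact h.exp.congr_deriv (by ring)
      refine ((((hasDerivAt_sin_mul T x).mul (hasDerivAt_cos_mul T x)).div_const 2).mul
        h1).congr_deriv ?_
      simp only [hs, hc, Pi.mul_apply]; ring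
    · refine hg.bdd_mul (c := 1) (Continuous.aestronglyMeasurable (by fun_prop))
        (ae_of_all _ fun x => ?_)
      rw [norm_div, norm_mul, Real.norm_eq_abs, Real.norm_eq_abs]
      have := mul_le_one₀ (hs1 x) (abs_nonneg _) (hc1 x)
      rw [Real.norm_of_nonneg zero_le_two]; linarith
  have hI : ∫ x, (T * s x ^ 2 + x * s x * c x) * Real.exp (-1 * x ^ 2) =
      T / 2 * √Real.pi := by
    rw [← add_zero (∫ x, _), ← hpart, ← integral_add i1 i2]
    have e : ∀ x, (T * s x ^ 2 + x * s x * c x) * Real.exp (-1 * x ^ 2) +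
        (T * (c x ^ 2 - s x ^ 2) / 2 - x * s x * c x) * Real.exp (-1 * x ^ 2) =
        T / 2 * Real.exp (-1 * x ^ 2) := fun x => by
      have := hsc x
      linear_combination (T / 2 * Real.exp (-1 * x ^ 2)) * this
    simp_rw [e]
    rw [integral_const_mul, integral_gaussian, div_one]
  have hexp : ∀ x : ℝ, Real.exp (-x ^ 2 / 2) ^ 2 = Real.exp (-1 * x ^ 2) := fun x => by
    rw [← Real.exp_nat_mul]; congr 1; push_cast; ring
  have i3 : Integrable fun x => gaussCos' A T x ^ 2 := by
    refine ((integrable_gaussCos' hA hT).norm.mul_const (2 * A * (1 + T))).mono'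
      ((continuous_gaussCos' A T).pow 2).aestronglyMeasurable (ae_of_all _ fun x => ?_)
    rw [norm_pow, pow_two]
    exact mul_le_mul_of_nonneg_left (abs_gaussCos'_le' hA hT x) (norm_nonneg _)
  -- Duality against sin(Tx) exp(-x²/2): expanding the square of w' + l sin(Tx) exp(-x²/2) gives ∫
  -- w'² ≥ (l A T - l²) √π, which is largest at l = AT/2.
  set l := A * T / 2 with hl
  have hkey : 0 ≤ ∫ x, (gaussCos' A T x ^ 2 +
      (-(2 * l * A) * ((T * s x ^ 2 + x * s x * c x) * Real.exp (-1 * x ^ 2)) +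
        l ^ 2 * Real.exp (-1 * x ^ 2))) := by
    refine integral_nonneg fun x => ?_
    have h1 : 0 ≤ (gaussCos' A T x + l * s x * Real.exp (-x ^ 2 / 2)) ^ 2 := sq_nonneg _
    have h2 : (gaussCos' A T x + l * s x * Real.exp (-x ^ 2 / 2)) ^ 2 = gaussCos' A T x ^ 2 +
        (-(2 * l * A) * ((T * s x ^ 2 + x * s x * c x) * Real.exp (-1 * x ^ 2)) +
        l ^ 2 * s x ^ 2 * Real.exp (-1 * x ^ 2)) := by
      rw [← hexp, gaussCos']; simp only [hs, hc]; ring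
    have h3 : l ^ 2 * s x ^ 2 * Real.exp (-1 * x ^ 2) ≤ l ^ 2 * Real.exp (-1 * x ^ 2) := by
      refine mul_le_mul_of_nonneg_right ?_ (Real.exp_pos _).le
      nlinarith [hsc x, sq_nonneg (c x), sq_nonneg l,
        mul_nonneg (sq_nonneg l) (sq_nonneg (c x))]
    simp only [Pi.zero_apply]
    linarith
  have i4 : Integrable fun x => -(2 * l * A) * ((T * s x ^ 2 + x * s x * c x) *
      Real.exp (-1 * x ^ 2)) + l ^ 2 * Real.exp (-1 * x ^ 2) :=
    (i1.const_mul _).add (hg.const_mul _)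
  rw [integral_add i3 i4, integral_add (i1.const_mul _) (hg.const_mul _), integral_const_mul,
    integral_const_mul, hI, integral_gaussian, div_one] at hkey
  have hpi : 1 ≤ √Real.pi := by
    rw [Real.one_le_sqrt]; linarith [Real.pi_gt_three]
  have : A ^ 2 * T ^ 2 / 4 * √Real.pi ≤ ∫ x, gaussCos' A T x ^ 2 := by
    rw [hl] at hkey; nlinarith
  have h0 : 0 ≤ A ^ 2 * T ^ 2 / 4 := by positivity
  nlinarith

lemma ofReal_le_eLpNorm_gaussCos' {A T : ℝ} (hA : 0 ≤ A) (hT : 0 ≤ T) :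
    ENNReal.ofReal (A * T / 2) ≤ eLpNorm (gaussCos' A T) 2 volume := by
  have h := sq_le_integral_gaussCos'_sq hA hT
  have i3 : Integrable fun x => gaussCos' A T x ^ 2 := by
    refine ((integrable_gaussCos' hA hT).norm.mul_const (2 * A * (1 + T))).mono'
      ((continuous_gaussCos' A T).pow 2).aestronglyMeasurable (ae_of_all _ fun x => ?_)
    rw [norm_pow, pow_two]
    exact mul_le_mul_of_nonneg_left (abs_gaussCos'_le' hA hT x) (norm_nonneg _)
  have hm : MemLp (gaussCos' A T) 2 volume :=
    (memLp_two_iff_integrable_sq (continuous_gaussCos' A T).aestronglyMeasurable).2 i3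
  rw [hm.eLpNorm_eq_integral_rpow_norm (by simp) (by simp)]
  refine ENNReal.ofReal_le_ofReal ?_
  simp only [ENNReal.toReal_ofNat, Real.rpow_two, Real.norm_eq_abs, sq_abs]
  rw [← one_div, ← Real.sqrt_eq_rpow]
  refine Real.le_sqrt_of_sq_le ?_
  linarith [h, (by ring : (A * T / 2) ^ 2 = A ^ 2 * T ^ 2 / 4)]

/-! ### Weighted estimates for modulated Gaussians -/

lemma wt_le_one_add_pow (n : ℕ) (u : ℝ) : wt n u ≤ 1 + |u| ^ n := by
  unfold wt
  rcases max_cases 1 |u| with h | h <;> rw [h.1]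
  · rw [one_pow]; exact le_add_of_nonneg_right (by positivity)
  · exact le_add_of_nonneg_left one_pos.le

lemma integrable_wt_mul_exp (n : ℕ) {b : ℝ} (hb : 0 < b) :
    Integrable fun u => wt n u * Real.exp (-b * u ^ 2) := by
  have h1 := (integrable_exp_neg_mul_sq hb).add (integrable_rpow_mul_exp_neg_mul_sq hb (s := n)
    (by have : (0 : ℝ) ≤ n := n.cast_nonneg
        linarith)).norm
  refine h1.mono' ((continuous_wt n).mul (by fun_prop)).aestronglyMeasurable
    (ae_of_all _ fun u => ?_)
  simp only [Pi.add_apply]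
  rw [Real.rpow_natCast, norm_mul, norm_mul, Real.norm_of_nonneg (Real.exp_pos _).le,
    Real.norm_of_nonneg (wt_pos n u).le, norm_pow, Real.norm_eq_abs]
  have := mul_le_mul_of_nonneg_right (wt_le_one_add_pow n u) (Real.exp_pos (-b * u ^ 2)).le
  linarith

lemma exp_neg_sq_half_eq (u : ℝ) : Real.exp (-u ^ 2 / 2) = Real.exp (-(1 / 2) * u ^ 2) := by
  ring_nf

lemma inv_wt_le_shift (k : ℕ) (z T : ℝ) : (wt k z)⁻¹ ≤ 2 ^ k * wt k (z - T) * (wt k T)⁻¹ := by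
  have h := wt_le_add k z (T - z)
  rw [add_sub_cancel, ← neg_sub z T, wt_neg] at h
  have h1 := wt_pos k z
  have h2 := wt_pos k T
  rw [inv_eq_one_div, ← div_eq_mul_inv, div_le_div_iff₀ h1 h2, one_mul]
  linarith

/-- A Gaussian centred at T sees the weight at T: shifting by `inv_wt_le_shift` costs only the
factor `wt k (z - T)`, which the Gaussian absorbs uniformly in T. -/
lemma exists_integral_inv_wt_mul_exp_le (k : ℕ) : ∃ C : ℝ, 0 ≤ C ∧ ∀ T : ℝ,
    Integrable (fun z => (wt k z)⁻¹ * Real.exp (-(z - T) ^ 2 / 2)) ∧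
    ∫ z, (wt k z)⁻¹ * Real.exp (-(z - T) ^ 2 / 2) ≤ C * (wt k T)⁻¹ := by
  have hi := integrable_wt_mul_exp k (b := 1 / 2) (by norm_num)
  refine ⟨2 ^ k * ∫ u, wt k u * Real.exp (-(1 / 2) * u ^ 2), ?_, fun T => ?_⟩
  · exact mul_nonneg (by positivity) (integral_nonneg fun u =>
      mul_nonneg (wt_pos k u).le (Real.exp_pos _).le)
  have hT := (hi.comp_sub_right T).const_mul (2 ^ k * (wt k T)⁻¹)
  have hle : ∀ z, (wt k z)⁻¹ * Real.exp (-(z - T) ^ 2 / 2) ≤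
      2 ^ k * (wt k T)⁻¹ * (wt k (z - T) * Real.exp (-(1 / 2) * (z - T) ^ 2)) := fun z => by
    rw [exp_neg_sq_half_eq]
    have := mul_le_mul_of_nonneg_right (inv_wt_le_shift k z T)
      (Real.exp_pos (-(1 / 2) * (z - T) ^ 2)).le
    linarith
  have hint : Integrable fun z => (wt k z)⁻¹ * Real.exp (-(z - T) ^ 2 / 2) := by
    refine hT.mono' ((continuous_inv_wt k).mul (by fun_prop)).aestronglyMeasurable
      (ae_of_all _ fun z => ?_)
    rw [Real.norm_of_nonneg (mul_nonneg (inv_pos.2 (wt_pos k z)).le (Real.exp_pos _).le)]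
    exact hle z
  refine ⟨hint, (integral_mono hint hT hle).trans (le_of_eq ?_)⟩
  rw [integral_const_mul, integral_sub_right_eq_self
    (fun u => wt k u * Real.exp (-(1 / 2) * u ^ 2))]
  ring

/-- Pointwise bounds for the convolution of a modulated Gaussian with a density whose Fourier
transform decays polynomially. -/
lemma exists_abs_conv_gaussCos_le {k : ℕ} (hk : 2 ≤ k) : ∃ C : ℝ, 0 ≤ C ∧
    ∀ (A T M : ℝ) (ρ : ℝ → ℝ), 0 ≤ A → 0 ≤ T → Integrable ρ →
      (∀ z, ‖fourierR ρ z‖ ≤ M * (wt k z)⁻¹) →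
      ∀ x, |conv (gaussCos A T) ρ x| ≤ C * A * M * (wt k T)⁻¹ ∧
        |conv (gaussCos' A T) ρ x| ≤ C * A * M * (wt (k - 1) T)⁻¹ := by
  obtain ⟨C₁, hC₁, h₁⟩ := exists_integral_inv_wt_mul_exp_le k
  obtain ⟨C₂, hC₂, h₂⟩ := exists_integral_inv_wt_mul_exp_le (k - 1)
  have hpi : 0 ≤ (2 * Real.pi)⁻¹ := by positivity
  -- Fourier inversion, with the two bumps at ±T integrated against the decay of order j. For the
  -- bump itself j = k; for its derivative the factor |z| uses up one power, so j = k - 1.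
  have key : ∀ (j : ℕ) (D : ℝ), (∀ T : ℝ,
      Integrable (fun z => (wt j z)⁻¹ * Real.exp (-(z - T) ^ 2 / 2)) ∧
      ∫ z, (wt j z)⁻¹ * Real.exp (-(z - T) ^ 2 / 2) ≤ D * (wt j T)⁻¹) →
      ∀ (K : ℝ → ℝ) (A T M B : ℝ) (ρ : ℝ → ℝ), 0 ≤ A → 0 ≤ M → Integrable K → Continuous K →
      (∀ x, |K x| ≤ B) → Integrable ρ →
      (∀ z, ‖fourierR K z * fourierR ρ z‖ ≤ A * √(2 * Real.pi) / 2 *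
        (Real.exp (-(z - T) ^ 2 / 2) + Real.exp (-(z + T) ^ 2 / 2)) * (M * (wt j z)⁻¹)) →
      ∀ x, |conv K ρ x| ≤ (2 * Real.pi)⁻¹ * √(2 * Real.pi) * D * A * M * (wt j T)⁻¹ := by
    intro j D hD K A T M B ρ hA hM hK hKc hB hρ hF x
    have hD' := hD (-T)
    simp only [sub_neg_eq_add, wt_neg] at hD'
    have hI := ((hD T).1.add hD'.1).const_mul (A * √(2 * Real.pi) / 2 * M)
    have hF' : ∀ z, ‖fourierR K z * fourierR ρ z‖ ≤ A * √(2 * Real.pi) / 2 * M *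
        ((wt j z)⁻¹ * Real.exp (-(z - T) ^ 2 / 2) + (wt j z)⁻¹ * Real.exp (-(z + T) ^ 2 / 2)) :=
      fun z => (hF z).trans (le_of_eq (by ring))
    have hFi : Integrable fun z => fourierR K z * fourierR ρ z :=
      hI.mono' ((continuous_fourierR hK).mul (continuous_fourierR hρ)).aestronglyMeasurable
        (ae_of_all _ hF')
    have h := conv_eq_integral_fourierR hK hKc hB hρ hFi x
    have h3 : |conv K ρ x| = ‖((conv K ρ x : ℝ) : ℂ)‖ := by
      rw [Complex.norm_real, Real.norm_eq_abs]
    rw [h3, h]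
    refine (norm_integral_le_of_norm_le (hI.const_mul (2 * Real.pi)⁻¹)
      (ae_of_all _ fun z => ?_)).trans ?_
    · rw [norm_mul, norm_cexp_neg_I_mul, one_mul, norm_mul, Complex.norm_real,
        Real.norm_of_nonneg hpi]
      exact mul_le_mul_of_nonneg_left (hF' z) hpi
    · rw [integral_const_mul, integral_const_mul]
      simp only [Pi.add_apply]
      rw [integral_add (hD T).1 hD'.1]
      have h4 := add_le_add (hD T).2 hD'.2
      have h5 : 0 ≤ (2 * Real.pi)⁻¹ * (A * √(2 * Real.pi) / 2 * M) := by positivity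
      have h6 := mul_le_mul_of_nonneg_left h4 h5
      linarith
  refine ⟨(2 * Real.pi)⁻¹ * √(2 * Real.pi) * (C₁ + C₂), by positivity, ?_⟩
  intro A T M ρ hA hT hρ hM x
  have hM0 : 0 ≤ M := by
    have h1 := (norm_nonneg _).trans (hM 0)
    exact nonneg_of_mul_nonneg_left h1 (inv_pos.2 (wt_pos k 0))
  constructor
  · refine (key k C₁ h₁ (gaussCos A T) A T M A ρ hA hM0 (integrable_gaussCos hA T)
      (contDiff_gaussCos A T (n := 0)).continuous (abs_gaussCos_le' hA T) hρ (fun z => ?_)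
      x).trans ?_
    · rw [norm_mul, norm_fourierR_gaussCos hA]
      exact mul_le_mul_of_nonneg_left (hM z) (by positivity)
    · have hw := inv_pos.2 (wt_pos k T)
      gcongr
      linarith
  · refine (key (k - 1) C₂ h₂ (gaussCos' A T) A T M (2 * A * (1 + T)) ρ hA hM0
      (integrable_gaussCos' hA hT) (continuous_gaussCos' A T) (abs_gaussCos'_le' hA hT) hρ
      (fun z => ?_) x).trans ?_
    · rw [norm_mul, norm_fourierR_gaussCos' hA hT, norm_fourierR_gaussCos hA]
      have h5 : |z| * (M * (wt k z)⁻¹) ≤ M * (wt (k - 1) z)⁻¹ := by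
        have e : wt k z = wt (k - 1) z * max 1 |z| := by
          unfold wt; rw [← pow_succ]; congr 1; omega
        have hw := wt_pos (k - 1) z
        have hm : 0 < max 1 |z| := lt_max_of_lt_left one_pos
        rw [e, mul_inv]
        have h6 : |z| * (max 1 |z|)⁻¹ ≤ 1 := by
          rw [← div_eq_mul_inv, div_le_one hm]; exact le_max_right _ _
        calc |z| * (M * ((wt (k - 1) z)⁻¹ * (max 1 |z|)⁻¹))
            = M * (wt (k - 1) z)⁻¹ * (|z| * (max 1 |z|)⁻¹) := by ring
          _ ≤ _ := mul_le_of_le_one_right (by positivity) h6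
      set G := A * √(2 * Real.pi) / 2 *
        (Real.exp (-(z - T) ^ 2 / 2) + Real.exp (-(z + T) ^ 2 / 2)) with hG
      have hG0 : 0 ≤ G := by positivity
      calc |z| * G * ‖fourierR ρ z‖ ≤ |z| * G * (M * (wt k z)⁻¹) := by gcongr; exact hM z
        _ = G * (|z| * (M * (wt k z)⁻¹)) := by ring
        _ ≤ _ := by gcongr
    · have hw := inv_pos.2 (wt_pos (k - 1) T)
      gcongr
      linarith

/-- Weighted `L²` bound for the Fourier transform of the derivative of a modulated Gaussian. -/
lemma exists_lintegral_wt_fourierR_gaussCos'_le (k : ℕ) : ∃ C : ℝ, 0 ≤ C ∧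
    ∀ A T : ℝ, 0 ≤ A → 0 ≤ T →
      ∫⁻ z, ENNReal.ofReal ((wt k z * ‖fourierR (gaussCos' A T) z‖) ^ 2) ≤
        ENNReal.ofReal (C * A ^ 2 * wt (k + 1) T ^ 2) := by
  set n := 2 * (k + 1) with hn
  have hi := integrable_wt_mul_exp n one_pos
  set I := ∫ u, wt n u * Real.exp (-1 * u ^ 2) with hI
  have hI0 : 0 ≤ I := integral_nonneg fun u => mul_nonneg (wt_pos n u).le (Real.exp_pos _).le
  set D : ℝ := 4 ^ (k + 1) * Real.pi with hD
  refine ⟨D * (2 * I), by positivity, fun A T hA hT => ?_⟩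
  have hi1 := hi.comp_sub_right T
  have hi2 := hi.comp_add_right T
  have hsum := (hi1.add hi2).const_mul (D * A ^ 2 * wt (k + 1) T ^ 2)
  have hle : ∀ z, (wt k z * ‖fourierR (gaussCos' A T) z‖) ^ 2 ≤ D * A ^ 2 * wt (k + 1) T ^ 2 *
      (wt n (z - T) * Real.exp (-1 * (z - T) ^ 2) +
        wt n (z + T) * Real.exp (-1 * (z + T) ^ 2)) := fun z => by
    rw [norm_fourierR_gaussCos' hA hT, norm_fourierR_gaussCos hA]
    -- The factor |z| from the derivative raises the weight by one. The weight is then split between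
    -- z ∓ T, where the Gaussian absorbs it, and T, which gives `wt (k + 1) T`.
    have hw : wt k z * |z| ≤ wt (k + 1) z := by
      unfold wt; rw [pow_succ]; gcongr; exact le_max_right _ _
    have h1 : wt (k + 1) z ≤ 2 ^ (k + 1) * (wt (k + 1) (z - T) * wt (k + 1) T) := by
      have := wt_le_add (k + 1) (z - T) T
      rwa [sub_add_cancel] at this
    have h2 : wt (k + 1) z ≤ 2 ^ (k + 1) * (wt (k + 1) (z + T) * wt (k + 1) T) := by
      have := wt_le_add (k + 1) (z + T) (-T)
      rwa [add_neg_cancel_right, wt_neg] at this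
    have hsq : ∀ u, Real.exp (-u ^ 2 / 2) ^ 2 = Real.exp (-1 * u ^ 2) := fun u => by
      rw [← Real.exp_nat_mul]; congr 1; push_cast; ring
    have hwn : ∀ u, wt (k + 1) u ^ 2 = wt n u := fun u => by
      unfold wt; rw [← pow_mul]; congr 1; omega
    have h4 : (2 : ℝ) ^ (k + 1) * 2 ^ (k + 1) = 4 ^ (k + 1) := by
      rw [← mul_pow]; norm_num
    have hp : √(2 * Real.pi) ^ 2 = 2 * Real.pi := Real.sq_sqrt (by positivity)
    set a := Real.exp (-(z - T) ^ 2 / 2) with ha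
    set b := Real.exp (-(z + T) ^ 2 / 2) with hb
    have ha0 : 0 < a := Real.exp_pos _
    have hb0 : 0 < b := Real.exp_pos _
    have hT0 := wt_pos (k + 1) T
    have p1 := wt_pos (k + 1) (z - T)
    have p2 := wt_pos (k + 1) (z + T)
    have p0 := wt_pos (k + 1) z
    have p3 := wt_pos k z
    have hmain : wt k z * (|z| * (A * √(2 * Real.pi) / 2 * (a + b))) ≤
        A * √(2 * Real.pi) / 2 * 2 ^ (k + 1) * wt (k + 1) T *
          (wt (k + 1) (z - T) * a + wt (k + 1) (z + T) * b) := by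
      have e1 : wt (k + 1) z * a ≤ 2 ^ (k + 1) * (wt (k + 1) (z - T) * wt (k + 1) T) * a := by
        gcongr
      have e2 : wt (k + 1) z * b ≤ 2 ^ (k + 1) * (wt (k + 1) (z + T) * wt (k + 1) T) * b := by
        gcongr
      calc wt k z * (|z| * (A * √(2 * Real.pi) / 2 * (a + b)))
          = A * √(2 * Real.pi) / 2 * ((wt k z * |z|) * (a + b)) := by ring
        _ ≤ A * √(2 * Real.pi) / 2 * (wt (k + 1) z * (a + b)) := by gcongr
        _ ≤ A * √(2 * Real.pi) / 2 *
            (2 ^ (k + 1) * (wt (k + 1) (z - T) * wt (k + 1) T) * a +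
              2 ^ (k + 1) * (wt (k + 1) (z + T) * wt (k + 1) T) * b) := by
            gcongr; linarith
        _ = _ := by ring
    refine (pow_le_pow_left₀ (by positivity) hmain 2).trans ?_
    rw [← hwn, ← hwn, ← hsq, ← hsq, ← ha, ← hb]
    have e3 : (A * √(2 * Real.pi) / 2 * 2 ^ (k + 1) * wt (k + 1) T *
        (wt (k + 1) (z - T) * a + wt (k + 1) (z + T) * b)) ^ 2 =
        A ^ 2 * wt (k + 1) T ^ 2 * (√(2 * Real.pi) ^ 2 / 4 * (2 ^ (k + 1) * 2 ^ (k + 1))) *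
        (wt (k + 1) (z - T) * a + wt (k + 1) (z + T) * b) ^ 2 := by ring
    rw [e3, hp, h4, hD]
    have e4 : (wt (k + 1) (z - T) * a + wt (k + 1) (z + T) * b) ^ 2 ≤
        2 * (wt (k + 1) (z - T) ^ 2 * a ^ 2 + wt (k + 1) (z + T) ^ 2 * b ^ 2) := by
      nlinarith [sq_nonneg (wt (k + 1) (z - T) * a - wt (k + 1) (z + T) * b)]
    calc _ ≤ A ^ 2 * wt (k + 1) T ^ 2 * (2 * Real.pi / 4 * 4 ^ (k + 1)) *
          (2 * (wt (k + 1) (z - T) ^ 2 * a ^ 2 + wt (k + 1) (z + T) ^ 2 * b ^ 2)) := by gcongr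
      _ = _ := by ring
  calc ∫⁻ z, ENNReal.ofReal ((wt k z * ‖fourierR (gaussCos' A T) z‖) ^ 2)
      ≤ ∫⁻ z, ENNReal.ofReal (D * A ^ 2 * wt (k + 1) T ^ 2 *
        (wt n (z - T) * Real.exp (-1 * (z - T) ^ 2) +
          wt n (z + T) * Real.exp (-1 * (z + T) ^ 2))) :=
        lintegral_mono fun z => ENNReal.ofReal_le_ofReal (hle z)
    _ = ENNReal.ofReal (∫ z, D * A ^ 2 * wt (k + 1) T ^ 2 *
        (wt n (z - T) * Real.exp (-1 * (z - T) ^ 2) +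
          wt n (z + T) * Real.exp (-1 * (z + T) ^ 2))) :=
        (ofReal_integral_eq_lintegral_ofReal hsum (ae_of_all _ fun z => by
          have h1 := wt_pos n (z - T)
          have h2 := wt_pos n (z + T)
          simp only [Pi.zero_apply, Pi.add_apply]
          positivity)).symm
    _ ≤ _ := by
        refine ENNReal.ofReal_le_ofReal (le_of_eq ?_)
        rw [integral_const_mul, integral_add hi1 hi2,
          integral_sub_right_eq_self (fun u => wt n u * Real.exp (-1 * u ^ 2)),
          integral_add_right_eq_self (fun u => wt n u * Real.exp (-1 * u ^ 2))]
        ring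

/-! ### Gaussian tails -/

/-- The quantity whose upper limit bounds the tail of an interaction. -/
def tailFun (p : ℝ) (f : ℝ → ℝ) (x : ℝ) : ℝ≥0∞ :=
  ENNReal.ofReal (Real.exp (2 * p * x ^ 2)) * ∫⁻ y in {y : ℝ | x < |y|}, ‖f y‖ₑ ^ 2

lemma measurableSet_lt_abs (x : ℝ) : MeasurableSet {y : ℝ | x < |y|} :=
  measurableSet_lt measurable_const continuous_abs.measurable

lemma tendsto_exp_neg_mul_sq_atTop {c : ℝ} (hc : 0 < c) :
    Tendsto (fun x : ℝ => Real.exp (-c * x ^ 2)) atTop (nhds 0) := by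
  refine Real.tendsto_exp_atBot.comp ?_
  have := (tendsto_pow_atTop (two_ne_zero)).const_mul_atTop hc
  refine (tendsto_neg_atTop_atBot.comp this).congr fun x => ?_
  simp

lemma tendsto_ofReal_mul_exp {c : ℝ} (hc : 0 < c) {K : ℝ≥0∞} (hK : K ≠ ∞) :
    Tendsto (fun x : ℝ => ENNReal.ofReal (Real.exp (-c * x ^ 2)) * K) atTop (nhds 0) := by
  have h := ENNReal.tendsto_ofReal (tendsto_exp_neg_mul_sq_atTop hc)
  have h2 := ENNReal.Tendsto.mul_const (b := K) h (Or.inr hK)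
  simpa using h2

/-- f² decays like exp(-y²/2). One factor exp(-x²/4) is pulled out at the edge of the tail and beats
exp(2px²) when p < 1/8; the other keeps the integral finite. -/
lemma tendsto_tailFun_of_le_exp {f : ℝ → ℝ} {C p : ℝ} (hp : p < 1 / 8)
    (hf : ∀ y, |f y| ≤ C * Real.exp (-(1 / 4) * y ^ 2)) :
    Tendsto (tailFun p f) atTop (nhds 0) := by
  have hC : 0 ≤ C := by
    have := (abs_nonneg _).trans (hf 0)
    simpa using this
  have hg : Integrable fun y : ℝ => C ^ 2 * Real.exp (-(1 / 4) * y ^ 2) :=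
    (integrable_exp_neg_mul_sq (by norm_num)).const_mul _
  have hfin : (∫⁻ y : ℝ, ENNReal.ofReal (C ^ 2 * Real.exp (-(1 / 4) * y ^ 2))) ≠ ∞ :=
    (hg.lintegral_lt_top).ne
  have hlim := tendsto_ofReal_mul_exp (c := 1 / 4 - 2 * p) (by linarith) hfin
  refine tendsto_of_tendsto_of_tendsto_of_le_of_le' tendsto_const_nhds hlim
    (Eventually.of_forall fun _ => zero_le) ?_
  filter_upwards [eventually_ge_atTop 0] with x hx
  have h1 : ∫⁻ y in {y : ℝ | x < |y|}, ‖f y‖ₑ ^ 2 ≤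
      ENNReal.ofReal (Real.exp (-(1 / 4) * x ^ 2)) *
        ∫⁻ y : ℝ, ENNReal.ofReal (C ^ 2 * Real.exp (-(1 / 4) * y ^ 2)) := by
    rw [← lintegral_const_mul' _ _ ENNReal.ofReal_ne_top]
    refine (setLIntegral_mono' (measurableSet_lt_abs x) fun y hy => ?_).trans
      (setLIntegral_le_lintegral _ _)
    rw [Real.enorm_eq_ofReal_abs, ← ENNReal.ofReal_pow (abs_nonneg _),
      ← ENNReal.ofReal_mul (Real.exp_pos _).le]
    refine ENNReal.ofReal_le_ofReal ((pow_le_pow_left₀ (abs_nonneg _) (hf y) 2).trans ?_)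
    have hxy : x ^ 2 ≤ y ^ 2 := by
      rw [← sq_abs y]; exact pow_le_pow_left₀ hx (le_of_lt hy) 2
    have e : (C * Real.exp (-(1 / 4) * y ^ 2)) ^ 2 =
        C ^ 2 * (Real.exp (-(1 / 4) * y ^ 2) * Real.exp (-(1 / 4) * y ^ 2)) := by ring
    rw [e]
    have : Real.exp (-(1 / 4) * y ^ 2) ≤ Real.exp (-(1 / 4) * x ^ 2) :=
      Real.exp_le_exp.2 (by linarith)
    calc C ^ 2 * (Real.exp (-(1 / 4) * y ^ 2) * Real.exp (-(1 / 4) * y ^ 2))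
        ≤ C ^ 2 * (Real.exp (-(1 / 4) * x ^ 2) * Real.exp (-(1 / 4) * y ^ 2)) := by gcongr
      _ = _ := by ring
  unfold tailFun
  refine (mul_le_mul_right h1 _).trans ?_
  rw [← mul_assoc, ← ENNReal.ofReal_mul (Real.exp_pos _).le, ← Real.exp_add]
  refine le_of_eq ?_
  congr 3; ring

lemma eventually_tailFun_le {f : ℝ → ℝ} {p r : ℝ}
    (h : limsup (tailFun p f) atTop ≤ ENNReal.ofReal r) :
    ∀ᶠ x in atTop, tailFun p f x ≤ ENNReal.ofReal r + 1 := by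
  have h1 : limsup (tailFun p f) atTop < ENNReal.ofReal r + 1 :=
    h.trans_lt (ENNReal.lt_add_right ENNReal.ofReal_ne_top one_ne_zero)
  filter_upwards [eventually_lt_of_limsup_lt h1] with x hx using hx.le

/-- Lowering p turns a bounded upper limit into the limit 0. The tail condition then survives
addition of the perturbation with any positive bound on the right. -/
lemma tendsto_tailFun_of_limsup_le {f : ℝ → ℝ} {p p' r : ℝ} (hp : p' < p)
    (h : limsup (tailFun p f) atTop ≤ ENNReal.ofReal r) :
    Tendsto (tailFun p' f) atTop (nhds 0) := by
  have hlim := tendsto_ofReal_mul_exp (c := 2 * (p - p')) (by linarith)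
    (K := ENNReal.ofReal r + 1) (by simp)
  refine tendsto_of_tendsto_of_tendsto_of_le_of_le' tendsto_const_nhds hlim
    (Eventually.of_forall fun _ => zero_le) ?_
  filter_upwards [eventually_tailFun_le h] with x hx
  refine le_trans (le_of_eq ?_) (mul_le_mul_right hx _)
  unfold tailFun
  rw [← mul_assoc, ← ENNReal.ofReal_mul (Real.exp_pos _).le, ← Real.exp_add]
  congr 3; ring

lemma tendsto_tailFun_add {f g : ℝ → ℝ} {p : ℝ} (hfm : Measurable f)
    (hf : Tendsto (tailFun p f) atTop (nhds 0)) (hg : Tendsto (tailFun p g) atTop (nhds 0)) :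
    Tendsto (tailFun p fun y => f y + g y) atTop (nhds 0) := by
  have h := ENNReal.Tendsto.const_mul (a := 2) (hf.add hg) (Or.inr (by simp))
  simp only [add_zero, mul_zero] at h
  refine tendsto_of_tendsto_of_tendsto_of_le_of_le tendsto_const_nhds h
    (fun _ => zero_le) fun x => ?_
  simp only [tailFun]
  rw [← mul_add, mul_left_comm]
  refine mul_le_mul_right ?_ _
  rw [← lintegral_add_left (by fun_prop), ← lintegral_const_mul' _ _ (by simp)]
  refine lintegral_mono fun y => ?_
  rw [Real.enorm_eq_ofReal_abs, Real.enorm_eq_ofReal_abs, Real.enorm_eq_ofReal_abs,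
    ← ENNReal.ofReal_pow (abs_nonneg _), ← ENNReal.ofReal_pow (abs_nonneg _),
    ← ENNReal.ofReal_pow (abs_nonneg _), ← ENNReal.ofReal_add (by positivity) (by positivity),
    ← ENNReal.ofReal_ofNat, ← ENNReal.ofReal_mul (by norm_num)]
  refine ENNReal.ofReal_le_ofReal ?_
  rw [sq_abs, sq_abs, sq_abs]
  nlinarith [sq_nonneg (f y - g y)]

/-- The second moment weight against an `L²` function with Gaussian tails. -/
lemma integrable_abs_mul_of_tail {f : ℝ → ℝ} (hf : Continuous f) {B : ℝ} (hB : ∀ x, |f x| ≤ B)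
    (hi : Integrable f) {p r : ℝ} (hp : 0 < p)
    (h : limsup (tailFun p f) atTop ≤ ENNReal.ofReal r) :
    Integrable fun y => |y| * |f y| := by
  obtain ⟨x₀, hx₀⟩ := eventually_atTop.1 (eventually_tailFun_le h)
  set ν : Measure ℝ := volume.withDensity fun y => ENNReal.ofReal (f y ^ 2) with hν
  have hf2 : Integrable fun y => f y ^ 2 := by
    refine (hi.norm.mul_const B).mono' (hf.pow 2).aestronglyMeasurable (ae_of_all _ fun x => ?_)
    rw [norm_pow, pow_two]
    exact mul_le_mul_of_nonneg_left (hB x) (norm_nonneg _)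
  have hνs : ∀ t, ν {y | t < |y|} = ∫⁻ y in {y : ℝ | t < |y|}, ‖f y‖ₑ ^ 2 := fun t => by
    rw [hν, withDensity_apply _ (measurableSet_lt_abs t)]
    refine lintegral_congr fun y => ?_
    rw [Real.enorm_eq_ofReal_abs, ← ENNReal.ofReal_pow (abs_nonneg _), sq_abs]
  have hνu : ν Set.univ ≠ ∞ := by
    rw [hν, withDensity_apply _ MeasurableSet.univ, setLIntegral_univ]
    exact hf2.lintegral_lt_top.ne
  -- Layer-cake formula for the fourth moment of f(y)² dy. Beyond x₁ the tail exp(-2pt²) beats t³;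
  -- below x₁ the total mass suffices.
  have hlay := lintegral_rpow_eq_lintegral_meas_lt_mul ν (f := fun y => |y|)
    (ae_of_all _ fun y => abs_nonneg y) continuous_abs.aemeasurable (p := 4) (by norm_num)
  have hfin : ∫⁻ t in Set.Ioi 0, ν {a : ℝ | t < |a|} * ENNReal.ofReal (t ^ ((4 : ℝ) - 1)) ≠ ∞ := by
    set K := ENNReal.ofReal r + 1 with hK
    have hKt : K ≠ ∞ := by simp [hK]
    set x₁ := max x₀ 0 with hx₁
    have hsplit : Set.Ioi (0 : ℝ) ⊆ Set.Ioc 0 x₁ ∪ Set.Ioi x₁ := fun t ht => by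
      rcases le_or_gt t x₁ with h | h
      · exact Or.inl ⟨ht, h⟩
      · exact Or.inr h
    refine ne_top_of_le_ne_top ?_ ((lintegral_mono_set hsplit).trans (lintegral_union_le _ _ _))
    refine ENNReal.add_ne_top.2 ⟨?_, ?_⟩
    · have : ∀ t ∈ Set.Ioc 0 x₁, ν {a : ℝ | t < |a|} * ENNReal.ofReal (t ^ ((4 : ℝ) - 1)) ≤
          ν Set.univ * ENNReal.ofReal (x₁ ^ ((4 : ℝ) - 1)) := fun t ht => by
        refine mul_le_mul' (measure_mono (Set.subset_univ _)) (ENNReal.ofReal_le_ofReal ?_)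
        exact Real.rpow_le_rpow ht.1.le ht.2 (by norm_num)
      refine ne_top_of_le_ne_top ?_ (setLIntegral_mono' measurableSet_Ioc this)
      rw [setLIntegral_const]
      exact ENNReal.mul_ne_top (ENNReal.mul_ne_top hνu ENNReal.ofReal_ne_top) (by simp)
    · have hint := (integrable_rpow_mul_exp_neg_mul_sq (b := 2 * p) (by linarith) (s := 3)
        (by norm_num))
      have : ∀ t ∈ Set.Ioi x₁, ν {a : ℝ | t < |a|} * ENNReal.ofReal (t ^ ((4 : ℝ) - 1)) ≤
          K * ENNReal.ofReal (t ^ (3 : ℝ) * Real.exp (-(2 * p) * t ^ 2)) := fun t ht => by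
        have ht0 : 0 ≤ t := (le_max_right _ _).trans (le_of_lt ht)
        have h1 := hx₀ t ((le_max_left _ _).trans (le_of_lt ht))
        unfold tailFun at h1
        rw [← hνs] at h1
        have h2 : ν {a : ℝ | t < |a|} ≤ ENNReal.ofReal (Real.exp (-(2 * p) * t ^ 2)) * K := by
          refine le_trans (le_of_eq ?_) (mul_le_mul_right h1 _)
          rw [← mul_assoc, ← ENNReal.ofReal_mul (Real.exp_pos _).le, ← Real.exp_add]
          ring_nf; simp
        refine (mul_le_mul_left h2 _).trans (le_of_eq ?_)
        rw [ENNReal.ofReal_mul (Real.rpow_nonneg ht0 _)]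
        norm_num
        ring
      refine ne_top_of_le_ne_top ?_ (setLIntegral_mono' measurableSet_Ioi this)
      rw [lintegral_const_mul' _ _ hKt]
      exact ENNReal.mul_ne_top hKt (ne_top_of_le_ne_top hint.lintegral_lt_top.ne
        (setLIntegral_le_lintegral _ _))
  have h4 : Integrable fun y => |y| ^ 4 * f y ^ 2 := by
    refine ⟨Continuous.aestronglyMeasurable (by fun_prop), ?_⟩
    rw [hasFiniteIntegral_iff_ofReal (ae_of_all _ fun y => by
      simp only [Pi.zero_apply]; positivity)]
    have e : ∫⁻ y, ENNReal.ofReal (|y| ^ 4 * f y ^ 2) = ∫⁻ y, ENNReal.ofReal (|y| ^ (4 : ℝ)) ∂ν := by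
      rw [hν, lintegral_withDensity_eq_lintegral_mul _ (by fun_prop) (by fun_prop)]
      refine lintegral_congr fun y => ?_
      simp only [Pi.mul_apply]
      rw [← ENNReal.ofReal_mul (sq_nonneg _), mul_comm]
      norm_cast
    rw [e, hlay]
    exact (ENNReal.mul_ne_top ENNReal.ofReal_ne_top hfin).lt_top
  refine ((h4.add hf2).add integrable_inv_one_add_sq).mono'
    (Continuous.aestronglyMeasurable (by fun_prop)) (ae_of_all _ fun y => ?_)
  simp only [Pi.add_apply]
  rw [Real.norm_of_nonneg (by positivity)]
  have hpos : (0 : ℝ) < 1 + y ^ 2 := by positivity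
  have e1 : |y| ^ 4 = y ^ 4 := by
    have := sq_abs y
    calc |y| ^ 4 = (|y| ^ 2) ^ 2 := by ring
      _ = y ^ 4 := by rw [this]; ring
  -- Weighted AM–GM: the weight 1 + y² leaves the integrable (1 + y²)⁻¹ on one side and at most
  -- fourth moments of f² on the other.
  have h5 : |y| * |f y| ≤ (1 + y ^ 2) * (y ^ 2 * f y ^ 2) / 2 + (1 + y ^ 2)⁻¹ / 2 := by
    have h6 : 0 ≤ ((1 + y ^ 2) * (|y| * |f y|) - 1) ^ 2 / (2 * (1 + y ^ 2)) := by positivity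
    have h7 : ((1 + y ^ 2) * (|y| * |f y|) - 1) ^ 2 / (2 * (1 + y ^ 2)) =
        (1 + y ^ 2) * (|y| ^ 2 * |f y| ^ 2) / 2 + (1 + y ^ 2)⁻¹ / 2 - |y| * |f y| := by
      field_simp; ring
    rw [h7, sq_abs, sq_abs] at h6
    linarith
  have h8 : 0 ≤ (1 + y ^ 2)⁻¹ := by positivity
  rw [e1]
  nlinarith [sq_nonneg (f y), mul_nonneg (sq_nonneg (y ^ 2 - 1)) (sq_nonneg (f y))]

/-- A function whose derivative has an absolute first moment differs from a constant by an
integrable function, if it is even. -/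
lemma exists_integrable_sub_const {f : ℝ → ℝ} (hf : Differentiable ℝ f)
    (heven : ∀ x, f (-x) = f x) (hi : Integrable (deriv f))
    (hm : Integrable fun y => |y| * |deriv f y|) :
    ∃ l : ℝ, Integrable fun x => f x - l := by
  obtain ⟨l, hl⟩ : ∃ l, Tendsto f atTop (nhds l) :=
    ⟨_, tendsto_limUnder_of_hasDerivAt_of_integrableOn_Ioi (a := 0)
      (fun x _ => (hf x).hasDerivAt) hi.integrableOn⟩
  refine ⟨l, ?_⟩
  -- For x > 0, |f(x) - l| ≤ ∫_x^∞ |f'|. Fubini over 0 < x < y bounds the integral in x by ∫ y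
  -- |f'(y)| dy; evenness handles x < 0.
  have hint : Integrable (Function.uncurry fun x y : ℝ =>
      Set.indicator {q : ℝ × ℝ | 0 < q.1 ∧ q.1 < q.2} (fun q => |deriv f q.2|) (x, y))
      (volume.prod volume) := by
    have hms : MeasurableSet {q : ℝ × ℝ | 0 < q.1 ∧ q.1 < q.2} :=
      (measurableSet_lt measurable_const measurable_fst).inter
        (measurableSet_lt measurable_fst measurable_snd)
    have hmeas : AEStronglyMeasurable (fun q : ℝ × ℝ => |deriv f q.2|)
        ((volume : Measure ℝ).prod volume) := hi.abs.aestronglyMeasurable.comp_snd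
    have e : (Function.uncurry fun x y : ℝ =>
        Set.indicator {q : ℝ × ℝ | 0 < q.1 ∧ q.1 < q.2} (fun q => |deriv f q.2|) (x, y)) =
        Set.indicator {q : ℝ × ℝ | 0 < q.1 ∧ q.1 < q.2} (fun q => |deriv f q.2|) := by
      ext ⟨x, y⟩; rfl
    rw [e, integrable_prod_iff' (hmeas.indicator hms)]
    have hsec : ∀ y : ℝ, (fun x : ℝ => Set.indicator {q : ℝ × ℝ | 0 < q.1 ∧ q.1 < q.2}
        (fun q => |deriv f q.2|) (x, y)) =
        Set.indicator (Set.Ioo 0 y) fun _ => |deriv f y| := fun y => by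
      ext x; simp [Set.indicator_apply]
    refine ⟨ae_of_all _ fun y => ?_, ?_⟩
    · rw [hsec]
      exact (integrable_indicator_iff measurableSet_Ioo).2
        (integrableOn_const (by simp))
    · refine hm.mono' ?_ (ae_of_all _ fun y => ?_)
      · exact ((hmeas.indicator hms).norm).prod_swap.integral_prod_right'
      · rw [Real.norm_of_nonneg (integral_nonneg fun _ => norm_nonneg _)]
        have : (fun x : ℝ => ‖Set.indicator {q : ℝ × ℝ | 0 < q.1 ∧ q.1 < q.2}
            (fun q => |deriv f q.2|) (x, y)‖) =
            Set.indicator (Set.Ioo 0 y) fun _ => |deriv f y| := by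
          rw [← funext_iff.1 (funext hsec) y]
          ext x
          rw [Real.norm_of_nonneg]
          exact Set.indicator_nonneg (fun _ _ => abs_nonneg _) _
        rw [this, integral_indicator measurableSet_Ioo, setIntegral_const, smul_eq_mul]
        refine mul_le_mul_of_nonneg_right ?_ (abs_nonneg _)
        simp only [Measure.real, Real.volume_Ioo, sub_zero]
        rw [ENNReal.toReal_ofReal']
        exact max_le (le_abs_self y) (abs_nonneg y)
  have hI := hint.integral_prod_left
  have hpos : IntegrableOn (fun x => f x - l) (Set.Ioi 0) := by
    refine hI.integrableOn.mono' (hf.continuous.sub continuous_const).aestronglyMeasurable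
      ((ae_restrict_iff' measurableSet_Ioi).2 (ae_of_all _ fun x hx => ?_))
    have h1 := integral_Ioi_of_hasDerivAt_of_tendsto' (a := x) (fun z _ => (hf z).hasDerivAt)
      hi.integrableOn hl
    have h2 : (fun y : ℝ => Function.uncurry (fun x y : ℝ =>
        Set.indicator {q : ℝ × ℝ | 0 < q.1 ∧ q.1 < q.2} (fun q => |deriv f q.2|) (x, y)) (x, y)) =
        Set.indicator (Set.Ioi x) fun y => |deriv f y| := by
      ext y
      have hx' : 0 < x := hx
      simp [Set.indicator_apply, hx']
    rw [h2, integral_indicator measurableSet_Ioi, ← norm_neg, neg_sub, ← h1]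
    exact norm_integral_le_integral_norm _
  have hneg : IntegrableOn (fun x => f x - l) (Set.Iio 0) := by
    have h := hpos.comp_neg
    simp only [heven, Set.neg_Ioi, neg_zero] at h
    exact h
  rw [← integrableOn_univ, ← Set.Iio_union_Ici (a := (0 : ℝ))]
  exact hneg.union ((integrableOn_Ici_iff_integrableOn_Ioi (by simp)).2 hpos)

/-! ### The two-point lower bound -/

lemma lintegral_pi_prod {n : ℕ} (ν : Fin n → Measure ℝ) [∀ i, SigmaFinite (ν i)]
    (g : Fin n → ℝ → ℝ≥0∞) (hg : ∀ i, Measurable (g i)) :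
    ∫⁻ x, ∏ i, g i (x i) ∂(Measure.pi ν) = ∏ i, ∫⁻ y, g i y ∂(ν i) := by
  induction n with
  | zero => simp
  | succ n ih =>
    rw [← ((measurePreserving_piFinSuccAbove ν 0).symm).lintegral_comp_emb
      (MeasurableEquiv.measurableEmbedding _)]
    simp_rw [MeasurableEquiv.piFinSuccAbove_symm_apply, Fin.insertNthEquiv,
      Fin.prod_univ_succ, Fin.insertNth_zero, Equiv.coe_fn_mk, Fin.cons_succ,
      Fin.zero_succAbove, Fin.cons_zero]
    rw [← ih (fun i => ν i.succ) (fun i => g i.succ) fun i => hg _]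
    have h1 : Measurable fun x : Fin n → ℝ => ∏ i, g i.succ (x i) :=
      Finset.measurable_prod _ fun i _ => (hg _).comp (measurable_pi_apply i)
    exact lintegral_prod_mul (hg 0).aemeasurable h1.aemeasurable

lemma pi_withDensity {n : ℕ} (ν : Measure ℝ) [IsProbabilityMeasure ν] {g : ℝ → ℝ≥0∞}
    (hg : Measurable g) [SigmaFinite (ν.withDensity g)] :
    Measure.pi (fun _ : Fin n => ν.withDensity g) =
      (Measure.pi fun _ : Fin n => ν).withDensity fun x => ∏ i, g (x i) := by
  refine Measure.pi_eq fun s hs => ?_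
  rw [withDensity_apply _ (MeasurableSet.univ_pi hs),
    ← lintegral_indicator (MeasurableSet.univ_pi hs)]
  have e : (Set.univ.pi s).indicator (fun x : Fin n → ℝ => ∏ i, g (x i)) =
      fun x => ∏ i, (s i).indicator g (x i) := by
    ext x
    by_cases hx : x ∈ Set.univ.pi s
    · rw [Set.indicator_of_mem hx]
      exact Finset.prod_congr rfl fun i _ => (Set.indicator_of_mem (hx i trivial) g).symm
    · rw [Set.indicator_of_notMem hx]
      simp only [Set.mem_pi, Set.mem_univ, true_implies, not_forall] at hx
      obtain ⟨i, hi⟩ := hx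
      exact (Finset.prod_eq_zero (Finset.mem_univ i) (Set.indicator_of_notMem hi g)).symm
  rw [e, lintegral_pi_prod _ _ fun i => hg.indicator (hs i)]
  refine Finset.prod_congr rfl fun i _ => ?_
  rw [lintegral_indicator (hs i), withDensity_apply _ (hs i)]

lemma IsProbDensity.isProbabilityMeasure {μ : ℝ → ℝ} (h : IsProbDensity μ) :
    IsProbabilityMeasure ((volume : Measure ℝ).withDensity fun x => ENNReal.ofReal (μ x)) := by
  refine ⟨?_⟩
  rw [withDensity_apply _ MeasurableSet.univ, setLIntegral_univ,
    ← ofReal_integral_eq_lintegral_ofReal h.integrable (ae_of_all _ h.nonneg), h.integral_eq_one,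
    ENNReal.ofReal_one]

/-- Two product laws whose densities are close cannot be told apart. -/
theorem two_point_bound {N : ℕ} {μ ν r : ℝ → ℝ} (hμ : IsProbDensity μ) (hμm : Measurable μ)
    (hν : IsProbDensity ν) (hr : Measurable r) (hr0 : ∀ x, 0 ≤ r x) (hνr : ∀ x, ν x = μ x * r x)
    {ε : ℝ} (hε : ∀ x, |r x - 1| ≤ ε) (hN : N * ε ^ 2 ≤ 1) {A₀ A₁ : Set (Fin N → ℝ)}
    (hA : A₀ ∪ A₁ = Set.univ) {b : ℝ≥0∞} (h0 : iidLaw N μ A₀ ≤ b) (h1 : iidLaw N ν A₁ ≤ b) :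
    (14 : ℝ≥0∞)⁻¹ ≤ b := by
  have hm1 : Measurable fun x => ENNReal.ofReal (μ x) := hμm.ennreal_ofReal
  have hm2 : Measurable fun x => ENNReal.ofReal (r x) := hr.ennreal_ofReal
  set m := (volume : Measure ℝ).withDensity fun x => ENNReal.ofReal (μ x) with hmd
  have : IsProbabilityMeasure m := hμ.isProbabilityMeasure
  have hν' : (volume : Measure ℝ).withDensity (fun x => ENNReal.ofReal (ν x)) =
      m.withDensity fun x => ENNReal.ofReal (r x) := by
    rw [hmd, ← withDensity_mul _ hm1 hm2]
    congr 1; ext x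
    rw [hνr, ENNReal.ofReal_mul (hμ.nonneg x)]; rfl
  have hp2 : IsProbabilityMeasure (m.withDensity fun x => ENNReal.ofReal (r x)) := by
    rw [← hν']; exact hν.isProbabilityMeasure
  set P₀ := iidLaw N μ with hP₀
  set P₁ := iidLaw N ν with hP₁
  have hP₀' : P₀ = Measure.pi fun _ : Fin N => m := rfl
  have : IsProbabilityMeasure P₁ := by
    rw [hP₁, iidLaw, hν']; infer_instance
  let R : (Fin N → ℝ) → ℝ≥0∞ := fun x => ∏ i, ENNReal.ofReal (r (x i))
  have hRm : Measurable R :=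
    Finset.measurable_prod _ fun i _ => hm2.comp (measurable_pi_apply i)
  have hPR : P₁ = P₀.withDensity R := by
    rw [hP₁, iidLaw, hν', pi_withDensity m hm2]; rfl
  have hε0 : 0 ≤ ε := (abs_nonneg _).trans (hε 0)
  -- second moment of the likelihood ratio
  have hR2 : ∫⁻ x, R x ^ 2 ∂P₀ ≤ 3 := by
    have e : ∀ x, R x ^ 2 = ∏ i, ENNReal.ofReal (r (x i)) ^ 2 := fun x =>
      (Finset.prod_pow _ _ _).symm
    simp_rw [e]
    rw [hP₀', lintegral_pi_prod (fun _ : Fin N => m) (fun _ y => ENNReal.ofReal (r y) ^ 2)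
      fun _ => hm2.pow_const 2, Finset.prod_const, Finset.card_univ, Fintype.card_fin]
    -- Pointwise μ r² = 2ν - μ + μ (r - 1)². The first two terms integrate to 1, so the deviation of
    -- r enters quadratically and N ε² ≤ 1 is enough.
    have hone : ∫⁻ y, ENNReal.ofReal (r y) ^ 2 ∂m ≤ ENNReal.ofReal (1 + ε ^ 2) := by
      have i1 : Integrable ν := hν.integrable
      have i2 : Integrable fun y => μ y * (r y - 1) ^ 2 :=
        hμ.integrable.mul_bdd (c := ε ^ 2) (by fun_prop) (ae_of_all _ fun y => by
          rw [norm_pow]; exact pow_le_pow_left₀ (norm_nonneg _) (hε y) 2)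
      have i3 : Integrable fun y => 2 * ν y - μ y + μ y * (r y - 1) ^ 2 :=
        ((i1.const_mul 2).sub hμ.integrable).add i2
      rw [hmd, lintegral_withDensity_eq_lintegral_mul _ hm1 (hm2.pow_const 2)]
      have e2 : ∀ y, ((fun x => ENNReal.ofReal (μ x)) * fun y => ENNReal.ofReal (r y) ^ 2) y =
          ENNReal.ofReal (2 * ν y - μ y + μ y * (r y - 1) ^ 2) := fun y => by
        simp only [Pi.mul_apply]
        rw [← ENNReal.ofReal_pow (hr0 y), ← ENNReal.ofReal_mul (hμ.nonneg y), hνr]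
        congr 1; ring
      simp_rw [e2]
      rw [← ofReal_integral_eq_lintegral_ofReal i3 (ae_of_all _ fun y => by
        have : 2 * ν y - μ y + μ y * (r y - 1) ^ 2 = μ y * r y ^ 2 := by rw [hνr]; ring
        simp only [Pi.zero_apply]
        rw [this]
        exact mul_nonneg (hμ.nonneg y) (sq_nonneg _))]
      refine ENNReal.ofReal_le_ofReal ?_
      have i4 : Integrable fun y => 2 * ν y - μ y := (i1.const_mul 2).sub hμ.integrable
      rw [integral_add i4 i2, integral_sub (i1.const_mul 2) hμ.integrable,
        integral_const_mul, hν.integral_eq_one, hμ.integral_eq_one]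
      have h5 : ∫ y, μ y * (r y - 1) ^ 2 ≤ ∫ y, μ y * ε ^ 2 := by
        refine integral_mono i2 (hμ.integrable.mul_const _) fun y => ?_
        refine mul_le_mul_of_nonneg_left ?_ (hμ.nonneg y)
        rw [← sq_abs]; exact pow_le_pow_left₀ (abs_nonneg _) (hε y) 2
      rw [integral_mul_const, hμ.integral_eq_one] at h5
      linarith
    refine (pow_le_pow_left' hone N).trans ?_
    rw [← ENNReal.ofReal_pow (by positivity), ← ENNReal.ofReal_ofNat]
    refine ENNReal.ofReal_le_ofReal ?_
    calc (1 + ε ^ 2) ^ N ≤ Real.exp (ε ^ 2) ^ N :=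
          pow_le_pow_left₀ (by positivity) (by linarith [Real.add_one_le_exp (ε ^ 2)]) N
      _ = Real.exp (N * ε ^ 2) := (Real.exp_nat_mul _ _).symm
      _ ≤ Real.exp 1 := Real.exp_le_exp.2 hN
      _ ≤ 3 := by linarith [Real.exp_one_lt_d9]
  -- From R ≤ 6 + R²/6 and a second moment of at most 3. With P₁ A₁ ≤ b this gives 1 ≤ 7b + 1/2. The
  -- error sets need not be measurable, hence the measurable hull.
  have hbound : P₁ A₀ ≤ 6 * P₀ A₀ + 2⁻¹ := by
    set S := toMeasurable P₀ A₀ with hS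
    have hSm : MeasurableSet S := measurableSet_toMeasurable _ _
    calc P₁ A₀ ≤ P₁ S := measure_mono (subset_toMeasurable _ _)
      _ = ∫⁻ x in S, R x ∂P₀ := by rw [hPR, withDensity_apply _ hSm]
      _ ≤ ∫⁻ x in S, (6 + 6⁻¹ * R x ^ 2) ∂P₀ := by
          refine lintegral_mono fun x => ?_
          rcases le_total (R x) 6 with h | h
          · exact h.trans le_self_add
          · refine le_trans ?_ le_add_self
            have h6 : (1 : ℝ≥0∞) ≤ 6⁻¹ * R x := by
              rw [← ENNReal.inv_mul_cancel (a := 6) (by norm_num) (by norm_num)]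
              gcongr
            calc R x = 1 * R x := (one_mul _).symm
              _ ≤ (6⁻¹ * R x) * R x := by gcongr
              _ = _ := by ring
      _ = 6 * P₀ S + ∫⁻ x in S, 6⁻¹ * R x ^ 2 ∂P₀ := by
          rw [lintegral_add_left measurable_const, setLIntegral_const]
      _ ≤ 6 * P₀ S + 2⁻¹ := by
          gcongr
          refine (setLIntegral_le_lintegral _ _).trans ?_
          rw [lintegral_const_mul _ (hRm.pow_const 2)]
          calc (6 : ℝ≥0∞)⁻¹ * ∫⁻ x, R x ^ 2 ∂P₀ ≤ 6⁻¹ * 3 := by gcongr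
            _ = 2⁻¹ := by
              rw [show (6 : ℝ≥0∞) = 2 * 3 by norm_num,
                ENNReal.mul_inv (by norm_num) (by norm_num), mul_assoc,
                ENNReal.inv_mul_cancel (by norm_num) (by norm_num), mul_one]
      _ = 6 * P₀ A₀ + 2⁻¹ := by rw [hS, measure_toMeasurable]
  have hall : (1 : ℝ≥0∞) ≤ 7 * b + 2⁻¹ := by
    calc (1 : ℝ≥0∞) = P₁ Set.univ := measure_univ.symm
      _ ≤ P₁ A₀ + P₁ A₁ := by rw [← hA]; exact measure_union_le _ _
      _ ≤ (6 * b + 2⁻¹) + b := by gcongr; exact hbound.trans (by gcongr)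
      _ = 7 * b + 2⁻¹ := by ring
  have h7 : (2 : ℝ≥0∞)⁻¹ ≤ 7 * b := by
    have h8 : (1 : ℝ≥0∞) = 2⁻¹ + 2⁻¹ := (ENNReal.inv_two_add_inv_two).symm
    rw [h8] at hall
    exact (ENNReal.add_le_add_iff_right (by simp)).1 hall
  rw [show (14 : ℝ≥0∞) = 2 * 7 by norm_num, ENNReal.mul_inv (by norm_num) (by norm_num),
    ← div_eq_mul_inv]
  exact ENNReal.div_le_of_le_mul' h7

/-! ### Stability of the weighted Fourier bound under the Gibbs map -/

/-- Additive constants cancel against the normaliser, so a change of potential is an exponential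
tilt of the old density. This is what lets the shifts of W by constants be ignored. -/
lemma gibbs_add_const {U f : ℝ → ℝ} (hU : Integrable fun x => Real.exp (-U x)) (c : ℝ) (x : ℝ) :
    gibbs (fun y => U y + f y + c) x =
      (∫ y, gibbs U y * Real.exp (-f y))⁻¹ * (gibbs U x * Real.exp (-f x)) := by
  have hZ := integral_exp_pos' hU
  have e : ∀ y, Real.exp (-(U y + f y + c)) =
      Real.exp (-c) * (Real.exp (-U y) * Real.exp (-f y)) := fun y => by
    rw [← Real.exp_add, ← Real.exp_add]; ring_nf
  unfold gibbs
  simp_rw [e, mul_assoc]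
  rw [integral_const_mul, integral_const_mul]
  by_cases h0 : ∫ y, Real.exp (-U y) * Real.exp (-f y) = 0
  · simp [h0]
  have hc := (Real.exp_pos (-c)).ne'
  field_simp

/-- The unnormalised tilt is controlled by `norm_fourierR_mul_exp_sub_le`. The normaliser is its
Fourier transform at frequency 0, where the weight is 1, so the same estimate bounds |c - 1|; the
second smallness condition gives c ≥ 1/2. -/
lemma norm_fourierR_tilt_sub_le {k : ℕ} (hk : 2 ≤ k) {ρ f : ℝ → ℝ} {m : ℝ → ℂ} {A M B : ℝ}
    (hρ : IsProbDensity ρ) (hm : AEStronglyMeasurable m volume) (hA : 0 ≤ A)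
    (hmb : ∀ y, ‖m y‖ ≤ A * (wt k y)⁻¹) (hf : HasFourierRep f m) (hfc : Continuous f)
    (hfb : ∀ x, |f x| ≤ B) (hM : ∀ y, ‖fourierR ρ y‖ ≤ M * (wt k y)⁻¹)
    (h1 : convC k * A ≤ 1) (h2 : 4 * (convC k * A) * M ≤ 1) (z : ℝ) :
    ‖fourierR (fun x => (∫ y, ρ y * Real.exp (-f y))⁻¹ * (ρ x * Real.exp (-f x))) z -
      fourierR ρ z‖ ≤ 4 * (1 + M) * M * convC k * A * (wt k z)⁻¹ := by
  have hM0 : 0 ≤ M := by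
    have h1 := (norm_nonneg _).trans (hM 0)
    exact nonneg_of_mul_nonneg_left h1 (inv_pos.2 (wt_pos k 0))
  have hC := convC_nonneg k
  have hCA : 0 ≤ convC k * A := mul_nonneg hC hA
  set E := (Real.exp (convC k * A) - 1) * M with hE
  have hE1 : E ≤ 2 * (convC k * A) * M := by
    have := Real.abs_exp_sub_one_le (x := convC k * A) (by rwa [abs_of_nonneg hCA])
    rw [abs_of_nonneg hCA] at this
    exact mul_le_mul_of_nonneg_right ((le_abs_self _).trans this) hM0
  have hkey := norm_fourierR_mul_exp_sub_le hk hρ.integrable hm hA hmb hf hfc hfb hM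
  rw [← hE] at hkey
  set c := ∫ y, ρ y * Real.exp (-f y) with hc
  have hc1 : |c - 1| ≤ E := by
    have := hkey 0
    rw [fourierR_zero, fourierR_zero, hρ.integral_eq_one, ← hc, ← Complex.ofReal_sub,
      Complex.norm_real, Real.norm_eq_abs] at this
    simpa [wt] using this
  have hchalf : 1 / 2 ≤ c := by
    have := (abs_le.1 hc1).1
    linarith
  have hc0 : 0 < c := by linarith
  rw [fourierR_const_mul]
  set g := fourierR (fun x => ρ x * Real.exp (-f x)) z with hg
  have hw := inv_pos.2 (wt_pos k z)
  have hcC : (c : ℂ) ≠ 0 := by exact_mod_cast hc0.ne'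
  have e : ((c⁻¹ : ℝ) : ℂ) * g - fourierR ρ z =
      ((c⁻¹ : ℝ) : ℂ) * ((g - fourierR ρ z) + fourierR ρ z * ((1 - c : ℝ) : ℂ)) := by
    push_cast; field_simp; ring
  rw [e, norm_mul, Complex.norm_real, Real.norm_of_nonneg (inv_nonneg.2 hc0.le)]
  have hcinv : c⁻¹ ≤ 2 := by
    rw [inv_le_comm₀ hc0 two_pos]; linarith
  have h5 : ‖(g - fourierR ρ z) + fourierR ρ z * ((1 - c : ℝ) : ℂ)‖ ≤
      (1 + M) * E * (wt k z)⁻¹ := by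
    refine (norm_add_le _ _).trans ?_
    rw [norm_mul, Complex.norm_real, Real.norm_eq_abs, abs_sub_comm]
    have h6 : ‖fourierR ρ z‖ * |c - 1| ≤ (M * (wt k z)⁻¹) * E :=
      mul_le_mul (hM z) hc1 (abs_nonneg _) (by positivity)
    linarith [hkey z]
  calc c⁻¹ * _ ≤ 2 * ((1 + M) * E * (wt k z)⁻¹) := by
        gcongr
    _ ≤ 2 * ((1 + M) * (2 * (convC k * A) * M) * (wt k z)⁻¹) := by gcongr
    _ = _ := by ring

lemma HasFourierRep.add {f g : ℝ → ℝ} {m n : ℝ → ℂ} (hf : HasFourierRep f m)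
    (hg : HasFourierRep g n) (hm : Integrable m) (hn : Integrable n) :
    HasFourierRep (fun x => f x + g x) fun z => m z + n z := by
  intro x
  have hb : ∀ {q : ℝ → ℂ}, Integrable q →
      Integrable fun y : ℝ => Complex.exp (-(Complex.I * (x : ℂ) * (y : ℂ))) * q y := fun hq =>
    hq.bdd_mul (c := 1) (Continuous.aestronglyMeasurable (by fun_prop)) (ae_of_all _ fun y => by
      rw [norm_cexp_neg_I_mul])
  simp only [Complex.ofReal_add, mul_add]
  rw [integral_add (hb hm) (hb hn), ← hf x, ← hg x]

lemma hasFourierRep_conv {k : ℕ} (hk : 2 ≤ k) {K ρ : ℝ → ℝ} (hK : Integrable K)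
    (hKc : Continuous K) {B : ℝ} (hB : ∀ x, |K x| ≤ B) (hρ : Integrable ρ) {A : ℝ}
    (hA : ∀ z, ‖fourierR K z * fourierR ρ z‖ ≤ A * (wt k z)⁻¹) :
    ∃ m : ℝ → ℂ, Continuous m ∧ (∀ z, ‖m z‖ ≤ A * (wt k z)⁻¹) ∧ HasFourierRep (conv K ρ) m := by
  have hc : Continuous fun z => fourierR K z * fourierR ρ z :=
    (continuous_fourierR hK).mul (continuous_fourierR hρ)
  refine ⟨fun z => (2 * Real.pi : ℝ)⁻¹ * (fourierR K z * fourierR ρ z), hc.const_mul _,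
    fun z => ?_, conv_eq_integral_fourierR hK hKc hB hρ
      (integrable_of_le_wt hk hc.aestronglyMeasurable hA)⟩
  have hpi : (2 * Real.pi)⁻¹ ≤ 1 := by
    refine inv_le_one_of_one_le₀ ?_
    linarith [Real.pi_gt_three]
  rw [norm_mul, Complex.norm_real, Real.norm_of_nonneg (by positivity)]
  exact (mul_le_of_le_one_left (norm_nonneg _) hpi).trans (hA z)

/-- Low frequencies are controlled by the `L¹`-norms, high frequencies by the derivative of the
kernel. -/
lemma norm_fourierR_mul_fourierR_le {k : ℕ} {K ρ : ℝ → ℝ} (hK : Integrable K)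
    (hKd : Differentiable ℝ K) (hK' : Integrable (deriv K)) {b b₁ d δ R : ℝ} (hR : 1 ≤ R)
    (hb : ∫ x, |K x| ≤ b) (hb₁ : ∫ x, |deriv K x| ≤ b₁) (hd : ∫ x, |ρ x| ≤ d)
    (hδ : ∀ z, ‖fourierR ρ z‖ ≤ δ * (wt k z)⁻¹) (z : ℝ) :
    ‖fourierR K z * fourierR ρ z‖ ≤ (R ^ k * b * d + b₁ / R * δ) * (wt k z)⁻¹ := by
  have hb0 : 0 ≤ b := (integral_nonneg fun _ => abs_nonneg _).trans hb
  have hb10 : 0 ≤ b₁ := (integral_nonneg fun _ => abs_nonneg _).trans hb₁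
  have hd0 : 0 ≤ d := (integral_nonneg fun _ => abs_nonneg _).trans hd
  have hδ0 : 0 ≤ δ := by
    have h1 := (norm_nonneg _).trans (hδ 0)
    exact nonneg_of_mul_nonneg_left h1 (inv_pos.2 (wt_pos k 0))
  have hw := inv_pos.2 (wt_pos k z)
  have hR0 : 0 < R := by linarith
  rw [norm_mul, add_mul]
  rcases le_or_gt |z| R with h | h
  · have h1 : 1 ≤ R ^ k * (wt k z)⁻¹ := by
      rw [← div_eq_mul_inv, one_le_div (wt_pos k z)]
      exact pow_le_pow_left₀ (by positivity) (max_le hR h) k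
    have h2 : ‖fourierR K z‖ * ‖fourierR ρ z‖ ≤ b * d :=
      mul_le_mul ((norm_fourierR_le K z).trans hb) ((norm_fourierR_le ρ z).trans hd)
        (norm_nonneg _) hb0
    have h3 : b * d * 1 ≤ b * d * (R ^ k * (wt k z)⁻¹) := by gcongr
    have h4 : 0 ≤ b₁ / R * δ * (wt k z)⁻¹ := by positivity
    linarith
  · have h1 := fourierR_deriv hK hKd hK' z
    have h2 : |z| * ‖fourierR K z‖ ≤ b₁ := by
      have h3 := (norm_fourierR_le (deriv K) z).trans hb₁
      rwa [h1, norm_mul, norm_neg, norm_mul, Complex.norm_I, one_mul, Complex.norm_real,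
        Real.norm_eq_abs] at h3
    have h3 : ‖fourierR K z‖ ≤ b₁ / R := by
      rw [le_div_iff₀ hR0]
      have := mul_le_mul_of_nonneg_right h.le (norm_nonneg (fourierR K z))
      linarith
    have h4 : ‖fourierR K z‖ * ‖fourierR ρ z‖ ≤ b₁ / R * (δ * (wt k z)⁻¹) :=
      mul_le_mul h3 (hδ z) (norm_nonneg _) (by positivity)
    have h5 : 0 ≤ R ^ k * b * d * (wt k z)⁻¹ := by positivity
    linarith

/-- The normaliser is an average of exp(-f), so it lies in [exp(-S), exp(S)] together with exp(-f
x). The ratio is then between exp(-2S) and exp(2S). -/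
lemma abs_ratio_sub_one_le {ρ f : ℝ → ℝ} (hρ : IsProbDensity ρ) (hfc : Continuous f) {S : ℝ}
    (hS : ∀ x, |f x| ≤ S) (hS1 : 2 * S ≤ 1) (x : ℝ) :
    |(∫ y, ρ y * Real.exp (-f y))⁻¹ * Real.exp (-f x) - 1| ≤ 4 * S := by
  have hS0 : 0 ≤ S := (abs_nonneg _).trans (hS 0)
  have hi : Integrable fun y => ρ y * Real.exp (-f y) := by
    refine hρ.integrable.mul_bdd (c := Real.exp S) (Continuous.aestronglyMeasurable (by fun_prop))
      (ae_of_all _ fun y => ?_)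
    rw [Real.norm_of_nonneg (Real.exp_pos _).le]
    exact Real.exp_le_exp.2 (by linarith [(abs_le.1 (hS y)).1])
  set c := ∫ y, ρ y * Real.exp (-f y) with hc
  have hup : c ≤ Real.exp S := by
    have h := integral_mono hi (hρ.integrable.mul_const (Real.exp S)) fun y =>
      mul_le_mul_of_nonneg_left (Real.exp_le_exp.2 (by linarith [(abs_le.1 (hS y)).1]))
        (hρ.nonneg y)
    rwa [integral_mul_const, hρ.integral_eq_one, one_mul] at h
  have hlo : Real.exp (-S) ≤ c := by
    have h := integral_mono (hρ.integrable.mul_const (Real.exp (-S))) hi fun y =>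
      mul_le_mul_of_nonneg_left (Real.exp_le_exp.2 (by linarith [(abs_le.1 (hS y)).2]))
        (hρ.nonneg y)
    rwa [integral_mul_const, hρ.integral_eq_one, one_mul] at h
  have hc0 : 0 < c := (Real.exp_pos _).trans_le hlo
  have h1 : c⁻¹ * Real.exp (-f x) ≤ Real.exp (2 * S) := by
    have : c⁻¹ ≤ Real.exp S := by
      rw [inv_le_comm₀ hc0 (Real.exp_pos _), ← Real.exp_neg]; exact hlo
    calc c⁻¹ * Real.exp (-f x) ≤ Real.exp S * Real.exp S := by
          gcongr; linarith [(abs_le.1 (hS x)).1]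
      _ = _ := by rw [← Real.exp_add]; ring_nf
  have h2 : Real.exp (-(2 * S)) ≤ c⁻¹ * Real.exp (-f x) := by
    have : Real.exp (-S) ≤ c⁻¹ := by
      rw [Real.exp_neg]; exact inv_anti₀ hc0 hup
    calc Real.exp (-(2 * S)) = Real.exp (-S) * Real.exp (-S) := by
          rw [← Real.exp_add]; ring_nf
      _ ≤ _ := by gcongr; linarith [(abs_le.1 (hS x)).2]
  have h3 := Real.abs_exp_sub_one_le (x := 2 * S) (by rw [abs_of_nonneg (by linarith)]; exact hS1)
  rw [abs_of_nonneg (by linarith : 0 ≤ 2 * S)] at h3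
  have h4 := Real.add_one_le_exp (-(2 * S))
  rw [abs_le]
  constructor
  · linarith
  · linarith [le_abs_self (Real.exp (2 * S) - 1)]

set_option maxHeartbeats 2000000 in
/-- The density of a perturbed interaction potential: it exists, is close to the original density
in the weighted Fourier norm, and the likelihood ratio is uniformly close to one. -/
theorem exists_perturbed_density {J k : ℕ} (hk : 2 ≤ k) {α : ℝ} {Vt W π₀ : ℝ → ℝ}
    (hV : IsNonsmoothConfinement J α Vt) (hW : IsInteraction α Vt W)
    (hπ₀ : IsInvariantDensity (confinement α Vt) W π₀) {κ L M : ℝ} (hκ0 : 0 < κ)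
    (hκ : κ ≤ 2 * constCV α Vt - constCW W) (hL : L ≤ 3 / 4 * √κ) (hM0 : 0 < M)
    (hM : ∀ z, ‖fourierR π₀ z‖ ≤ M * (wt k z)⁻¹) (hmom : Integrable fun y => |y| * |deriv W y|)
    {δ : ℝ} (hδ0 : 0 < δ) (hδ1 : δ ≤ 1) :
    ∃ a₀ > 0, a₀ ≤ 1 ∧ ∃ D > 0, ∀ a T : ℝ, 0 < a → 1 ≤ T → a * T ^ (k + 1) ≤ a₀ →
      ∀ W₁ : ℝ → ℝ, (W₁ = fun x => W x + 1 + gaussCos a T x) → IsInteraction α Vt W₁ →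
      κ ≤ 2 * constCV α Vt - constCW W₁ → (∀ x, |deriv W₁ x| ≤ L) →
      ∃ π₁ q : ℝ → ℝ, IsInvariantDensity (confinement α Vt) W₁ π₁ ∧
        (∀ z, ‖fourierR π₁ z - fourierR π₀ z‖ ≤ δ * (wt k z)⁻¹) ∧
        Continuous q ∧ (∀ x, 0 ≤ q x) ∧ (∀ x, π₁ x = π₀ x * q x) ∧
        ∀ x, |q x - 1| ≤ D * a * (T ^ (k - 1))⁻¹ := by
  have hp₀ := hπ₀.isProbDensity
  have hWd : Differentiable ℝ W := fun x => (hW.hasDerivAt x).differentiableAt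
  -- W need not be integrable, but W - l is, l being its limit at infinity. Only then does the
  -- kernel have a Fourier transform to work with.
  obtain ⟨l, hl⟩ := exists_integrable_sub_const hWd hW.even hW.deriv_integrable hmom
  obtain ⟨B, hB⟩ := hW.bdd
  have hB0 : 0 ≤ B := (abs_nonneg _).trans (hB 0)
  obtain ⟨Cg, hCg0, hCg⟩ := exists_abs_conv_gaussCos_le hk
  have hκs := Real.sqrt_pos.2 hκ0
  set C := convC k with hC
  have hC0 : 0 ≤ C := convC_nonneg k
  set I₂ := ∫ x : ℝ, Real.exp (-x ^ 2 / 2) with hI₂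
  set I₄ := ∫ x : ℝ, Real.exp (-(1 / 4) * x ^ 2) with hI₄
  have hI₂0 : 0 ≤ I₂ := integral_nonneg fun _ => (Real.exp_pos _).le
  have hI₄0 : 0 ≤ I₄ := integral_nonneg fun _ => (Real.exp_pos _).le
  set b := (∫ x, |W x - l|) + I₂ with hb
  have hb0 : 0 ≤ b := add_nonneg (integral_nonneg fun _ => abs_nonneg _) hI₂0
  set b₁ := (∫ x, |deriv W x|) + 4 * I₄ with hb₁
  have hb₁0 : 0 ≤ b₁ := add_nonneg (integral_nonneg fun _ => abs_nonneg _) (by positivity)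
  -- The sum of all factors of A in `norm_fourierR_tilt_sub_le`: Q A ≤ δ ≤ 1 yields both smallness
  -- conditions and the final bound δ at once.
  set Q := 4 * (1 + M) * M * C + C + 4 * C * M + 1 with hQ
  have hQ1 : 1 ≤ Q := by
    have : 0 ≤ 4 * (1 + M) * M * C + C + 4 * C * M := by positivity
    linarith
  have hQ0 : 0 < Q := by linarith
  -- The frequency cut-off. Above R the kernel transform is at most b₁/R, so the high-frequency
  -- share Q (b₁/R) δ uses at most δ/2; the other half pays for the terms proportional to a,
  -- collected in E.
  set R := 2 * Q * b₁ + 1 with hR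
  have hR1 : 1 ≤ R := by
    have : 0 ≤ 2 * Q * b₁ := by positivity
    linarith
  have hR0 : 0 < R := by linarith
  -- The L¹ radius d solves d = Cg a M s/√κ + (3/4) d, which is where the 4 comes from.
  set D₁ := 4 * (Cg * M / √κ) with hD₁
  have hD₁0 : 0 ≤ D₁ := by positivity
  set E := Q * (√(2 * Real.pi) * M + R ^ k * b * D₁) with hE
  have hE0 : 0 ≤ E := by positivity
  set D₂ := Cg * M + (B + |l| + 1) * D₁ with hD₂
  have hD₂0 : 0 ≤ D₂ := by positivity
  -- The second entry makes a E ≤ δ/2; the third makes a D₂ ≤ 1/2, as `abs_ratio_sub_one_le` needs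
  -- for the sup bound D₂ a s of the tilt.
  set a₀ := min 1 (min (δ / (2 * E + 1)) (1 / (2 * D₂ + 1))) with ha₀
  have ha₀0 : 0 < a₀ := by
    refine lt_min one_pos (lt_min ?_ ?_) <;> positivity
  refine ⟨a₀, ha₀0, min_le_left _ _, 4 * D₂ + 1, by positivity, ?_⟩
  intro a T ha hT haT W₁ hW₁ hI₁ hκ₁ hL₁
  have hT0 : 0 ≤ T := by linarith
  have hTk : 1 ≤ T ^ (k + 1) := one_le_pow₀ hT
  have haa : a ≤ a₀ := le_trans (le_mul_of_one_le_right ha.le hTk) haT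
  have ha1 : a ≤ 1 := haa.trans (min_le_left _ _)
  have haE : a * E ≤ δ / 2 := by
    have h1 : a ≤ δ / (2 * E + 1) := haa.trans ((min_le_right _ _).trans (min_le_left _ _))
    rw [le_div_iff₀ (by positivity)] at h1
    linarith
  have haD : a * D₂ ≤ 1 / 2 := by
    have h1 : a ≤ 1 / (2 * D₂ + 1) := haa.trans ((min_le_right _ _).trans (min_le_right _ _))
    rw [le_div_iff₀ (by positivity)] at h1
    linarith
  set w := gaussCos a T with hw
  have hwc : Continuous w := (contDiff_gaussCos a T (n := 0)).continuous
  have hwB : ∀ x, |w x| ≤ 1 := fun x => (abs_gaussCos_le' ha.le T x).trans ha1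
  have hwi : Integrable w := integrable_gaussCos ha.le T
  let K : ℝ → ℝ := fun x => (W x - l) + w x
  have hKc : Continuous K := (hWd.continuous.sub continuous_const).add hwc
  have hKi : Integrable K := hl.add hwi
  have hKB : ∀ x, |K x| ≤ B + |l| + 1 := fun x =>
    (abs_add_le _ _).trans (add_le_add ((abs_sub _ _).trans (by linarith [hB x])) (hwB x))
  have hKb : ∫ x, |K x| ≤ b := by
    have h1 : ∫ x, |K x| ≤ ∫ x, (|W x - l| + Real.exp (-x ^ 2 / 2)) := by
      refine integral_mono hKi.abs (hl.abs.add integrable_exp_neg_sq_half) fun x => ?_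
      refine (abs_add_le _ _).trans (add_le_add le_rfl ((abs_gaussCos_le ha.le T x).trans ?_))
      exact mul_le_of_le_one_left (Real.exp_pos _).le ha1
    rwa [integral_add hl.abs integrable_exp_neg_sq_half] at h1
  have hKd : ∀ x, HasDerivAt K (deriv W x + gaussCos' a T x) x := fun x =>
    ((hW.hasDerivAt x).sub_const l).add (hasDerivAt_gaussCos a T x)
  have hKd' : deriv K = fun x => deriv W x + gaussCos' a T x := funext fun x => (hKd x).deriv
  have hw'i : Integrable (gaussCos' a T) := integrable_gaussCos' ha.le hT0
  have hK'i : Integrable (deriv K) := by rw [hKd']; exact hW.deriv_integrable.add hw'i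
  have hW₁d : deriv W₁ = deriv K := by
    rw [hKd', hW₁]
    exact funext fun x => (((hW.hasDerivAt x).add_const 1).add (hasDerivAt_gaussCos a T x)).deriv
  have haT1 : a * T ≤ 1 := by
    have h1 : T ≤ T ^ (k + 1) := le_self_pow₀ hT (by omega)
    exact (mul_le_mul_of_nonneg_left h1 ha.le).trans (haT.trans (min_le_left _ _))
  have hKb₁ : ∫ x, |deriv K x| ≤ b₁ := by
    have hg4 : Integrable fun x : ℝ => 4 * Real.exp (-(1 / 4) * x ^ 2) :=
      (integrable_exp_neg_mul_sq (by norm_num)).const_mul 4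
    have h1 : ∫ x, |deriv K x| ≤ ∫ x, (|deriv W x| + 4 * Real.exp (-(1 / 4) * x ^ 2)) := by
      refine integral_mono hK'i.abs (hW.deriv_integrable.abs.add hg4) fun x => ?_
      rw [hKd']
      refine (abs_add_le _ _).trans (add_le_add le_rfl ((abs_gaussCos'_le ha.le hT0 x).trans ?_))
      refine mul_le_mul_of_nonneg_right ?_ (Real.exp_pos _).le
      have e : 2 * a * (1 + T) = 2 * a + 2 * (a * T) := by ring
      linarith only [e, haT1, ha1]
    rwa [integral_add hW.deriv_integrable.abs hg4, integral_const_mul] at h1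
  set s := (T ^ (k - 1))⁻¹ with hs
  have hs0 : 0 < s := by positivity
  have hs1 : s ≤ 1 := inv_le_one_of_one_le₀ (one_le_pow₀ hT)
  have hwtT : ∀ j, wt j T = T ^ j := fun j => by
    unfold wt; rw [abs_of_nonneg hT0, max_eq_right hT]
  have hgc := fun x => hCg a T M π₀ ha.le hT0 hp₀.integrable hM x
  set d := D₁ * a * s with hd
  have hd0 : 0 ≤ d := by positivity
  have hdD : d ≤ D₁ * a := mul_le_of_le_one_right (by positivity) hs1
  let f : (ℝ → ℝ) → ℝ → ℝ := fun μ x => conv w π₀ x + conv K (fun y => μ y - π₀ y) x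
  have hpot : ∀ μ, IsProbDensity μ → pot (confinement α Vt) W₁ μ =
      fun x => pot (confinement α Vt) W π₀ x + f μ x + 1 := fun μ hμ => by
    funext x
    have h1 : W₁ = fun y => K y + (l + 1) := by
      rw [hW₁]; ext y; simp only [K]; ring
    have h2 : conv W₁ μ x = conv K μ x + (l + 1) := by
      rw [h1, conv_add_left hKc hKB continuous_const (fun _ => le_rfl) hμ.integrable,
        conv_const_left, hμ.integral_eq_one, mul_one]
    have h3 : conv K π₀ x = (conv W π₀ x - l) + conv w π₀ x := by
      have h4 : conv (fun y => W y + -l) π₀ x = conv W π₀ x - l := by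
        rw [conv_add_left hWd.continuous hB continuous_const (fun _ => le_rfl) hp₀.integrable,
          conv_const_left, hp₀.integral_eq_one]; ring
      rw [← h4]
      exact conv_add_left (hWd.continuous.add continuous_const)
        (fun y => (abs_add_le _ _).trans (add_le_add (hB y) (le_of_eq (abs_neg l)))) hwc hwB
        hp₀.integrable x
    have h5 := conv_sub_right hKc hKB hμ.integrable hp₀.integrable x
    simp only [pot, f]
    rw [h2, h5, h3]; ring
  have hiU : Integrable fun x => Real.exp (-pot (confinement α Vt) W π₀ x) :=
    (strongPot_pot hV hW hp₀ hκ).integrable_exp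
  have hgibbs : ∀ μ, IsProbDensity μ → gibbs (pot (confinement α Vt) W₁ μ) = fun x =>
      (∫ y, π₀ y * Real.exp (-f μ y))⁻¹ * (π₀ x * Real.exp (-f μ x)) := fun μ hμ => by
    rw [hpot μ hμ]
    funext x
    rw [gibbs_add_const hiU, ← hπ₀.eq_gibbs]
  have hfc : ∀ μ, IsProbDensity μ → Continuous (f μ) := fun μ hμ =>
    (continuous_conv hwc hwB hp₀.integrable).add
      (continuous_conv hKc hKB (hμ.integrable.sub hp₀.integrable))
  have hfS : ∀ μ, IsProbDensity μ → (∫ x, |μ x - π₀ x|) ≤ d → ∀ x, |f μ x| ≤ D₂ * a * s := by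
    intro μ hμ hμd x
    have h1 := abs_conv_le hKB (hμ.integrable.sub hp₀.integrable) x
    simp only [Pi.sub_apply] at h1
    have h2 := (hgc x).1
    have h3 : (wt k T)⁻¹ ≤ s := by
      rw [hwtT, hs]
      exact inv_anti₀ (by positivity) (pow_le_pow_right₀ hT (by omega))
    calc |f μ x| ≤ Cg * a * M * s + (B + |l| + 1) * d := by
          refine (abs_add_le _ _).trans (add_le_add (h2.trans ?_) (h1.trans ?_))
          · gcongr
          · gcongr
      _ = _ := by rw [hd, hD₂]; ring
  have hds : D₂ * a * s ≤ 1 / 2 := by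
    have : D₂ * a * s ≤ D₂ * a := mul_le_of_le_one_right (by positivity) hs1
    linarith
  -- the invariant set of the iteration
  let P : (ℝ → ℝ) → Prop := fun μ =>
    (∀ z, ‖fourierR μ z - fourierR π₀ z‖ ≤ δ * (wt k z)⁻¹) ∧ (∫ x, |μ x - π₀ x|) ≤ d
  have hP₀ : P π₀ := by
    refine ⟨fun z => ?_, by simpa using hd0⟩
    rw [sub_self, norm_zero]
    have := wt_pos k z
    positivity
  have hPs : ∀ μ, IsProbDensity μ → P μ → P (gibbs (pot (confinement α Vt) W₁ μ)) := by
    intro μ hμ hPμ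
    have hρi : Integrable fun y => μ y - π₀ y := hμ.integrable.sub hp₀.integrable
    constructor
    · have hF : ∀ z, ‖fourierR (fun y => μ y - π₀ y) z‖ ≤ δ * (wt k z)⁻¹ := fun z => by
        rw [fourierR_sub hμ.integrable hp₀.integrable]; exact hPμ.1 z
      obtain ⟨m₁, hm₁c, hm₁, hm₁r⟩ := hasFourierRep_conv hk hwi hwc hwB hp₀.integrable
        (A := a * √(2 * Real.pi) * M) fun z => by
          rw [norm_mul, mul_assoc _ M]
          exact mul_le_mul (norm_fourierR_gaussCos_le ha.le T z) (hM z) (norm_nonneg _)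
            (by positivity)
      obtain ⟨m₂, hm₂c, hm₂, hm₂r⟩ := hasFourierRep_conv hk hKi hKc hKB hρi
        (norm_fourierR_mul_fourierR_le hKi (fun x => (hKd x).differentiableAt) hK'i hR1 hKb hKb₁
          hPμ.2 hF)
      set A := a * √(2 * Real.pi) * M + (R ^ k * b * d + b₁ / R * δ) with hA
      have hA0 : 0 ≤ A := by positivity
      have hQA : Q * A ≤ δ := by
        have h1 : Q * (b₁ / R) ≤ 1 / 2 := by
          rw [mul_div_assoc', div_le_iff₀ hR0, hR]; linarith
        have h2 : Q * (b₁ / R) * δ ≤ 1 / 2 * δ := by gcongr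
        have h3 : Q * (R ^ k * b * d) ≤ Q * (R ^ k * b * (D₁ * a)) := by gcongr
        have h4 : Q * A = Q * (a * √(2 * Real.pi) * M) + Q * (R ^ k * b * d) +
          Q * (b₁ / R) * δ := by rw [hA]; ring
        have h5 : a * E = Q * (a * √(2 * Real.pi) * M) + Q * (R ^ k * b * (D₁ * a)) := by
          rw [hE]; ring
        linarith
      have hQA' : 4 * (1 + M) * M * C * A + C * A + 4 * (C * A) * M + A ≤ δ := by
        have : Q * A = 4 * (1 + M) * M * C * A + C * A + 4 * (C * A) * M + A := by
          rw [hQ]; ring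
        linarith
      have t1 : 0 ≤ 4 * (1 + M) * M * C * A := by positivity
      have t2 : 0 ≤ C * A := by positivity
      have t3 : 0 ≤ 4 * (C * A) * M := by positivity
      have hrep : HasFourierRep (f μ) fun z => m₁ z + m₂ z :=
        hm₁r.add hm₂r (integrable_of_le_wt hk hm₁c.aestronglyMeasurable hm₁)
          (integrable_of_le_wt hk hm₂c.aestronglyMeasurable hm₂)
      intro z
      rw [hgibbs μ hμ]
      refine (norm_fourierR_tilt_sub_le hk hp₀ (hm₁c.add hm₂c).aestronglyMeasurable hA0
        (fun y => ?_) hrep (hfc μ hμ) (hfS μ hμ hPμ.2) hM (by linarith) (by linarith) z).trans ?_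
      · refine (norm_add_le _ _).trans ((add_le_add (hm₁ y) (hm₂ y)).trans (le_of_eq ?_))
        rw [hA]; ring
      · have := inv_pos.2 (wt_pos k z)
        gcongr
        linarith
    · have h := integral_abs_gibbs_pot_sub_le hV hI₁ hW hμ hp₀ hκ0 hκ₁ hκ hL₁
        (η := Cg * a * M * s) fun x => by
          have e : (fun y => deriv W₁ y - deriv W y) = gaussCos' a T := by
            rw [hW₁d, hKd']; ext y; ring
          rw [e]
          have := (hgc x).2
          rwa [hwtT, ← hs] at this
      rw [← hπ₀.eq_gibbs] at h
      refine h.trans ?_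
      rw [div_le_iff₀ hκs]
      have hL0 : 0 ≤ L := (abs_nonneg _).trans (hL₁ 0)
      -- The feedback uses three quarters of the radius d and the direct effect, h3, the remaining
      -- quarter.
      have h2 : L * (∫ x, |μ x - π₀ x|) ≤ 3 / 4 * √κ * d :=
        mul_le_mul hL hPμ.2 (integral_nonneg fun _ => abs_nonneg _) (by positivity)
      have h3 : d / 4 * √κ = Cg * a * M * s := by
        rw [hd, hD₁]; field_simp
      linarith
  have hPc : ∀ (u : ℕ → ℝ → ℝ) (μ g : ℝ → ℝ), Integrable g → (∀ n, IsProbDensity (u n)) →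
      (∀ n, P (u n)) → (∀ n x, |u n x| ≤ g x) →
      (∀ x, Tendsto (fun n => u n x) atTop (nhds (μ x))) → P μ := by
    intro u μ g hg hu hPu hug hlim
    constructor
    · intro z
      have h : Tendsto (fun n => fourierR (u n) z) atTop (nhds (fourierR μ z)) := by
        refine tendsto_integral_of_dominated_convergence g
          (fun n => (integrable_kernel (hu n).integrable z).aestronglyMeasurable) hg
          (fun n => ae_of_all _ fun x => ?_) (ae_of_all _ fun x => ?_)
        · rw [norm_mul, norm_cexp_I_mul, one_mul, Complex.norm_real]; exact hug n x
        · exact ((Complex.continuous_ofReal.tendsto _).comp (hlim x)).const_mul _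
      exact le_of_tendsto ((h.sub_const _).norm) (Eventually.of_forall fun n => (hPu n).1 z)
    · have h : Tendsto (fun n => ∫ x, |u n x - π₀ x|) atTop (nhds (∫ x, |μ x - π₀ x|)) := by
        refine tendsto_integral_of_dominated_convergence (fun x => g x + |π₀ x|)
          (fun n => ((hu n).integrable.sub hp₀.integrable).abs.aestronglyMeasurable)
          (hg.add hp₀.integrable.abs)
          (fun n => ae_of_all _ fun x => ?_) (ae_of_all _ fun x => ((hlim x).sub_const _).abs)
        rw [Real.norm_eq_abs, abs_abs]
        exact (abs_sub _ _).trans (by gcongr; exact hug n x)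
      exact le_of_tendsto h (Eventually.of_forall fun n => (hPu n).2)
  have hlt : L < √(2 * constCV α Vt - constCW W₁) :=
    (by linarith : L < √κ).trans_le (Real.sqrt_le_sqrt hκ₁)
  obtain ⟨π₁, hπ₁, hPπ₁⟩ := exists_invariantDensity hV hI₁ hL₁ hlt P hp₀ hP₀ hPs hPc
  have hp₁ := hπ₁.isProbDensity
  refine ⟨π₁, fun x => (∫ y, π₀ y * Real.exp (-f π₁ y))⁻¹ * Real.exp (-f π₁ x), hπ₁, hPπ₁.1,
    ?_, fun x => ?_, fun x => ?_, fun x => ?_⟩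
  · have := hfc π₁ hp₁
    fun_prop
  · exact mul_nonneg (inv_nonneg.2 (integral_nonneg fun y =>
      mul_nonneg (hp₀.nonneg y) (Real.exp_pos _).le)) (Real.exp_pos _).le
  · have h := hπ₁.eq_gibbs
    rw [hgibbs π₁ hp₁] at h
    rw [congrFun h x]
    ring
  · refine (abs_ratio_sub_one_le hp₀ (hfc π₁ hp₁) (hfS π₁ hp₁ hPπ₁.2) (by linarith) x).trans ?_
    have h1 : 0 ≤ a * s := mul_nonneg ha.le hs0.le
    have h2 : (4 * D₂ + 1) * a * s = 4 * (D₂ * a * s) + a * s := by ring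
    linarith only [h1, h2]

/-! ### The minimax lower bound -/

lemma iInf_le_iInf_add {f g : ℝ → ℝ} {C e : ℝ} (hf : ∀ x, |f x| ≤ C)
    (h : ∀ x, |f x - g x| ≤ e) : (⨅ x, f x) ≤ (⨅ x, g x) + e := by
  have hb : BddBelow (Set.range f) := ⟨-C, by rintro _ ⟨x, rfl⟩; exact (abs_le.1 (hf x)).1⟩
  rw [← sub_le_iff_le_add]
  refine le_ciInf fun x => ?_
  have h1 := ciInf_le hb x
  have h2 := (abs_le.1 (h x)).2
  linarith

lemma abs_constCW_sub_le {W G : ℝ → ℝ} {C D e : ℝ} (hW : ∀ x, |iteratedDeriv 2 W x| ≤ C)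
    (hG : ∀ x, |iteratedDeriv 2 G x| ≤ D)
    (h : ∀ x, |iteratedDeriv 2 W x - iteratedDeriv 2 G x| ≤ e) :
    |constCW W - constCW G| ≤ e := by
  have h1 := iInf_le_iInf_add hW h
  have h2 := iInf_le_iInf_add hG fun x => by rw [abs_sub_comm]; exact h x
  unfold constCW
  rw [abs_le]; constructor <;> linarith

/-! ### The perturbed interaction satisfies the standing hypotheses. -/

section Perturbation

variable {α : ℝ} {Vt W : ℝ → ℝ} {a T : ℝ}

lemma hasDerivAt_perturb (hW : IsInteraction α Vt W) (a T x : ℝ) :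
    HasDerivAt (fun x => W x + 1 + gaussCos a T x) (deriv W x + gaussCos' a T x) x :=
  ((hW.hasDerivAt x).add_const 1).add (hasDerivAt_gaussCos a T x)

lemma deriv_perturb (hW : IsInteraction α Vt W) (a T : ℝ) :
    deriv (fun x => W x + 1 + gaussCos a T x) = fun x => deriv W x + gaussCos' a T x :=
  funext fun x => (hasDerivAt_perturb hW a T x).deriv

lemma iteratedDeriv_two_perturb (hW : IsInteraction α Vt W) (a T : ℝ) :
    iteratedDeriv 2 (fun x => W x + 1 + gaussCos a T x) =
      fun x => iteratedDeriv 2 W x + gaussCos'' a T x := by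
  rw [iteratedDeriv_two, deriv_perturb hW, iteratedDeriv_two]
  exact funext fun x => (((hW.contDiff.deriv_two.2.1 x).hasDerivAt).add
    (hasDerivAt_gaussCos' a T x)).deriv

lemma abs_constCW_perturb_sub_le (hW : IsInteraction α Vt W) (ha : 0 ≤ a) (hT : 0 ≤ T) :
    |constCW (fun x => W x + 1 + gaussCos a T x) - constCW W| ≤ 4 * a * (1 + T) ^ 2 := by
  obtain ⟨C, hC⟩ := hW.deriv2_bdd
  refine abs_constCW_sub_le (C := C + 4 * a * (1 + T) ^ 2) (D := C) (fun x => ?_) hC fun x => ?_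
  · rw [iteratedDeriv_two_perturb hW]
    exact (abs_add_le _ _).trans (add_le_add (hC x) (abs_gaussCos''_le ha hT x))
  · rw [iteratedDeriv_two_perturb hW, add_sub_cancel_left]
    exact abs_gaussCos''_le ha hT x

lemma isInteraction_perturb (hW : IsInteraction α Vt W) (ha : 0 ≤ a) (hT : 0 ≤ T) (ha1 : a ≤ 1)
    (h1 : 4 * a * (1 + T) ^ 2 < constCW W)
    (h2 : 4 * a * (1 + T) ^ 2 < constCV α Vt - constCW W) :
    IsInteraction α Vt fun x => W x + 1 + gaussCos a T x where
  nonneg x := by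
    have := (abs_le.1 (abs_gaussCos_le' ha T x)).1
    linarith [hW.nonneg x]
  even x := by rw [hW.even, gaussCos_neg]
  contDiff := (hW.contDiff.add contDiff_const).add (contDiff_gaussCos a T)
  deriv_bdd := by
    obtain ⟨C, hC⟩ := hW.deriv_bdd
    refine ⟨C + 2 * a * (1 + T), fun x => ?_⟩
    rw [deriv_perturb hW]
    exact (abs_add_le _ _).trans (add_le_add (hC x) (abs_gaussCos'_le' ha hT x))
  deriv_integrable := by
    rw [deriv_perturb hW]
    exact hW.deriv_integrable.add (integrable_gaussCos' ha hT)
  deriv2_bdd := by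
    obtain ⟨C, hC⟩ := hW.deriv2_bdd
    refine ⟨C + 4 * a * (1 + T) ^ 2, fun x => ?_⟩
    rw [iteratedDeriv_two_perturb hW]
    exact (abs_add_le _ _).trans (add_le_add (hC x) (abs_gaussCos''_le ha hT x))
  constCW_pos := by
    have := (abs_le.1 (abs_constCW_perturb_sub_le hW ha hT)).1
    linarith
  constCW_lt := by
    have := (abs_le.1 (abs_constCW_perturb_sub_le hW ha hT)).2
    linarith

end Perturbation

/-- The class condition on ‖W'‖_∞ is strict, hence open. The slack e is the budget for the
perturbation of both W' and W''. -/
lemma exists_slack {c d L : ℝ} (hc : 0 < c) (hd : 0 < d) (hL : L < √d) :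
    ∃ e > 0, e ≤ c / 2 ∧ e ≤ d / 2 ∧ L + e < √(d - e) := by
  have h1 : ∀ᶠ e in nhds (0 : ℝ), L + e < √(d - e) := by
    refine ContinuousAt.eventually_lt (f := fun e => L + e) (g := fun e => √(d - e))
      (by fun_prop) (by fun_prop) ?_
    simpa using hL
  have h2 : ∀ᶠ e in nhds (0 : ℝ), e < min (c / 2) (d / 2) :=
    eventually_lt_nhds (by positivity)
  obtain ⟨e, ⟨he1, he2⟩, he3⟩ := (((h1.and h2).filter_mono nhdsWithin_le_nhds).and
    (self_mem_nhdsWithin (s := Set.Ioi (0 : ℝ)))).exists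
  exact ⟨e, he3, (he2.trans_le (min_le_left _ _)).le, (he2.trans_le (min_le_right _ _)).le, he1⟩

/-- The two-sided bounds make d₀ and d₁ comparable to the weight: the old numerator changes
denominator at the cost 2M/m, and the new part h pays the full weight. -/
lemma lintegral_ratio_le {k : ℕ} {g₀ g₁ h d₀ d₁ : ℝ → ℂ} {m M : ℝ} (hm : 0 < m) (hM : 0 ≤ M)
    (hg : ∀ z, g₁ z = g₀ z + h z) (hd₀' : ∀ z, m * (wt k z)⁻¹ ≤ ‖d₀ z‖)
    (hd₀ : ∀ z, ‖d₀ z‖ ≤ M * (wt k z)⁻¹) (hd₁ : ∀ z, m / 2 * (wt k z)⁻¹ ≤ ‖d₁ z‖)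
    (hh : Continuous h) {r s : ℝ} (hr0 : 0 ≤ r)
    (hr : ∫⁻ z, ‖g₀ z / d₀ z‖ₑ ^ 2 ≤ ENNReal.ofReal r)
    (hs : ∫⁻ z, ENNReal.ofReal ((wt k z * ‖h z‖) ^ 2) ≤ ENNReal.ofReal s) (hs0 : 0 ≤ s) :
    ∫⁻ z, ‖g₁ z / d₁ z‖ₑ ^ 2 ≤
      ENNReal.ofReal (2 * (2 * M / m) ^ 2 * r + 2 * (2 / m) ^ 2 * s) := by
  have hpt : ∀ z, ‖g₁ z / d₁ z‖ₑ ^ 2 ≤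
      ENNReal.ofReal (2 * (2 * M / m) ^ 2) * ‖g₀ z / d₀ z‖ₑ ^ 2 +
      ENNReal.ofReal (2 * (2 / m) ^ 2) * ENNReal.ofReal ((wt k z * ‖h z‖) ^ 2) := fun z => by
    have hw := wt_pos k z
    have e0 : ∀ q : ℂ, ‖q‖ₑ ^ 2 = ENNReal.ofReal (‖q‖ ^ 2) := fun q => by
      rw [← ofReal_norm, ENNReal.ofReal_pow (norm_nonneg _)]
    rw [e0, e0, ← ENNReal.ofReal_mul (by positivity), ← ENNReal.ofReal_mul (by positivity),
      ← ENNReal.ofReal_add (by positivity) (by positivity)]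
    refine ENNReal.ofReal_le_ofReal ?_
    have hd1p : 0 < ‖d₁ z‖ := lt_of_lt_of_le (by positivity) (hd₁ z)
    have hd0p : 0 < ‖d₀ z‖ := lt_of_lt_of_le (by positivity) (hd₀' z)
    have hinv : ‖d₁ z‖⁻¹ ≤ 2 / m * wt k z := by
      rw [inv_le_comm₀ hd1p (by positivity)]
      refine le_trans (le_of_eq ?_) (hd₁ z)
      field_simp
    have h1 : ‖g₁ z / d₁ z‖ ≤ 2 * M / m * ‖g₀ z / d₀ z‖ + 2 / m * (wt k z * ‖h z‖) := by
      rw [norm_div, div_eq_mul_inv, hg z]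
      have h3 : ‖g₀ z‖ ≤ ‖g₀ z / d₀ z‖ * (M * (wt k z)⁻¹) := by
        calc ‖g₀ z‖ = ‖g₀ z / d₀ z‖ * ‖d₀ z‖ := by rw [norm_div, div_mul_cancel₀ _ hd0p.ne']
          _ ≤ _ := by gcongr; exact hd₀ z
      calc ‖g₀ z + h z‖ * ‖d₁ z‖⁻¹
          ≤ (‖g₀ z / d₀ z‖ * (M * (wt k z)⁻¹) + ‖h z‖) * (2 / m * wt k z) := by
            refine mul_le_mul ((norm_add_le _ _).trans ?_) hinv (by positivity) (by positivity)
            gcongr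
        _ = _ := by field_simp
    refine (pow_le_pow_left₀ (norm_nonneg _) h1 2).trans ?_
    nlinarith [sq_nonneg (2 * M / m * ‖g₀ z / d₀ z‖ - 2 / m * (wt k z * ‖h z‖))]
  refine (lintegral_mono hpt).trans ?_
  have hmeas : Measurable fun z => ENNReal.ofReal (2 * (2 / m) ^ 2) *
      ENNReal.ofReal ((wt k z * ‖h z‖) ^ 2) := by
    have : Continuous fun z => (wt k z * ‖h z‖) ^ 2 := ((continuous_wt k).mul hh.norm).pow 2
    exact this.measurable.ennreal_ofReal.const_mul _
  rw [lintegral_add_right _ hmeas, lintegral_const_mul' _ _ ENNReal.ofReal_ne_top,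
    lintegral_const_mul' _ _ ENNReal.ofReal_ne_top, ENNReal.ofReal_add (by positivity)
    (by positivity), ENNReal.ofReal_mul (p := 2 * (2 * M / m) ^ 2) (by positivity),
    ENNReal.ofReal_mul (p := 2 * (2 / m) ^ 2) (by positivity)]
  gcongr

/-- Two-point lower bound for the minimax probability. -/
theorem le_minimaxProb_of_two_points {J N : ℕ} {α p : ℝ} {Vt : ℝ → ℝ} {r : Fin 6 → ℝ}
    {W₀ W₁ π₀ π₁ q : ℝ → ℝ} (h₀ : W₀ ∈ interactionClass α Vt r p J)
    (h₁ : W₁ ∈ interactionClass α Vt r p J) (hV : IsNonsmoothConfinement J α Vt)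
    (hπ₀ : IsInvariantDensity (confinement α Vt) W₀ π₀)
    (hπ₁ : IsInvariantDensity (confinement α Vt) W₁ π₁) (hqc : Continuous q)
    (hq0 : ∀ x, 0 ≤ q x) (hπq : ∀ x, π₁ x = π₀ x * q x) {ε : ℝ} (hq1 : ∀ x, |q x - 1| ≤ ε)
    (hN : N * ε ^ 2 ≤ 1) {s : ℝ}
    (hs : ENNReal.ofReal s + ENNReal.ofReal s < eLpNorm (deriv W₁ - deriv W₀) 2 volume) :
    (14 : ℝ≥0∞)⁻¹ ≤ minimaxProb α Vt r p J N s := by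
  have hI₀ : IsInteraction α Vt W₀ := InClass.interaction h₀
  have hI₁ : IsInteraction α Vt W₁ := InClass.interaction h₁
  have hcont : Continuous π₀ := by
    rw [hπ₀.eq_gibbs]
    have := (strongPot_pot hV hI₀ hπ₀.isProbDensity le_rfl).continuous
    unfold gibbs
    fun_prop
  refine le_iInf₂ fun est hest => ?_
  obtain ⟨E, hE⟩ : ∃ E : (ℝ → ℝ) → Set (Fin N → ℝ), E = fun W =>
      {x | ENNReal.ofReal s < eLpNorm (fun t => est x t - deriv W t) 2 volume} := ⟨_, rfl⟩
  -- An estimate within s of both derivatives would contradict their separation, by the triangle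
  -- inequality.
  have hcover : E W₀ ∪ E W₁ = Set.univ := by
    rw [Set.eq_univ_iff_forall]
    intro x
    by_contra hx
    simp only [hE, Set.mem_union, Set.mem_ofPred_eq, not_or, not_lt] at hx
    have hex : AEStronglyMeasurable (est x) volume :=
      (hest.comp measurable_prodMk_left).aestronglyMeasurable
    have h1 := eLpNorm_sub_le (μ := volume) (p := 2)
      (hex.sub hI₀.continuous_deriv.aestronglyMeasurable)
      (hex.sub hI₁.continuous_deriv.aestronglyMeasurable) (by norm_num)
    have h2 : (est x - deriv W₀) - (est x - deriv W₁) = deriv W₁ - deriv W₀ := by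
      rw [sub_sub_sub_cancel_left]
    rw [h2] at h1
    exact absurd hs (not_lt.2 (h1.trans (add_le_add hx.1 hx.2)))
  have hmax : ∀ b : ℝ≥0∞, iidLaw N π₀ (E W₀) ≤ b → iidLaw N π₁ (E W₁) ≤ b →
      (14 : ℝ≥0∞)⁻¹ ≤ b := fun b =>
    two_point_bound hπ₀.isProbDensity hcont.measurable hπ₁.isProbDensity hqc.measurable hq0 hπq
      hq1 hN hcover
  have hle : ∀ W ∈ interactionClass α Vt r p J, ∀ dens,
      IsInvariantDensity (confinement α Vt) W dens → iidLaw N dens (E W) ≤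
      ⨆ (W : ℝ → ℝ) (_ : W ∈ interactionClass α Vt r p J)
        (dens : ℝ → ℝ) (_ : IsInvariantDensity (confinement α Vt) W dens),
        iidLaw N dens (E W) := fun W hW dens hd =>
    (le_iSup₂ (f := fun (dens : ℝ → ℝ) (_ : IsInvariantDensity (confinement α Vt) W dens) =>
      iidLaw N dens (E W)) dens hd).trans
      (le_iSup₂ (f := fun (W : ℝ → ℝ) (_ : W ∈ interactionClass α Vt r p J) =>
        ⨆ (dens : ℝ → ℝ) (_ : IsInvariantDensity (confinement α Vt) W dens),
          iidLaw N dens (E W)) W hW)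
  have hfin := hmax _ (hle W₀ h₀ π₀ hπ₀) (hle W₁ h₁ π₁ hπ₁)
  rw [hE] at hfin
  exact hfin

set_option maxHeartbeats 400000 in
/-- The lower bound at the rate `N^{-1/4}`. -/
theorem exists_le_minimaxProb {J : ℕ} {α : ℝ} {Vt : ℝ → ℝ} (hV : IsNonsmoothConfinement J α Vt)
    (hne : ∃ (p : ℝ) (r : Fin 6 → ℝ), 0 < p ∧ (∀ i, 0 < r i) ∧
      (interactionClass α Vt r p J).Nonempty) :
    ∃ (p : ℝ) (r : Fin 6 → ℝ), 0 < p ∧ (∀ i, 0 < r i) ∧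
      ∃ c₀ : ℝ, 0 < c₀ ∧ ∃ κ : ℝ≥0∞, 0 < κ ∧ ∀ N : ℕ, 1 ≤ N →
        κ ≤ minimaxProb α Vt r p J N (c₀ * (N : ℝ) ^ (-(1 / 4 : ℝ))) := by
  obtain ⟨p₀, r₀, hp₀, hr₀, W, hWc⟩ := hne
  have hWc' : InClass α Vt r₀ p₀ J W := hWc
  have hW := hWc'.interaction
  obtain ⟨π₀, hπ₀, hr3, hFπ⟩ := hWc'.fourier
  have htail : limsup (tailFun p₀ (deriv W)) atTop ≤ ENNReal.ofReal (r₀ 2) := hWc'.tail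
  set k := J + 2 with hk
  have hk2 : 2 ≤ k := by omega
  set c := constCW W with hc
  have hc0 : 0 < c := hW.constCW_pos
  set L₀ := ⨆ x, |deriv W x| with hL₀
  have hLb : ∀ x, |deriv W x| ≤ L₀ := by
    obtain ⟨C, hC⟩ := hW.deriv_bdd
    exact fun x => le_ciSup (f := fun x => |deriv W x|)
      ⟨C, by rintro _ ⟨x, rfl⟩; exact hC x⟩ x
  obtain ⟨e, he0, hec, hed, heL⟩ := exists_slack hc0 hW.constCW_lt hWc'.sup_deriv_lt
  set CV := constCV α Vt with hCV
  have hCVc : 0 < CV - c := hW.constCW_lt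
  set κ := 2 * CV - c - e with hκ
  have hκ0 : 0 < κ := by linarith
  set L := L₀ + e with hL
  -- C_V - C_W - e is less than half of κ = 2 C_V - C_W - e, so L/√κ < 1/√2 < 3/4. The contraction
  -- factor stays uniformly below 1.
  have hL34 : L ≤ 3 / 4 * √κ := by
    refine heL.le.trans (Real.sqrt_le_iff.2 ⟨by positivity, ?_⟩)
    rw [mul_pow, Real.sq_sqrt hκ0.le]
    linarith
  set m := r₀ 4 with hm
  have hm0 : 0 < m := hr₀ 4
  set M := r₀ 5 with hM
  have hM0 : 0 < M := hr₀ 5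
  have hFlow : ∀ z, m * (wt k z)⁻¹ ≤ ‖fourierR π₀ z‖ := fun z => (hFπ z).1
  have hFup : ∀ z, ‖fourierR π₀ z‖ ≤ M * (wt k z)⁻¹ := fun z => (hFπ z).2
  have hmom := integrable_abs_mul_of_tail hW.continuous_deriv hLb hW.deriv_integrable hp₀ htail
  -- A change of F(π₀) by δ times the weight leaves the lower constant at least m/2 and the upper
  -- one at most M + 1.
  set δ := min (m / 2) 1 with hδ
  have hδ0 : 0 < δ := lt_min (by positivity) one_pos
  obtain ⟨a₀, ha₀, ha₀1, D, hD, hmain⟩ := exists_perturbed_density hk2 hV hW hπ₀ hκ0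
    (by linarith : κ ≤ 2 * constCV α Vt - constCW W) hL34 hM0 hFup hmom hδ0 (min_le_right _ _)
  obtain ⟨CL, hCL0, hCL⟩ := exists_lintegral_wt_fourierR_gaussCos'_le k
  -- a₀ is for the existence of π₁, e/32 keeps the changes of W' and W'' within e, and 1/D makes N
  -- ε² ≤ 1 for the likelihood ratio.
  set A := min a₀ (min (e / 32) (1 / D)) with hA
  have hA0 : 0 < A := lt_min ha₀ (lt_min (by positivity) (by positivity))
  have hAe : A ≤ e / 32 := (min_le_right _ _).trans (min_le_left _ _)
  have hAD : D * A ≤ 1 := by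
    have : A ≤ 1 / D := (min_le_right _ _).trans (min_le_right _ _)
    rw [le_div_iff₀ hD] at this
    linarith
  have hA1 : A ≤ 1 := (min_le_left _ _).trans ha₀1
  -- Strictly below p₀, so that the tail of W' tends to 0, and below 1/8, so that the tail of the
  -- Gaussian perturbation does.
  set p := min (p₀ / 2) (1 / 16) with hp
  have hp0 : 0 < p := lt_min (by positivity) (by norm_num)
  have hpp₀ : p < p₀ := (min_le_left _ _).trans_lt (by linarith)
  have hp8 : p < 1 / 8 := (min_le_right _ _).trans_lt (by norm_num)
  have hr3p : 0 < r₀ 3 := hr₀ 3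
  set r₃ := 2 * (2 * M / m) ^ 2 * r₀ 3 + 2 * (2 / m) ^ 2 * CL + r₀ 3 with hr₃
  -- Parameters wide enough for both hypotheses and independent of N: C_W moves by at most e ≤ c/2,
  -- the tail limits are 0 so any positive bound will do, and the last three entries come from
  -- `lintegral_ratio_le` and the choice of δ.
  let r : Fin 6 → ℝ := ![2 * c, c / 2, 1, r₃, m / 2, M + 1]
  have hrpos : ∀ i, 0 < r i := by
    intro i
    fin_cases i
    · exact (by positivity : (0 : ℝ) < 2 * c)
    · exact (by positivity : (0 : ℝ) < c / 2)
    · exact one_pos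
    · exact (by positivity : (0 : ℝ) < r₃)
    · exact (by positivity : (0 : ℝ) < m / 2)
    · exact (by positivity : (0 : ℝ) < M + 1)
  have htail0 : Tendsto (tailFun p (deriv W)) atTop (nhds 0) :=
    tendsto_tailFun_of_limsup_le hpp₀ htail
  have hW0mem : W ∈ interactionClass α Vt r p J := by
    refine ⟨hW, hWc'.sup_deriv_lt, ?_, ?_, π₀, hπ₀, ?_, fun z => ⟨?_, ?_⟩⟩
    · have : (⨅ x, iteratedDeriv 2 W x) = -c := by rw [hc, constCW, neg_neg]
      rw [this]
      exact ⟨(by linarith : -(2 * c) ≤ -c), (by linarith : -c ≤ -(c / 2))⟩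
    · change limsup (tailFun p (deriv W)) atTop ≤ _
      rw [htail0.limsup_eq]; exact zero_le
    · refine hr3.trans (ENNReal.ofReal_le_ofReal ?_)
      change r₀ 3 ≤ r₃
      have : 0 ≤ 2 * (2 * M / m) ^ 2 * r₀ 3 + 2 * (2 / m) ^ 2 * CL := by positivity
      linarith
    · refine le_trans ?_ (hFlow z)
      change m / 2 * (wt k z)⁻¹ ≤ _
      have := inv_pos.2 (wt_pos k z)
      gcongr
      linarith
    · refine (hFup z).trans ?_
      change _ ≤ (M + 1) * (wt k z)⁻¹
      have := inv_pos.2 (wt_pos k z)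
      gcongr
      linarith
  -- Twice (A/8) T^{-k} is strictly below (A/2) T^{-k} = aT/2, the lower bound for ‖W₁' - W'‖. The
  -- value 1/14 is that of `two_point_bound`.
  refine ⟨p, r, hp0, hrpos, A / 8, by positivity, 14⁻¹, by simp, fun N hN => ?_⟩
  -- the frequency and the amplitude of the perturbation
  set T : ℝ := (N : ℝ) ^ (1 / (4 * k : ℝ)) with hT
  have hN1 : (1 : ℝ) ≤ N := by exact_mod_cast hN
  have hk0 : (0 : ℝ) < k := by exact_mod_cast (by omega : 0 < k)
  have hT1 : 1 ≤ T := Real.one_le_rpow hN1 (by positivity)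
  have hT0 : 0 < T := by linarith
  have hTk : T ^ k = (N : ℝ) ^ (1 / 4 : ℝ) := by
    rw [hT, ← Real.rpow_natCast, ← Real.rpow_mul (by positivity)]
    congr 1; field_simp
  have hNk : (N : ℝ) ^ (-(1 / 4 : ℝ)) = (T ^ k)⁻¹ := by
    rw [hTk, Real.rpow_neg (by positivity)]
  have hT4 : (T ^ k) ^ 4 = N := by
    rw [hTk, ← Real.rpow_natCast, ← Real.rpow_mul (by positivity)]; norm_num
  -- This order of amplitude keeps the weighted L² norm of F(w'), which is at most of order a
  -- T^{k+1}, bounded uniformly in N.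
  set a := A * (T ^ (k + 1))⁻¹ with ha
  have ha0 : 0 < a := by positivity
  have haT : a * T ^ (k + 1) = A := by rw [ha]; field_simp
  have haA : ∀ j ≤ k + 1, a * T ^ j ≤ A := fun j hj => by
    rw [← haT]
    exact mul_le_mul_of_nonneg_left (pow_le_pow_right₀ hT1 hj) ha0.le
  have ha1 : a ≤ 1 := by simpa using (haA 0 (by omega)).trans hA1
  have hw1 : 2 * a * (1 + T) ≤ e := by
    have h1 := haA 1 (by omega)
    have h0 := haA 0 (by omega)
    rw [pow_one] at h1
    rw [pow_zero, mul_one] at h0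
    have : 2 * a * (1 + T) = 2 * a + 2 * (a * T) := by ring
    linarith
  have hw2 : 4 * a * (1 + T) ^ 2 < e := by
    have h2 := haA 2 (by omega)
    have h1 := haA 1 (by omega)
    have h0 := haA 0 (by omega)
    rw [pow_one] at h1
    rw [pow_zero, mul_one] at h0
    have : 4 * a * (1 + T) ^ 2 = 4 * a + 8 * (a * T) + 4 * (a * T ^ 2) := by ring
    linarith
  have hI₁ : IsInteraction α Vt fun x => W x + 1 + gaussCos a T x :=
    isInteraction_perturb hW ha0.le hT0.le ha1 (by linarith) (by linarith)
  set W₁ : ℝ → ℝ := fun x => W x + 1 + gaussCos a T x with hW₁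
  have hcW₁ : |constCW W₁ - c| ≤ e :=
    (abs_constCW_perturb_sub_le hW ha0.le hT0.le).trans hw2.le
  have hcle := abs_le.1 hcW₁
  have hdW₁ : deriv W₁ = fun x => deriv W x + gaussCos' a T x := deriv_perturb hW a T
  have hL₁ : ∀ x, |deriv W₁ x| ≤ L := fun x => by
    rw [hdW₁]
    exact (abs_add_le _ _).trans (add_le_add (hLb x)
      ((abs_gaussCos'_le' ha0.le hT0.le x).trans hw1))
  obtain ⟨π₁, q, hπ₁, hF₁, hqc, hq0, hπq, hq1⟩ := hmain a T ha0 hT1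
    (haT.le.trans (min_le_left _ _)) W₁ rfl hI₁ (by linarith) hL₁
  have hF₁low : ∀ z, m / 2 * (wt k z)⁻¹ ≤ ‖fourierR π₁ z‖ := fun z => by
    have h1 := norm_sub_norm_le (fourierR π₀ z) (fourierR π₁ z)
    rw [norm_sub_rev] at h1
    have h2 := hF₁ z
    have h3 := hFlow z
    have h4 : δ * (wt k z)⁻¹ ≤ m / 2 * (wt k z)⁻¹ :=
      mul_le_mul_of_nonneg_right (min_le_left _ _) (inv_pos.2 (wt_pos k z)).le
    linarith
  have hF₁up : ∀ z, ‖fourierR π₁ z‖ ≤ (M + 1) * (wt k z)⁻¹ := fun z => by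
    have h1 := norm_sub_norm_le (fourierR π₁ z) (fourierR π₀ z)
    have h2 := hF₁ z
    have h3 := hFup z
    have h4 : δ * (wt k z)⁻¹ ≤ 1 * (wt k z)⁻¹ :=
      mul_le_mul_of_nonneg_right (min_le_right _ _) (inv_pos.2 (wt_pos k z)).le
    linarith
  have hW1mem : W₁ ∈ interactionClass α Vt r p J := by
    refine ⟨hI₁, ?_, ?_, ?_, π₁, hπ₁, ?_, fun z => ⟨hF₁low z, hF₁up z⟩⟩
    · refine lt_of_le_of_lt (ciSup_le hL₁) (heL.trans_le (Real.sqrt_le_sqrt ?_))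
      linarith
    · have : (⨅ x, iteratedDeriv 2 W₁ x) = -constCW W₁ := by rw [constCW, neg_neg]
      rw [this]
      exact ⟨(by linarith : -(2 * c) ≤ -constCW W₁), (by linarith : -constCW W₁ ≤ -(c / 2))⟩
    · change limsup (tailFun p (deriv W₁)) atTop ≤ _
      have h1 : Tendsto (tailFun p (gaussCos' a T)) atTop (nhds 0) :=
        tendsto_tailFun_of_le_exp hp8 (abs_gaussCos'_le ha0.le hT0.le)
      rw [hdW₁, (tendsto_tailFun_add hW.continuous_deriv.measurable htail0 h1).limsup_eq]
      exact zero_le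
    · have hlin := lintegral_ratio_le (k := k) (g₀ := fourierR (deriv W))
        (g₁ := fourierR (deriv W₁)) (h := fourierR (gaussCos' a T)) hm0 hM0.le
        (fun z => by
          rw [hdW₁]
          exact fourierR_add hW.deriv_integrable (integrable_gaussCos' ha0.le hT0.le) z)
        hFlow hFup hF₁low (continuous_fourierR (integrable_gaussCos' ha0.le hT0.le)) hr3p.le hr3
        (hCL a T ha0.le hT0.le) (by positivity)
      refine hlin.trans (ENNReal.ofReal_le_ofReal ?_)
      change _ ≤ r₃
      have hwt : wt (k + 1) T = T ^ (k + 1) := by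
        unfold wt; rw [abs_of_pos hT0, max_eq_right hT1]
      have h1 : CL * a ^ 2 * wt (k + 1) T ^ 2 ≤ CL := by
        have h2 : CL * a ^ 2 * wt (k + 1) T ^ 2 = CL * (a * T ^ (k + 1)) ^ 2 := by
          rw [hwt]; ring
        rw [h2, haT]
        exact mul_le_of_le_one_right hCL0 (pow_le_one₀ hA0.le hA1)
      have h2 : 2 * (2 / m) ^ 2 * (CL * a ^ 2 * wt (k + 1) T ^ 2) ≤ 2 * (2 / m) ^ 2 * CL := by
        gcongr
      linarith
  have hAT : 0 < A * (T ^ k)⁻¹ := by positivity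
  refine le_minimaxProb_of_two_points hW0mem hW1mem hV hπ₀ hπ₁ hqc hq0 hπq hq1 ?_ ?_
  -- The likelihood ratio deviates by D A T^{-2k} and N = T^{4k}, so N ε² = (D A)² ≤ 1.
  · have h1 : D * a * (T ^ (k - 1))⁻¹ = D * A * ((T ^ k)⁻¹) ^ 2 := by
      have h2 : T ^ (k + 1) * T ^ (k - 1) = (T ^ k) ^ 2 := by
        rw [← pow_add, ← pow_mul]; congr 1; omega
      rw [ha, inv_pow, ← h2, mul_inv]; ring
    have h4 : (T ^ k)⁻¹ * T ^ k = 1 := inv_mul_cancel₀ (by positivity)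
    rw [h1, ← hT4]
    have h3 : (T ^ k) ^ 4 * (D * A * ((T ^ k)⁻¹) ^ 2) ^ 2 =
        (D * A) ^ 2 * ((T ^ k)⁻¹ * T ^ k) ^ 4 := by ring
    rw [h3, h4, one_pow, mul_one]
    exact pow_le_one₀ (by positivity) hAD
  · have h2 : deriv W₁ - deriv W = gaussCos' a T := by
      rw [hdW₁]; ext t; simp
    have h4 : a * T = A * (T ^ k)⁻¹ := by
      rw [ha, pow_succ]; field_simp
    rw [h2, hNk, ← ENNReal.ofReal_add (by positivity) (by positivity)]
    refine lt_of_lt_of_le ?_ (ofReal_le_eLpNorm_gaussCos' ha0.le hT0.le)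
    rw [h4, ENNReal.ofReal_lt_ofReal_iff (by positivity)]
    linarith

/-! ### Functions with bounded derivatives -/

/-- `f` is `n` times differentiable, with continuous and bounded derivatives of the orders
`0, …, n`. -/
def BddDeriv : ℕ → (ℝ → ℝ) → Prop
  | 0, f => Continuous f ∧ ∃ C, ∀ x, |f x| ≤ C
  | n + 1, f => Differentiable ℝ f ∧ (∃ C, ∀ x, |f x| ≤ C) ∧ BddDeriv n (deriv f)

lemma BddDeriv.bdd {n : ℕ} {f : ℝ → ℝ} (h : BddDeriv n f) : ∃ C, ∀ x, |f x| ≤ C := by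
  cases n with
  | zero => exact h.2
  | succ n => exact h.2.1

lemma BddDeriv.continuous {n : ℕ} {f : ℝ → ℝ} (h : BddDeriv n f) : Continuous f := by
  cases n with
  | zero => exact h.1
  | succ n => exact h.1.continuous

lemma BddDeriv.of_hasDerivAt {n : ℕ} {f f' : ℝ → ℝ} (hf : ∀ x, HasDerivAt f (f' x) x)
    (hb : ∃ C, ∀ x, |f x| ≤ C) (h : BddDeriv n f') : BddDeriv (n + 1) f :=
  ⟨fun x => (hf x).differentiableAt, hb, by
    rwa [show deriv f = f' from funext fun x => (hf x).deriv]⟩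

lemma BddDeriv.of_succ {n : ℕ} : ∀ {f : ℝ → ℝ}, BddDeriv (n + 1) f → BddDeriv n f := by
  induction n with
  | zero => exact fun h => ⟨h.1.continuous, h.2.1⟩
  | succ n ih => exact fun h => ⟨h.1, h.2.1, ih h.2.2⟩

lemma BddDeriv.hasDerivAt {n : ℕ} {f : ℝ → ℝ} (h : BddDeriv (n + 1) f) (x : ℝ) :
    HasDerivAt f (deriv f x) x := (h.1 x).hasDerivAt

lemma BddDeriv.add {n : ℕ} : ∀ {f g : ℝ → ℝ}, BddDeriv n f → BddDeriv n g →
    BddDeriv n fun x => f x + g x := by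
  have hb : ∀ {f g : ℝ → ℝ}, (∃ C, ∀ x, |f x| ≤ C) → (∃ C, ∀ x, |g x| ≤ C) →
      ∃ C, ∀ x, |f x + g x| ≤ C := by
    rintro f g ⟨C, hC⟩ ⟨D, hD⟩
    exact ⟨C + D, fun x => (abs_add_le _ _).trans (add_le_add (hC x) (hD x))⟩
  induction n with
  | zero => exact fun hf hg => ⟨hf.1.add hg.1, hb hf.2 hg.2⟩
  | succ n ih =>
    intro f g hf hg
    exact .of_hasDerivAt (fun x => (hf.hasDerivAt x).add (hg.hasDerivAt x)) (hb hf.bdd hg.bdd)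
      (ih hf.2.2 hg.2.2)

lemma BddDeriv.mul {n : ℕ} : ∀ {f g : ℝ → ℝ}, BddDeriv n f → BddDeriv n g →
    BddDeriv n fun x => f x * g x := by
  have hb : ∀ {f g : ℝ → ℝ}, (∃ C, ∀ x, |f x| ≤ C) → (∃ C, ∀ x, |g x| ≤ C) →
      ∃ C, ∀ x, |f x * g x| ≤ C := by
    rintro f g ⟨C, hC⟩ ⟨D, hD⟩
    refine ⟨C * D, fun x => ?_⟩
    rw [abs_mul]
    exact mul_le_mul (hC x) (hD x) (abs_nonneg _) ((abs_nonneg _).trans (hC x))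
  induction n with
  | zero => exact fun hf hg => ⟨hf.1.mul hg.1, hb hf.2 hg.2⟩
  | succ n ih =>
    intro f g hf hg
    exact .of_hasDerivAt (fun x => (hf.hasDerivAt x).mul (hg.hasDerivAt x)) (hb hf.bdd hg.bdd)
      ((ih hf.2.2 hg.of_succ).add (ih hf.of_succ hg.2.2))

lemma bddDeriv_const (n : ℕ) (c : ℝ) : BddDeriv n fun _ => c := by
  induction n generalizing c with
  | zero => exact ⟨continuous_const, |c|, fun _ => le_rfl⟩
  | succ n ih => exact .of_hasDerivAt (fun x => hasDerivAt_const x c) ⟨|c|, fun _ => le_rfl⟩ (ih 0)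

lemma BddDeriv.inv {n : ℕ} {f : ℝ → ℝ} {c : ℝ} (hc : 0 < c) (hf : BddDeriv n f)
    (h : ∀ x, c ≤ f x) : BddDeriv n fun x => (f x)⁻¹ := by
  have h0 : ∀ x, f x ≠ 0 := fun x => (hc.trans_le (h x)).ne'
  have hb : ∃ C, ∀ x, |(f x)⁻¹| ≤ C := by
    refine ⟨c⁻¹, fun x => ?_⟩
    rw [abs_of_pos (inv_pos.2 (hc.trans_le (h x)))]
    exact inv_anti₀ hc (h x)
  induction n with
  | zero => exact ⟨hf.1.inv₀ h0, hb⟩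
  | succ n ih =>
    have hi := ih hf.of_succ
    refine .of_hasDerivAt (f' := fun x => -1 * deriv f x * ((f x)⁻¹ * (f x)⁻¹)) (fun x => ?_) hb
      (((bddDeriv_const n (-1)).mul hf.2.2).mul (hi.mul hi))
    refine ((hf.hasDerivAt x).inv (h0 x)).congr_deriv ?_
    have := h0 x
    field_simp

lemma BddDeriv.log {n : ℕ} {f : ℝ → ℝ} {c : ℝ} (hc : 0 < c) (hf : BddDeriv n f)
    (h : ∀ x, c ≤ f x) : BddDeriv n fun x => Real.log (f x) := by
  have hp : ∀ x, 0 < f x := fun x => hc.trans_le (h x)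
  have hb : ∃ C, ∀ x, |Real.log (f x)| ≤ C := by
    obtain ⟨C, hC⟩ := hf.bdd
    refine ⟨max (Real.log C) (-Real.log c), fun x => abs_le'.2 ⟨?_, ?_⟩⟩
    · exact (Real.log_le_log (hp x) ((le_abs_self _).trans (hC x))).trans (le_max_left _ _)
    · exact (neg_le_neg (Real.log_le_log hc (h x))).trans (le_max_right _ _)
  cases n with
  | zero => exact ⟨hf.1.log fun x => (hp x).ne', hb⟩
  | succ n =>
    refine .of_hasDerivAt (f' := fun x => deriv f x * (f x)⁻¹) (fun x => ?_) hb
      (hf.2.2.mul (hf.of_succ.inv hc h))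
    exact ((hf.hasDerivAt x).log (hp x).ne').congr_deriv (div_eq_mul_inv _ _)

lemma BddDeriv.contDiff {n : ℕ} : ∀ {f : ℝ → ℝ}, BddDeriv n f → ContDiff ℝ n f := by
  induction n with
  | zero => exact fun h => contDiff_zero.2 h.1
  | succ n ih =>
    intro f h
    have := contDiff_succ_iff_deriv (n := (n : WithTop ℕ∞)) (f := f) (𝕜 := ℝ)
    rw [Nat.cast_add, Nat.cast_one]
    exact this.2 ⟨h.1, by simp, ih h.2.2⟩

lemma BddDeriv.iteratedDeriv_bdd {n : ℕ} : ∀ {f : ℝ → ℝ}, BddDeriv n f → ∀ j ≤ n,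
    ∃ C, ∀ x, |iteratedDeriv j f x| ≤ C := by
  induction n with
  | zero =>
    intro f h j hj
    obtain rfl : j = 0 := by omega
    simpa using h.2
  | succ n ih =>
    intro f h j hj
    cases j with
    | zero => simpa using h.bdd
    | succ j =>
      rw [iteratedDeriv_succ']
      exact ih h.2.2 j (by omega)

lemma BddDeriv.conv {n : ℕ} {ρ : ℝ → ℝ} (hρ : Integrable ρ) :
    ∀ {f : ℝ → ℝ}, BddDeriv n f → BddDeriv n (conv f ρ) := by
  have hb : ∀ {f : ℝ → ℝ}, (∃ C, ∀ x, |f x| ≤ C) → ∃ C, ∀ x, |_root_.conv f ρ x| ≤ C :=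
    fun ⟨C, hC⟩ => ⟨_, abs_conv_le hC hρ⟩
  induction n with
  | zero => exact fun ⟨h, C, hC⟩ => ⟨continuous_conv h hC hρ, hb ⟨C, hC⟩⟩
  | succ n ih =>
    intro f h
    obtain ⟨C, hC⟩ := h.bdd
    obtain ⟨D, hD⟩ := h.2.2.bdd
    exact .of_hasDerivAt (hasDerivAt_conv h.hasDerivAt h.2.2.continuous hC hD hρ) (hb h.bdd)
      (ih h.2.2)

lemma bddDeriv_pow_mul_gauss (n i : ℕ) : BddDeriv n fun x => x ^ i * Real.exp (-x ^ 2 / 2) := by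
  have hb : ∀ i : ℕ, ∃ C, ∀ x : ℝ, |x ^ i * Real.exp (-x ^ 2 / 2)| ≤ C := by
    intro i
    refine ⟨1 + 2 ^ i * i.factorial, fun x => ?_⟩
    have h1 := Real.pow_div_factorial_le_exp (x ^ 2 / 2) (by positivity) i
    rw [div_le_iff₀ (by positivity), div_pow, div_le_iff₀ (by positivity)] at h1
    have h2 : |x| ^ i ≤ 1 + (x ^ 2) ^ i := by
      rw [← sq_abs, ← pow_mul, mul_comm, pow_mul]
      nlinarith [sq_nonneg (|x| ^ i - 1)]
    have h3 : Real.exp (x ^ 2 / 2) * Real.exp (-x ^ 2 / 2) = 1 := by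
      rw [← Real.exp_add, neg_div, add_neg_cancel, Real.exp_zero]
    have h4 : Real.exp (-x ^ 2 / 2) ≤ 1 := Real.exp_le_one_iff.2 (by nlinarith [sq_nonneg x])
    have h5 := Real.exp_pos (-x ^ 2 / 2)
    rw [abs_mul, abs_pow, abs_of_pos h5]
    calc |x| ^ i * Real.exp (-x ^ 2 / 2)
        ≤ (1 + Real.exp (x ^ 2 / 2) * i.factorial * 2 ^ i) * Real.exp (-x ^ 2 / 2) := by
          gcongr; linarith
      _ = Real.exp (-x ^ 2 / 2) +
          2 ^ i * i.factorial * (Real.exp (x ^ 2 / 2) * Real.exp (-x ^ 2 / 2)) := by ring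
      _ ≤ _ := by rw [h3]; linarith
  induction n generalizing i with
  | zero => exact ⟨by fun_prop, hb i⟩
  | succ n ih =>
    refine .of_hasDerivAt (f' := fun x => i * (x ^ (i - 1) * Real.exp (-x ^ 2 / 2)) +
      -1 * (x ^ (i + 1) * Real.exp (-x ^ 2 / 2))) (fun x => ?_) (hb i)
      (((bddDeriv_const n i).mul (ih _)).add ((bddDeriv_const n (-1)).mul (ih _)))
    refine ((hasDerivAt_pow i x).mul (hasDerivAt_exp_neg_sq_half x)).congr_deriv ?_
    ring

lemma bddDeriv_gaussCos_zero (n : ℕ) (A : ℝ) : BddDeriv n (gaussCos A 0) := by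
  have := (bddDeriv_const n A).mul (bddDeriv_pow_mul_gauss n 0)
  convert this using 2 with x
  simp [gaussCos]

/-! ### Cosine integrals -/

/-- The `j`-th derivative of the cosine integral of `m`. -/
def cosInt (m : ℝ → ℝ) (j : ℕ) (x : ℝ) : ℝ :=
  ∫ z, z ^ j * Real.cos (x * z + j * (Real.pi / 2)) * m z

lemma integrable_cosInt {m : ℝ → ℝ} (hmc : Continuous m) {j : ℕ}
    (hm : Integrable fun z => |z| ^ j * |m z|) (x : ℝ) :
    Integrable fun z => z ^ j * Real.cos (x * z + j * (Real.pi / 2)) * m z := by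
  refine hm.mono' (Continuous.aestronglyMeasurable (by fun_prop)) (ae_of_all _ fun z => ?_)
  rw [Real.norm_eq_abs, abs_mul, abs_mul, abs_pow]
  gcongr
  exact mul_le_of_le_one_right (by positivity) (Real.abs_cos_le_one _)

lemma abs_cosInt_le {m : ℝ → ℝ} {j : ℕ} (hm : Integrable fun z => |z| ^ j * |m z|) (x : ℝ) :
    |cosInt m j x| ≤ ∫ z, |z| ^ j * |m z| := by
  rw [cosInt, ← Real.norm_eq_abs]
  refine norm_integral_le_of_norm_le hm (ae_of_all _ fun z => ?_)
  rw [Real.norm_eq_abs, abs_mul, abs_mul, abs_pow]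
  gcongr
  exact mul_le_of_le_one_right (by positivity) (Real.abs_cos_le_one _)

lemma continuous_cosInt {m : ℝ → ℝ} (hmc : Continuous m) {j : ℕ}
    (hm : Integrable fun z => |z| ^ j * |m z|) : Continuous (cosInt m j) := by
  refine continuous_of_dominated (fun x => (integrable_cosInt hmc hm x).aestronglyMeasurable)
    (fun x => ae_of_all _ fun z => ?_) hm (ae_of_all _ fun z => by fun_prop)
  rw [Real.norm_eq_abs, abs_mul, abs_mul, abs_pow]
  gcongr
  exact mul_le_of_le_one_right (by positivity) (Real.abs_cos_le_one _)

lemma hasDerivAt_cosInt {m : ℝ → ℝ} (hmc : Continuous m) {j : ℕ}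
    (hm : Integrable fun z => |z| ^ j * |m z|)
    (hm' : Integrable fun z => |z| ^ (j + 1) * |m z|) (x : ℝ) :
    HasDerivAt (cosInt m j) (cosInt m (j + 1) x) x := by
  refine (hasDerivAt_integral_of_dominated_loc_of_deriv_le (s := Set.univ) univ_mem
    (F := fun x z => z ^ j * Real.cos (x * z + j * (Real.pi / 2)) * m z)
    (F' := fun x z => z ^ (j + 1) * Real.cos (x * z + (j + 1 : ℕ) * (Real.pi / 2)) * m z)
    (bound := fun z => |z| ^ (j + 1) * |m z|)
    (Eventually.of_forall fun x => (integrable_cosInt hmc hm x).aestronglyMeasurable)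
    (integrable_cosInt hmc hm x) (integrable_cosInt hmc hm' x).aestronglyMeasurable
    (ae_of_all _ fun z x _ => ?_) hm' (ae_of_all _ fun z x _ => ?_)).2
  · rw [Real.norm_eq_abs, abs_mul, abs_mul, abs_pow]
    gcongr
    exact mul_le_of_le_one_right (by positivity) (Real.abs_cos_le_one _)
  · have h1 : HasDerivAt (fun x : ℝ => x * z + j * (Real.pi / 2)) z x := by
      simpa using ((hasDerivAt_id x).mul_const z).add_const (j * (Real.pi / 2))
    refine ((h1.cos.const_mul (z ^ j)).mul_const (m z)).congr_deriv ?_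
    have : x * z + ((j + 1 : ℕ) : ℝ) * (Real.pi / 2) =
        x * z + j * (Real.pi / 2) + Real.pi / 2 := by push_cast; ring
    rw [this, Real.cos_add_pi_div_two]
    ring

lemma bddDeriv_cosInt {m : ℝ → ℝ} (hmc : Continuous m) {n : ℕ}
    (hm : ∀ j ≤ n, Integrable fun z => |z| ^ j * |m z|) (i j : ℕ) (hij : j + i ≤ n) :
    BddDeriv i (cosInt m j) := by
  have hb : ∀ j ≤ n, ∃ C, ∀ x, |cosInt m j x| ≤ C := fun j hj => ⟨_, abs_cosInt_le (hm j hj)⟩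
  induction i generalizing j with
  | zero => exact ⟨continuous_cosInt hmc (hm j (by omega)), hb j (by omega)⟩
  | succ i ih =>
    exact .of_hasDerivAt (hasDerivAt_cosInt hmc (hm j (by omega)) (hm (j + 1) (by omega)))
      (hb j (by omega)) (ih (j + 1) (by omega))

lemma iteratedDeriv_cosInt {m : ℝ → ℝ} (hmc : Continuous m) {n : ℕ}
    (hm : ∀ j ≤ n, Integrable fun z => |z| ^ j * |m z|) (i j : ℕ) (hij : j + i ≤ n) :
    iteratedDeriv i (cosInt m j) = cosInt m (j + i) := by
  induction i generalizing j with
  | zero => simp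
  | succ i ih =>
    have h : deriv (cosInt m j) = cosInt m (j + 1) := funext fun x =>
      (hasDerivAt_cosInt hmc (hm j (by omega)) (hm (j + 1) (by omega)) x).deriv
    rw [iteratedDeriv_succ', h, ih (j + 1) (by omega)]
    congr 1; omega

/-- Decay of order J + 2 against |z|^J leaves the integrable |z|^{-2}, so J derivatives pass under
the cosine integral. -/
lemma integrable_pow_mul_inv_wt (J j : ℕ) (hj : j ≤ J) :
    Integrable fun z => |z| ^ j * |(wt (J + 2) z)⁻¹| := by
  refine (integrable_inv_wt 2 le_rfl).mono' (Continuous.aestronglyMeasurable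
    ((by fun_prop : Continuous fun z : ℝ => |z| ^ j).mul (continuous_inv_wt _).abs))
    (ae_of_all _ fun z => ?_)
  have h0 := le_max_left 1 |z|
  have h1 : |z| ^ j ≤ max 1 |z| ^ J :=
    (pow_le_pow_left₀ (abs_nonneg z) (le_max_right 1 |z|) j).trans (pow_le_pow_right₀ h0 hj)
  have h2 : (wt (J + 2) z)⁻¹ = (max 1 |z| ^ J)⁻¹ * (wt 2 z)⁻¹ := by
    unfold wt; rw [pow_add, mul_inv]
  have h3 := inv_pos.2 (wt_pos 2 z)
  have h4 : 0 < max 1 |z| ^ J := by positivity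
  rw [Real.norm_of_nonneg (by positivity), abs_of_pos (inv_pos.2 (wt_pos _ z)), h2, ← mul_assoc]
  refine mul_le_of_le_one_left h3.le ?_
  rw [← div_eq_mul_inv]
  exact (div_le_one h4).2 h1

/-! ### A function of exact smoothness `J` -/

/-- A function of smoothness `J` whose Fourier transform decays exactly like `|z|^{-J-2}`. -/
def roughFun (J : ℕ) : ℝ → ℝ := cosInt (fun z => (wt (J + 2) z)⁻¹) 0

lemma bddDeriv_roughFun (J : ℕ) : BddDeriv J (roughFun J) :=
  bddDeriv_cosInt (continuous_inv_wt _) (integrable_pow_mul_inv_wt J) J 0 (by omega)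

lemma iteratedDeriv_roughFun {J n : ℕ} (hn : n ≤ J) :
    iteratedDeriv n (roughFun J) = cosInt (fun z => (wt (J + 2) z)⁻¹) n := by
  rw [roughFun, iteratedDeriv_cosInt (continuous_inv_wt _) (integrable_pow_mul_inv_wt J) n 0
    (by omega), zero_add]

lemma cosInt_two_mul (m : ℝ → ℝ) (l : ℕ) (x : ℝ) :
    cosInt m (2 * l) x = (-1) ^ l * ∫ z, z ^ (2 * l) * Real.cos (x * z) * m z := by
  rw [← integral_const_mul, cosInt]
  congr 1; ext z
  have : x * z + ((2 * l : ℕ) : ℝ) * (Real.pi / 2) = x * z + l * Real.pi := by push_cast; ring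
  rw [this, Real.cos_add_nat_mul_pi]
  ring

lemma cosInt_two_mul_neg (m : ℝ → ℝ) (l : ℕ) (x : ℝ) :
    cosInt m (2 * l) (-x) = cosInt m (2 * l) x := by
  simp only [cosInt_two_mul, neg_mul, Real.cos_neg]

lemma roughFun_neg (J : ℕ) (x : ℝ) : roughFun J (-x) = roughFun J x :=
  cosInt_two_mul_neg _ 0 x

/-- For an even order the integrand z^{2l} (1 - cos(xz)) has a sign, so the integral can be
restricted to 1 ≤ z ≤ 1/x. There 1 - cos(xz) ≥ 2 (xz)²/π² and the weight is a pure power. -/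
lemma le_abs_cosInt_sub {J l : ℕ} (hl : 2 * l ≤ J) {x : ℝ} (hx0 : 0 < x) (hx1 : x ≤ 1) :
    2 / Real.pi ^ 2 * x ^ 2 * ∫ z in (1 : ℝ)..x⁻¹, z ^ (2 * l + 2) * (z ^ (J + 2))⁻¹ ≤
      |cosInt (fun z => (wt (J + 2) z)⁻¹) (2 * l) x -
        cosInt (fun z => (wt (J + 2) z)⁻¹) (2 * l) 0| := by
  set m : ℝ → ℝ := fun z => (wt (J + 2) z)⁻¹ with hm
  have hmp : ∀ z, 0 < m z := fun z => inv_pos.2 (wt_pos _ z)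
  have hi0 := integrable_pow_mul_inv_wt J (2 * l) hl
  have hmc : Continuous m := continuous_inv_wt _
  have hi : ∀ x : ℝ, Integrable fun z => z ^ (2 * l) * Real.cos (x * z) * m z := fun x => by
    refine hi0.mono' (Continuous.aestronglyMeasurable (by fun_prop)) (ae_of_all _ fun z => ?_)
    rw [Real.norm_eq_abs, abs_mul, abs_mul, abs_pow]
    gcongr
    exact mul_le_of_le_one_right (by positivity) (Real.abs_cos_le_one _)
  have h1x : (1 : ℝ) ≤ x⁻¹ := (one_le_inv₀ hx0).2 hx1
  rw [cosInt_two_mul, cosInt_two_mul, ← mul_sub, abs_mul, abs_pow, abs_neg, abs_one, one_pow,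
    one_mul, abs_sub_comm, ← integral_sub (hi 0) (hi x)]
  refine le_trans ?_ (le_abs_self _)
  have hnn : ∀ z, 0 ≤ z ^ (2 * l) * Real.cos (0 * z) * m z - z ^ (2 * l) * Real.cos (x * z) * m z :=
    fun z => by
      have h1 := Real.cos_le_one (x * z)
      have h2 : 0 ≤ z ^ (2 * l) := by rw [pow_mul]; positivity
      have h3 := mul_nonneg (mul_nonneg h2 (sub_nonneg.2 h1)) (hmp z).le
      rw [zero_mul, Real.cos_zero]
      linarith only [h3]
  rw [← intervalIntegral.integral_const_mul, intervalIntegral.integral_of_le h1x]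
  refine le_trans ?_ (setIntegral_le_integral (s := Set.Ioc 1 x⁻¹) ((hi 0).sub (hi x))
    (ae_of_all _ hnn))
  refine setIntegral_mono_on ?_ ((hi 0).sub (hi x)).integrableOn measurableSet_Ioc fun z hz => ?_
  · refine (ContinuousOn.integrableOn_Icc ?_).mono_set Set.Ioc_subset_Icc_self
    refine continuousOn_const.mul ((continuousOn_pow _).mul ((continuousOn_pow _).inv₀ ?_))
    intro z hz
    have : 0 < z := one_pos.trans_le hz.1
    positivity
  · have hz0 : 0 < z := one_pos.trans hz.1
    have hmz : m z = (z ^ (J + 2))⁻¹ := by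
      simp only [hm, wt]; rw [abs_of_pos hz0, max_eq_right hz.1.le]
    have hxz : x * z ≤ 1 := by
      have := mul_le_mul_of_nonneg_left hz.2 hx0.le
      rwa [mul_inv_cancel₀ hx0.ne'] at this
    have h1 := Real.cos_le_one_sub_mul_cos_sq (x := x * z) (by
      rw [abs_of_pos (by positivity)]
      exact hxz.trans (by linarith [Real.pi_gt_three]))
    rw [zero_mul, Real.cos_zero, hmz]
    have h2 : 0 < z ^ (2 * l) * (z ^ (J + 2))⁻¹ := by positivity
    have h3 := mul_le_mul_of_nonneg_left h1 h2.le
    have e : 2 / Real.pi ^ 2 * x ^ 2 * (z ^ (2 * l + 2) * (z ^ (J + 2))⁻¹) =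
        z ^ (2 * l) * (z ^ (J + 2))⁻¹ * (2 / Real.pi ^ 2 * (x * z) ^ 2) := by ring
    rw [e]
    linarith only [h3]

/-- Only even-order derivatives give an integrand with a sign. For even J, evenness forces a
derivative of the J-th derivative at 0 to vanish, while its increments are at least of order |x|.
For odd J, differentiability of the J-th derivative, which vanishes at 0, makes the increments of
the previous one O(x²), while they are at least of order x² log(1/x). -/
lemma not_contDiff_roughFun (J : ℕ) : ¬ ContDiff ℝ (J + 1 : ℕ) (roughFun J) := by
  intro h
  set m : ℝ → ℝ := fun z => (wt (J + 2) z)⁻¹ with hm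
  have hd := h.differentiable_iteratedDeriv J (by exact_mod_cast J.lt_succ_self)
  rw [iteratedDeriv_roughFun le_rfl] at hd
  have hpi := Real.pi_pos
  rcases Nat.even_or_odd' J with ⟨l, hl | hl⟩
  · have hev : ∀ x, cosInt m J (-x) = cosInt m J x := fun x => by
      rw [hl]; exact cosInt_two_mul_neg _ l x
    have hd0 := (hd 0).hasDerivAt
    have hz : deriv (cosInt m J) 0 = 0 := by
      have h1 := deriv_comp_neg (cosInt m J) 0
      rw [neg_zero, funext hev] at h1
      linarith
    rw [hz, hasDerivAt_iff_isLittleO] at hd0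
    obtain ⟨ε, hε, hb⟩ := Metric.eventually_nhds_iff.1
      (hd0.def (by positivity : (0 : ℝ) < 1 / Real.pi ^ 2))
    -- The increment is at least (2/π²)(x - x²), but at most x/π² by the little-o bound just chosen;
    -- x ≤ 1/4 makes these incompatible.
    set x := min (ε / 2) (1 / 4) with hx
    have hx0 : 0 < x := lt_min (by positivity) (by norm_num)
    have hx4 : x ≤ 1 / 4 := min_le_right _ _
    have hxε : x < ε := (min_le_left _ _).trans_lt (by linarith)
    have h1 := hb (y := x) (by rwa [Real.dist_eq, sub_zero, abs_of_pos hx0])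
    rw [smul_zero, sub_zero, sub_zero, Real.norm_eq_abs, Real.norm_eq_abs, abs_of_pos hx0] at h1
    have h2 := le_abs_cosInt_sub (J := J) (l := l) hl.ge hx0 (by linarith)
    rw [← hl] at h2
    have h1x : (1 : ℝ) ≤ x⁻¹ := (one_le_inv₀ hx0).2 (by linarith)
    have h3 : ∫ z in (1 : ℝ)..x⁻¹, z ^ (J + 2) * (z ^ (J + 2))⁻¹ = x⁻¹ - 1 := by
      rw [intervalIntegral.integral_congr (g := fun _ => (1 : ℝ))]
      · simp
      · intro z hz
        rw [Set.uIcc_of_le h1x] at hz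
        have : 0 < z := one_pos.trans_le hz.1
        exact mul_inv_cancel₀ (by positivity)
    rw [h3] at h2
    have h4 := h2.trans h1
    have h5 : 2 / Real.pi ^ 2 * x ^ 2 * (x⁻¹ - 1) = 1 / Real.pi ^ 2 * (2 * (x - x ^ 2)) := by
      field_simp
    rw [h5] at h4
    have h6 := le_of_mul_le_mul_left h4 (by positivity)
    nlinarith
  · have hlJ : 2 * l ≤ J := by omega
    have hder : ∀ x, HasDerivAt (cosInt m (2 * l)) (cosInt m J x) x := fun x => by
      rw [hl]
      exact hasDerivAt_cosInt (continuous_inv_wt _) (integrable_pow_mul_inv_wt J _ hlJ)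
        (integrable_pow_mul_inv_wt J _ hl.ge) x
    have hz : cosInt m J 0 = 0 := by
      have h1 : Real.cos ((J : ℝ) * (Real.pi / 2)) = 0 := by
        have : (J : ℝ) * (Real.pi / 2) = Real.pi / 2 + l * Real.pi := by
          rw [hl]; push_cast; ring
        rw [this, Real.cos_add_nat_mul_pi, Real.cos_pi_div_two, mul_zero]
      simp only [cosInt, zero_mul, zero_add, h1, mul_zero, integral_zero]
    obtain ⟨C, hC⟩ := ((hd 0).hasDerivAt.isBigO_sub).bound
    obtain ⟨ε, hε, hb⟩ := Metric.eventually_nhds_iff.1 hC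
    have hC0 : 0 ≤ max C 0 := le_max_right _ _
    -- Chosen so that (2/π²) R is the constant of the quadratic upper bound; log(1/x) ≥ R + 1 then
    -- exceeds it.
    set R := max C 0 * Real.pi ^ 2 / 2 with hR
    set x := min (ε / 2) (Real.exp (-(R + 1))) with hx
    have hx0 : 0 < x := lt_min (by positivity) (Real.exp_pos _)
    have hxε : x < ε := (min_le_left _ _).trans_lt (by linarith)
    have hxe : x ≤ Real.exp (-(R + 1)) := min_le_right _ _
    have hx1 : x ≤ 1 := hxe.trans (Real.exp_le_one_iff.2 (by
      have : 0 ≤ R := by positivity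
      linarith))
    have h1 := Convex.norm_image_sub_le_of_norm_hasDerivWithin_le (f := cosInt m (2 * l))
      (f' := cosInt m J) (s := Set.Icc 0 x) (C := max C 0 * x)
      (fun y _ => (hder y).hasDerivWithinAt) (fun y hy => by
        have h2 := hb (y := y) (by
          rw [Real.dist_eq, sub_zero, abs_of_nonneg hy.1]; exact hy.2.trans_lt hxε)
        rw [hz, sub_zero, sub_zero] at h2
        refine h2.trans ?_
        rw [Real.norm_of_nonneg hy.1]
        exact mul_le_mul (le_max_left _ _) hy.2 hy.1 hC0) (convex_Icc 0 x)
      (Set.left_mem_Icc.2 hx0.le) (Set.right_mem_Icc.2 hx0.le)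
    rw [Real.norm_eq_abs, sub_zero, Real.norm_of_nonneg hx0.le] at h1
    have h2 := le_abs_cosInt_sub (J := J) (l := l) hlJ hx0 hx1
    have h1x : (1 : ℝ) ≤ x⁻¹ := (one_le_inv₀ hx0).2 hx1
    have h3 : ∫ z in (1 : ℝ)..x⁻¹, z ^ (2 * l + 2) * (z ^ (J + 2))⁻¹ = -Real.log x := by
      rw [intervalIntegral.integral_congr (g := fun z : ℝ => z⁻¹), integral_inv_of_pos one_pos
        (by positivity), div_one, Real.log_inv]
      intro z hz
      rw [Set.uIcc_of_le h1x] at hz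
      have : 0 < z := one_pos.trans_le hz.1
      change z ^ (2 * l + 2) * (z ^ (J + 2))⁻¹ = z⁻¹
      have e : z ^ (J + 2) = z ^ (2 * l + 2) * z := by rw [← pow_succ, hl]
      rw [e, mul_inv, ← mul_assoc, mul_inv_cancel₀ (by positivity), one_mul]
    rw [h3] at h2
    have h4 := h2.trans h1
    have h5 : R + 1 ≤ -Real.log x := by
      have := Real.log_le_log hx0 hxe
      rw [Real.log_exp] at this
      linarith
    have h6 : 2 / Real.pi ^ 2 * x ^ 2 * (R + 1) ≤ 2 / Real.pi ^ 2 * x ^ 2 * -Real.log x := by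
      gcongr
    have h7 : 2 / Real.pi ^ 2 * x ^ 2 * (R + 1) = max C 0 * x * x + 2 / Real.pi ^ 2 * x ^ 2 := by
      rw [hR]; field_simp
    have h8 : 0 < 2 / Real.pi ^ 2 * x ^ 2 := by positivity
    linarith

/-! ### The Fourier transform of the density -/

lemma hasFourierRep_cosInt {m : ℝ → ℝ} (hm : Integrable m) (heven : ∀ z, m (-z) = m z) :
    HasFourierRep (cosInt m 0) fun z => (m z : ℂ) := by
  intro x
  have hc : Integrable fun z => Real.cos (x * z) * m z :=
    hm.bdd_mul (c := 1) (by fun_prop) (ae_of_all _ fun z => Real.abs_cos_le_one _)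
  have hs : Integrable fun z => Real.sin (x * z) * m z :=
    hm.bdd_mul (c := 1) (by fun_prop) (ae_of_all _ fun z => Real.abs_sin_le_one _)
  have h0 : ∫ z, Real.sin (x * z) * m z = 0 := by
    have h1 := integral_neg_eq_self (fun z => Real.sin (x * z) * m z) volume
    simp only [mul_neg, Real.sin_neg, heven, neg_mul, integral_neg] at h1
    linarith
  have h1 : (fun z : ℝ => Complex.exp (-(Complex.I * (x : ℂ) * (z : ℂ))) * (m z : ℂ)) =
      fun z => ((Real.cos (x * z) * m z : ℝ) : ℂ) -
        Complex.I * ((Real.sin (x * z) * m z : ℝ) : ℂ) := by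
    ext z
    have : -(Complex.I * (x : ℂ) * (z : ℂ)) = ((-(x * z) : ℝ) : ℂ) * Complex.I := by
      push_cast; ring
    rw [this, Complex.exp_mul_I, ← Complex.ofReal_cos, ← Complex.ofReal_sin, Real.cos_neg,
      Real.sin_neg]
    push_cast; ring
  rw [h1]
  refine Eq.trans ?_ (integral_sub (hc.ofReal (𝕜 := ℂ))
    ((hs.ofReal (𝕜 := ℂ)).const_mul Complex.I)).symm
  rw [integral_const_mul, integral_ofReal, integral_ofReal, h0, cosInt]
  simp

/-- The Fourier transform of `exp (-α x²)`. -/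
def gaussHat (α z : ℝ) : ℝ := √(Real.pi / α) * Real.exp (-(4 * α)⁻¹ * z ^ 2)

lemma fourierR_exp_neg_mul_sq {α : ℝ} (hα : 0 < α) (z : ℝ) :
    fourierR (fun x => Real.exp (-α * x ^ 2)) z = gaussHat α z := by
  have h := fourierIntegral_gaussian (b := (α : ℂ)) (by simpa using hα) (z : ℂ)
  unfold fourierR gaussHat
  push_cast
  rw [h, Real.sqrt_eq_rpow, Complex.ofReal_cpow (by positivity)]
  push_cast
  congr 2
  field_simp

lemma gaussHat_pos {α : ℝ} (hα : 0 < α) (z : ℝ) : 0 < gaussHat α z := by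
  unfold gaussHat; positivity

lemma continuous_gaussHat (α : ℝ) : Continuous (gaussHat α) := by unfold gaussHat; fun_prop

lemma exists_gaussHat_le (k : ℕ) {α : ℝ} (hα : 0 < α) :
    ∃ C > 0, ∀ z, gaussHat α z ≤ C * (wt k z)⁻¹ := by
  have hb : 0 < (4 * α)⁻¹ := by positivity
  set b := (4 * α)⁻¹ with hbd
  refine ⟨√(Real.pi / α) * (1 + (1 + k.factorial / b ^ k)), by positivity, fun z => ?_⟩
  rw [gaussHat, ← hbd, mul_assoc]
  gcongr
  rw [← div_eq_mul_inv, le_div_iff₀ (wt_pos k z)]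
  have h1 := Real.pow_div_factorial_le_exp (b * z ^ 2) (by positivity) k
  have h2 : wt k z ≤ 1 + |z| ^ k := wt_le_one_add_pow k z
  have h3 : |z| ^ k ≤ 1 + (z ^ 2) ^ k := by
    rw [← sq_abs, ← pow_mul, mul_comm, pow_mul]
    nlinarith [sq_nonneg (|z| ^ k - 1)]
  have h4 : Real.exp (-b * z ^ 2) * Real.exp (b * z ^ 2) = 1 := by
    rw [← Real.exp_add, neg_mul, neg_add_cancel, Real.exp_zero]
  have h5 : Real.exp (-b * z ^ 2) ≤ 1 := Real.exp_le_one_iff.2 (by nlinarith [sq_nonneg z])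
  have h6 := Real.exp_pos (-b * z ^ 2)
  have h7 : (z ^ 2) ^ k ≤ k.factorial / b ^ k * Real.exp (b * z ^ 2) := by
    rw [div_le_iff₀ (by positivity), mul_pow] at h1
    rw [div_mul_eq_mul_div, le_div_iff₀ (by positivity)]
    linarith
  calc Real.exp (-b * z ^ 2) * wt k z
      ≤ Real.exp (-b * z ^ 2) * (1 + (1 + k.factorial / b ^ k * Real.exp (b * z ^ 2))) := by
        gcongr; linarith
    _ = Real.exp (-b * z ^ 2) * 2 +
        k.factorial / b ^ k * (Real.exp (-b * z ^ 2) * Real.exp (b * z ^ 2)) := by ring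
    _ ≤ 1 + (1 + k.factorial / b ^ k) := by rw [h4]; linarith

/-- Two-sided bounds for the Fourier transform of `exp (-α x²) (1 + ε h)`. -/
lemma exists_fourierR_bounds (J : ℕ) {α ε : ℝ} (hα : 0 < α) (hε : 0 < ε) :
    ∃ l > 0, ∃ u > 0, ∀ z,
      l * (wt (J + 2) z)⁻¹ ≤
        ‖fourierR (fun x => Real.exp (-α * x ^ 2) * (1 + ε * roughFun J x)) z‖ ∧
      ‖fourierR (fun x => Real.exp (-α * x ^ 2) * (1 + ε * roughFun J x)) z‖ ≤
        u * (wt (J + 2) z)⁻¹ := by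
  set k := J + 2 with hk
  have hk2 : 2 ≤ k := by omega
  obtain ⟨C, hC0, hC⟩ := exists_gaussHat_le k hα
  have hγ : Integrable fun x : ℝ => Real.exp (-α * x ^ 2) := integrable_exp_neg_mul_sq hα
  have hm : Integrable fun z => (wt k z)⁻¹ := integrable_inv_wt k hk2
  have hrep : HasFourierRep (roughFun J) fun z => (((wt k z)⁻¹ : ℝ) : ℂ) :=
    hasFourierRep_cosInt hm fun z => by rw [wt_neg]
  have hm' : Integrable fun z => (((wt k z)⁻¹ : ℝ) : ℂ) := hm.ofReal
  obtain ⟨B, hB⟩ := (bddDeriv_roughFun J).bdd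
  have hγh : Integrable fun x => Real.exp (-α * x ^ 2) * roughFun J x :=
    hγ.mul_bdd (c := B) (bddDeriv_roughFun J).continuous.aestronglyMeasurable (ae_of_all _ hB)
  have hint : ∀ z, Integrable fun y => (wt k y)⁻¹ * gaussHat α (z - y) := fun z => by
    refine ((integrable_inv_wt_mul k hk2 z).const_mul C).mono' (Continuous.aestronglyMeasurable
      ((continuous_inv_wt k).mul ((continuous_gaussHat α).comp (by fun_prop))))
      (ae_of_all _ fun y => ?_)
    have h1 := inv_pos.2 (wt_pos k y)
    have h2 := gaussHat_pos hα (z - y)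
    rw [Real.norm_of_nonneg (by positivity)]
    calc (wt k y)⁻¹ * gaussHat α (z - y) ≤ (wt k y)⁻¹ * (C * (wt k (z - y))⁻¹) := by
          gcongr; exact hC _
      _ = _ := by ring
  have hF : ∀ z, fourierR (fun x => Real.exp (-α * x ^ 2) * (1 + ε * roughFun J x)) z =
      ((gaussHat α z + ε * ∫ y, (wt k y)⁻¹ * gaussHat α (z - y) : ℝ) : ℂ) := fun z => by
    have e : (fun x => Real.exp (-α * x ^ 2) * (1 + ε * roughFun J x)) = fun x =>
        Real.exp (-α * x ^ 2) + ε * (Real.exp (-α * x ^ 2) * roughFun J x) := by ext x; ring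
    rw [e, fourierR_add hγ (hγh.const_mul ε), fourierR_const_mul, fourierR_exp_neg_mul_sq hα,
      fourierR_mul_of_rep hγ hm' hrep]
    have e2 : ∫ y, (((wt k y)⁻¹ : ℝ) : ℂ) *
        fourierR (fun x => Real.exp (-α * x ^ 2)) (z - y) =
        ((∫ y, (wt k y)⁻¹ * gaussHat α (z - y) : ℝ) : ℂ) := by
      rw [← integral_complex_ofReal]
      congr 1; ext y
      rw [fourierR_exp_neg_mul_sq hα, Complex.ofReal_mul]
    rw [e2]
    push_cast; rfl
  have hI0 : ∀ z, 0 ≤ ∫ y, (wt k y)⁻¹ * gaussHat α (z - y) := fun z =>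
    integral_nonneg fun y => mul_nonneg (inv_pos.2 (wt_pos k y)).le (gaussHat_pos hα _).le
  -- Both terms are nonnegative, so nothing cancels: the Gaussian term can be dropped for the lower
  -- bound, and the convolution alone has the exact order of the weight.
  have hnorm : ∀ z, ‖fourierR (fun x => Real.exp (-α * x ^ 2) * (1 + ε * roughFun J x)) z‖ =
      gaussHat α z + ε * ∫ y, (wt k y)⁻¹ * gaussHat α (z - y) := fun z => by
    rw [hF, Complex.norm_real, Real.norm_of_nonneg]
    exact add_nonneg (gaussHat_pos hα z).le (mul_nonneg hε.le (hI0 z))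
  have hg1 := gaussHat_pos hα 1
  have hconv := convC_nonneg k
  refine ⟨ε * (2 * ((2 ^ k)⁻¹ * gaussHat α 1)), by positivity, C + ε * (C * convC k), by positivity,
    fun z => ?_⟩
  have hw := inv_pos.2 (wt_pos k z)
  rw [hnorm]
  constructor
  -- Only |y - z| ≤ 1 is kept, an interval of length 2 on which `wt k y` ≤ 2^k `wt k z` and the
  -- Gaussian is at least its value at 1.
  · have hlow : 2 * ((2 ^ k)⁻¹ * gaussHat α 1) * (wt k z)⁻¹ ≤
        ∫ y, (wt k y)⁻¹ * gaussHat α (z - y) := by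
      refine le_trans ?_ (setIntegral_le_integral (s := Set.Icc (z - 1) (z + 1)) (hint z)
        (ae_of_all _ fun y => mul_nonneg (inv_pos.2 (wt_pos k y)).le (gaussHat_pos hα _).le))
      have h1 : ∫ _ in Set.Icc (z - 1) (z + 1), (2 ^ k)⁻¹ * (wt k z)⁻¹ * gaussHat α 1 =
          2 * ((2 ^ k)⁻¹ * gaussHat α 1) * (wt k z)⁻¹ := by
        rw [setIntegral_const, Real.volume_real_Icc_of_le (by linarith), smul_eq_mul]
        ring
      rw [← h1]
      refine setIntegral_mono_on (integrableOn_const (by simp)) (hint z).integrableOn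
        measurableSet_Icc fun y hy => ?_
      have hyz : |y - z| ≤ 1 := abs_le.2 ⟨by linarith [hy.1], by linarith [hy.2]⟩
      have h2 : wt k y ≤ 2 ^ k * wt k z := by
        have h3 := wt_le_add k z (y - z)
        rw [add_sub_cancel] at h3
        have h4 : wt k (y - z) = 1 := by unfold wt; rw [max_eq_left hyz, one_pow]
        rwa [h4, mul_one] at h3
      have h3 : (2 ^ k)⁻¹ * (wt k z)⁻¹ ≤ (wt k y)⁻¹ := by
        rw [← mul_inv]; exact inv_anti₀ (wt_pos k y) h2
      have h4 : gaussHat α 1 ≤ gaussHat α (z - y) := by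
        unfold gaussHat
        have h5 : (z - y) ^ 2 ≤ 1 ^ 2 := by
          rw [← sq_abs (z - y), abs_sub_comm]
          gcongr
        have h6 : 0 < (4 * α)⁻¹ := by positivity
        gcongr ?_ * Real.exp ?_
        nlinarith
      exact mul_le_mul h3 h4 hg1.le (inv_pos.2 (wt_pos k y)).le
    have := mul_le_mul_of_nonneg_left hlow hε.le
    have h0 := gaussHat_pos hα z
    linarith
  · have hup : ∫ y, (wt k y)⁻¹ * gaussHat α (z - y) ≤ C * convC k * (wt k z)⁻¹ := by
      calc ∫ y, (wt k y)⁻¹ * gaussHat α (z - y)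
          ≤ ∫ y, C * ((wt k y)⁻¹ * (wt k (z - y))⁻¹) := by
            refine integral_mono (hint z) ((integrable_inv_wt_mul k hk2 z).const_mul C) fun y => ?_
            have h1 := mul_le_mul_of_nonneg_left (hC (z - y)) (inv_pos.2 (wt_pos k y)).le
            exact h1.trans (le_of_eq (by ring))
        _ = C * ∫ y, (wt k y)⁻¹ * (wt k (z - y))⁻¹ := integral_const_mul _ _
        _ ≤ C * (convC k * (wt k z)⁻¹) := by
            gcongr; exact integral_inv_wt_mul_le k hk2 z
        _ = _ := by ring
    have h1 := mul_le_mul_of_nonneg_left hup hε.le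
    have h2 := hC z
    linarith

/-! ### A confinement potential with a non-empty class -/

lemma isProbDensity_normalize {f : ℝ → ℝ} (hf : Integrable f) (h0 : ∀ x, 0 ≤ f x)
    (hpos : 0 < ∫ x, f x) : IsProbDensity fun x => (∫ y, f y)⁻¹ * f x where
  nonneg x := mul_nonneg (inv_pos.2 hpos).le (h0 x)
  integrable := hf.const_mul _
  integral_eq_one := by rw [integral_const_mul, inv_mul_cancel₀ hpos.ne']

lemma conv_neg_of_even {f g : ℝ → ℝ} (hf : ∀ x, f (-x) = f x) (hg : ∀ x, g (-x) = g x) (x : ℝ) :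
    conv f g (-x) = conv f g x := by
  unfold conv
  rw [← integral_neg_eq_self]
  congr 1; ext y
  rw [hg, ← hf, show -(-x - -y) = x - y by ring]

lemma deriv_deriv_conv_gaussCos {A : ℝ} (hA : 0 ≤ A) {ρ : ℝ → ℝ} (hρ : Integrable ρ) :
    (∀ x, HasDerivAt (conv (gaussCos A 0) ρ) (conv (gaussCos' A 0) ρ x) x) ∧
    ∀ x, HasDerivAt (conv (gaussCos' A 0) ρ) (conv (gaussCos'' A 0) ρ x) x :=
  ⟨hasDerivAt_conv (hasDerivAt_gaussCos A 0) (continuous_gaussCos' A 0) (abs_gaussCos_le' hA 0)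
    (abs_gaussCos'_le' hA le_rfl) hρ,
  hasDerivAt_conv (hasDerivAt_gaussCos' A 0) (by unfold gaussCos''; fun_prop)
    (abs_gaussCos'_le' hA le_rfl) (abs_gaussCos''_le hA le_rfl) hρ⟩

lemma constCW_gaussCos_zero {A : ℝ} (hA : 0 ≤ A) :
    A ≤ constCW (gaussCos A 0) ∧ constCW (gaussCos A 0) ≤ 4 * A := by
  have hb : ∀ x, |gaussCos'' A 0 x| ≤ 4 * A := fun x => by
    simpa using abs_gaussCos''_le hA le_rfl x
  unfold constCW
  rw [iteratedDeriv_two_gaussCos]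
  constructor
  · have h := ciInf_le (f := gaussCos'' A 0)
      ⟨-(4 * A), by rintro _ ⟨x, rfl⟩; exact (abs_le.1 (hb x)).1⟩ 0
    have h0 : gaussCos'' A 0 0 = -A := by simp [gaussCos'']
    linarith
  · have h := le_ciInf fun x => (abs_le.1 (hb x)).1
    linarith

lemma isInteraction_gaussCos_zero {α A : ℝ} {Vt : ℝ → ℝ} (hA : 0 < A)
    (h : 4 * A < constCV α Vt) : IsInteraction α Vt (gaussCos A 0) where
  nonneg x := by
    unfold gaussCos
    rw [zero_mul, Real.cos_zero, one_mul]
    positivity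
  even := gaussCos_neg A 0
  contDiff := contDiff_gaussCos A 0
  deriv_bdd := ⟨_, by rw [deriv_gaussCos]; exact abs_gaussCos'_le' hA.le le_rfl⟩
  deriv_integrable := by rw [deriv_gaussCos]; exact integrable_gaussCos' hA.le le_rfl
  deriv2_bdd := ⟨_, by rw [iteratedDeriv_two_gaussCos]; exact abs_gaussCos''_le hA.le le_rfl⟩
  constCW_pos := hA.trans_le (constCW_gaussCos_zero hA.le).1
  constCW_lt := by linarith [(constCW_gaussCos_zero hA.le).2]

lemma exists_lintegral_ratio_gaussCos_le (k : ℕ) {A l : ℝ} (hA : 0 ≤ A) (hl : 0 < l) {G : ℝ → ℂ}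
    (hG : ∀ z, l * (wt k z)⁻¹ ≤ ‖G z‖) :
    ∃ R > 0, ∫⁻ z, ‖fourierR (gaussCos' A 0) z / G z‖ₑ ^ 2 ≤ ENNReal.ofReal R := by
  obtain ⟨C, hC0, hC⟩ := exists_lintegral_wt_fourierR_gaussCos'_le k
  have h0 := hC A 0 hA le_rfl
  set B := C * A ^ 2 * wt (k + 1) 0 ^ 2 with hB
  have hB0 : 0 ≤ B := by positivity
  refine ⟨(l⁻¹) ^ 2 * B + 1, by positivity, ?_⟩
  calc ∫⁻ z, ‖fourierR (gaussCos' A 0) z / G z‖ₑ ^ 2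
      ≤ ∫⁻ z, ENNReal.ofReal ((l⁻¹) ^ 2) *
          ENNReal.ofReal ((wt k z * ‖fourierR (gaussCos' A 0) z‖) ^ 2) := by
        refine lintegral_mono fun z => ?_
        rw [← ENNReal.ofReal_mul (by positivity), ← ofReal_norm,
          ← ENNReal.ofReal_pow (norm_nonneg _)]
        refine ENNReal.ofReal_le_ofReal ?_
        rw [← mul_pow]
        refine pow_le_pow_left₀ (norm_nonneg _) ?_ 2
        have hw := wt_pos k z
        have hlw : 0 < l * (wt k z)⁻¹ := by positivity
        have h1 : ‖G z‖⁻¹ ≤ l⁻¹ * wt k z := by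
          rw [← inv_inv (wt k z), ← mul_inv]
          exact inv_anti₀ hlw (hG z)
        rw [norm_div, div_eq_mul_inv, mul_comm]
        calc _ ≤ l⁻¹ * wt k z * ‖fourierR (gaussCos' A 0) z‖ := by gcongr
          _ = _ := by ring
    _ = ENNReal.ofReal ((l⁻¹) ^ 2) *
          ∫⁻ z, ENNReal.ofReal ((wt k z * ‖fourierR (gaussCos' A 0) z‖) ^ 2) :=
        lintegral_const_mul' _ _ ENNReal.ofReal_ne_top
    _ ≤ ENNReal.ofReal ((l⁻¹) ^ 2) * ENNReal.ofReal B := by gcongr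
    _ = ENNReal.ofReal ((l⁻¹) ^ 2 * B) := (ENNReal.ofReal_mul (by positivity)).symm
    _ ≤ _ := ENNReal.ofReal_le_ofReal (by linarith)

lemma BddDeriv.exists_common_bound {n : ℕ} {f : ℝ → ℝ} (h : BddDeriv (n + 2) f) :
    ∃ H > 0, ∀ x, |f x| ≤ H ∧ |deriv f x| ≤ H ∧ |deriv (deriv f) x| ≤ H := by
  obtain ⟨A, hA⟩ := h.bdd
  obtain ⟨B, hB⟩ := h.2.2.bdd
  obtain ⟨C, hC⟩ := h.2.2.2.2.bdd
  have hA0 := (abs_nonneg _).trans (hA 0)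
  have hB0 := (abs_nonneg _).trans (hB 0)
  have hC0 := (abs_nonneg _).trans (hC 0)
  exact ⟨A + B + C + 1, by positivity, fun x =>
    ⟨by linarith [hA x], by linarith [hB x], by linarith [hC x]⟩⟩

/-- To be used for (log u)'' = u''/u - (u'/u)², with a = u'', b = u' and q = 1/u. -/
lemma abs_second_log_deriv_le {a b q e : ℝ} (ha : |a| ≤ e) (hb : |b| ≤ e) (hq0 : 0 ≤ q)
    (hq : q ≤ 2) (he : e ≤ 1 / 2) : |a * q - (b * q) ^ 2| ≤ 4 * e := by
  have he0 : 0 ≤ e := (abs_nonneg a).trans ha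
  have h1 : |a * q| ≤ e * 2 := by
    rw [abs_mul, abs_of_nonneg hq0]; exact mul_le_mul ha hq hq0 he0
  have h2 : |b * q| ≤ e * 2 := by
    rw [abs_mul, abs_of_nonneg hq0]; exact mul_le_mul hb hq hq0 he0
  have h3 : (b * q) ^ 2 ≤ (e * 2) ^ 2 := by
    rw [← sq_abs]; exact pow_le_pow_left₀ (abs_nonneg _) h2 2
  have h4 : (e * 2) ^ 2 ≤ 2 * e := by nlinarith
  have h5 := abs_le.1 h1
  have h6 := sq_nonneg (b * q)
  exact abs_le.2 ⟨by linarith, by linarith⟩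

/-- There is a confinement potential of smoothness exactly `J` for which the class of interaction
potentials is non-empty for suitable parameters. -/
theorem exists_confinement_nonempty {J : ℕ} (hJ : 2 ≤ J) {α : ℝ} (hα : 0 < α) :
    ∃ Vt : ℝ → ℝ, IsNonsmoothConfinement J α Vt ∧
      ∃ (p : ℝ) (r : Fin 6 → ℝ), 0 < p ∧ (∀ i, 0 < r i) ∧
        (interactionClass α Vt r p J).Nonempty := by
  set h := roughFun J with hh
  have hhB : BddDeriv J h := bddDeriv_roughFun J
  have hhB2 : BddDeriv (J - 2 + 2) h := by rwa [Nat.sub_add_cancel hJ]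
  obtain ⟨H, hH0, hH⟩ := hhB2.exists_common_bound
  -- A bound for εh and its first two derivatives: 1/2 keeps u = 1 + εh in [1/2, 3/2], and α/8
  -- together with η ≤ α/16 gives |Vt''| ≤ 2e + 2η ≤ 3α/8, hence C_V ≥ 5α/8.
  set e := min (1 / 2) (α / 8) with he
  have he0 : 0 < e := lt_min (by norm_num) (by positivity)
  have he2 : e ≤ 1 / 2 := min_le_left _ _
  have he8 : e ≤ α / 8 := min_le_right _ _
  set ε := e / H with hε
  have hε0 : 0 < ε := by positivity
  have hεH : ε * H = e := div_mul_cancel₀ _ hH0.ne'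
  have hsmall : ∀ {y : ℝ}, |y| ≤ H → |ε * y| ≤ e := fun {y} hy => by
    rw [abs_mul, abs_of_pos hε0, ← hεH]
    exact mul_le_mul_of_nonneg_left hy hε0.le
  set η := min (1 / 2) (α / 16) with hη
  have hη0 : 0 < η := lt_min (by norm_num) (by positivity)
  have hη2 : η ≤ 1 / 2 := min_le_left _ _
  have hη16 : η ≤ α / 16 := min_le_right _ _
  set u : ℝ → ℝ := fun x => 1 + ε * h x with hu
  have huB : BddDeriv J u := (bddDeriv_const J 1).add ((bddDeriv_const J ε).mul hhB)
  have hu_low : ∀ x, 1 / 2 ≤ u x := fun x => by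
    have := (abs_le.1 (hsmall (hH x).1)).1
    change 1 / 2 ≤ 1 + ε * h x
    linarith
  have hu_up : ∀ x, u x ≤ 3 / 2 := fun x => by
    have := (abs_le.1 (hsmall (hH x).1)).2
    change 1 + ε * h x ≤ 3 / 2
    linarith
  have hu_pos : ∀ x, 0 < u x := fun x => by linarith [hu_low x]
  have hu_even : ∀ x, u (-x) = u x := fun x => by simp only [hu, hh, roughFun_neg]
  -- the invariant density
  set f : ℝ → ℝ := fun x => Real.exp (-α * x ^ 2) * u x with hf
  have hf_pos : ∀ x, 0 < f x := fun x => mul_pos (Real.exp_pos _) (hu_pos x)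
  have hfi : Integrable f := (integrable_exp_neg_mul_sq hα).mul_bdd (c := 3 / 2)
    huB.continuous.aestronglyMeasurable (ae_of_all _ fun x => by
      rw [Real.norm_of_nonneg (hu_pos x).le]; exact hu_up x)
  have hZ : 0 < ∫ x, f x := by
    refine (integral_pos_iff_support_of_nonneg (fun x => (hf_pos x).le) hfi).2 ?_
    have : Function.support f = Set.univ := Set.eq_univ_of_forall fun x => (hf_pos x).ne'
    rw [this]; simp
  set Z := ∫ x, f x with hZd
  set π₀ : ℝ → ℝ := fun x => Z⁻¹ * f x with hπd
  have hπ : IsProbDensity π₀ := isProbDensity_normalize hfi (fun x => (hf_pos x).le) hZ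
  have hπ_even : ∀ x, π₀ (-x) = π₀ x := fun x => by simp only [hπd, hf, hu_even, neg_sq]
  -- the potentials
  set W := gaussCos η 0 with hW
  set g := conv W π₀ with hg
  have hgB : ∀ n, BddDeriv n g := fun n => (bddDeriv_gaussCos_zero n η).conv hπ.integrable
  have hg_even : ∀ x, g (-x) = g x := conv_neg_of_even (gaussCos_neg η 0) hπ_even
  have hg_le : ∀ x, |g x| ≤ η := fun x => by
    have := abs_conv_le (abs_gaussCos_le' hη0.le 0) hπ.integrable x
    rwa [hπ.integral_abs, mul_one] at this
  -- The solution of 2V + W ⋆ π₀ = αx² - log u + 2, which makes the prescribed density invariant.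
  -- The constant 1 ensures V ≥ 0, since log u and g are at most 1/2.
  set Vt : ℝ → ℝ := fun x => 1 + (-(1 / 2) * Real.log (u x) + -(1 / 2) * g x) with hVt
  have hVB : BddDeriv J Vt := (bddDeriv_const J 1).add
    (((bddDeriv_const J _).mul (huB.log (by norm_num) hu_low)).add
      ((bddDeriv_const J _).mul (hgB J)))
  have hV2 : ∀ x, |iteratedDeriv 2 Vt x| ≤ 3 * α / 8 := by
    obtain ⟨hg1, hg2⟩ := deriv_deriv_conv_gaussCos hη0.le hπ.integrable
    have hu1 : ∀ x, HasDerivAt u (ε * deriv h x) x := fun x =>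
      ((hhB2.hasDerivAt x).const_mul ε).const_add 1
    have hV1 : deriv Vt = fun x => -(1 / 2) * (ε * deriv h x * (u x)⁻¹) +
        -(1 / 2) * conv (gaussCos' η 0) π₀ x := funext fun x => by
      refine HasDerivAt.deriv ((((((hu1 x).log (hu_pos x).ne').const_mul (-(1 / 2))).add
        ((hg1 x).const_mul (-(1 / 2)))).const_add 1).congr_deriv ?_)
      simp only [div_eq_mul_inv]
    intro x
    have h2 : iteratedDeriv 2 Vt x = -(1 / 2) *
        (ε * deriv (deriv h) x * (u x)⁻¹ - (ε * deriv h x * (u x)⁻¹) ^ 2) +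
        -(1 / 2) * conv (gaussCos'' η 0) π₀ x := by
      rw [iteratedDeriv_two, hV1]
      have h3 : HasDerivAt (deriv h) (deriv (deriv h) x) x := BddDeriv.hasDerivAt hhB2.2.2 x
      refine HasDerivAt.deriv (((((h3.const_mul ε).mul ((hu1 x).inv (hu_pos x).ne')).const_mul
        (-(1 / 2))).add ((hg2 x).const_mul (-(1 / 2)))).congr_deriv ?_)
      simp only [Pi.inv_apply, div_eq_mul_inv]
      ring_nf
    have h3 := abs_second_log_deriv_le (hsmall (hH x).2.2) (hsmall (hH x).2.1)
      (inv_pos.2 (hu_pos x)).le (by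
        have := inv_anti₀ (by norm_num) (hu_low x)
        linarith) he2
    have h4 := abs_conv_le (abs_gaussCos''_le hη0.le le_rfl) hπ.integrable x
    rw [hπ.integral_abs] at h4
    rw [h2]
    have h5 := abs_le.1 h3
    have h6 := abs_le.1 h4
    exact abs_le.2 ⟨by linarith only [h5.2, h6.2, he8, hη16],
      by linarith only [h5.1, h6.1, he8, hη16]⟩
  have hCV : 5 * α / 8 ≤ constCV α Vt := by
    have := le_ciInf fun x => (abs_le.1 (hV2 x)).1
    unfold constCV
    linarith
  have hVc : IsNonsmoothConfinement J α Vt := by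
    refine ⟨hJ, hα, fun x => ?_, fun x => ?_, ?_, hVB.contDiff, fun hcd => ?_, fun j _ hj =>
      hVB.iteratedDeriv_bdd j hj, by linarith⟩
    · have h1 := Real.log_le_sub_one_of_pos (hu_pos x)
      have h2 := hu_up x
      have h3 := (abs_le.1 (hg_le x)).2
      have h4 : 0 ≤ α / 2 * x ^ 2 := by positivity
      change 0 ≤ α / 2 * x ^ 2 + (1 + (-(1 / 2) * Real.log (u x) + -(1 / 2) * g x))
      linarith
    · simp only [hVt, hu_even, hg_even]
    · obtain ⟨C, hC⟩ := hVB.bdd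
      exact ⟨C, 0, fun x => by simpa using hC x⟩
    -- g is smooth, so if Vt were C^{J+1} then u = exp(2(1 - Vt) - g), and with it h, would be too.
    · refine not_contDiff_roughFun J ?_
      have h1 : roughFun J = fun x => ε⁻¹ * (Real.exp (2 * (1 - Vt x) - g x) - 1) := by
        ext x
        have h2 : 2 * (1 - Vt x) - g x = Real.log (u x) := by simp only [hVt]; ring
        rw [h2, Real.exp_log (hu_pos x)]
        simp only [hu, hh]
        field_simp
        ring
      rw [h1]
      exact contDiff_const.mul ((((contDiff_const.mul (contDiff_const.sub hcd)).sub
        (hgB (J + 1)).contDiff).exp).sub contDiff_const)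
  have hexp : (fun x => Real.exp (-2 * confinement α Vt x - g x)) =
      fun x => Real.exp (-2) * f x := by
    ext x
    have h1 : -2 * confinement α Vt x - g x = -2 + (-α * x ^ 2 + Real.log (u x)) := by
      simp only [confinement, hVt]; ring
    rw [h1, Real.exp_add, Real.exp_add, Real.exp_log (hu_pos x)]
  have hinv : IsInvariantDensity (confinement α Vt) W π₀ := by
    refine ⟨hπ.nonneg, hπ.integrable, hπ.integral_eq_one, ?_, fun x => ?_⟩
    · change Integrable fun x => Real.exp (-2 * confinement α Vt x - g x)
      rw [hexp]; exact hfi.const_mul _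
    · change Z⁻¹ * f x = (∫ y, Real.exp (-2 * confinement α Vt y - g y))⁻¹ *
        Real.exp (-2 * confinement α Vt x - g x)
      have h1 := congrFun hexp x
      rw [h1, hexp, integral_const_mul, ← hZd]
      have := Real.exp_pos (-2)
      field_simp
  have hWi : IsInteraction α Vt W := isInteraction_gaussCos_zero hη0 (by linarith)
  obtain ⟨hcW1, hcW2⟩ := constCW_gaussCos_zero hη0.le
  obtain ⟨l, hl0, v, hv0, hlv⟩ := exists_fourierR_bounds J hα hε0
  have hFπ : ∀ z, ‖fourierR π₀ z‖ = Z⁻¹ * ‖fourierR f z‖ := fun z => by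
    rw [hπd, fourierR_const_mul, norm_mul, Complex.norm_real,
      Real.norm_of_nonneg (inv_pos.2 hZ).le]
  have hZi := inv_pos.2 hZ
  have hlow : ∀ z, Z⁻¹ * l * (wt (J + 2) z)⁻¹ ≤ ‖fourierR π₀ z‖ := fun z => by
    rw [hFπ, mul_assoc]
    exact mul_le_mul_of_nonneg_left (hlv z).1 hZi.le
  have hup : ∀ z, ‖fourierR π₀ z‖ ≤ Z⁻¹ * v * (wt (J + 2) z)⁻¹ := fun z => by
    rw [hFπ, mul_assoc]
    exact mul_le_mul_of_nonneg_left (hlv z).2 hZi.le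
  obtain ⟨R, hR0, hR⟩ := exists_lintegral_ratio_gaussCos_le (J + 2) hη0.le
    (by positivity : 0 < Z⁻¹ * l) hlow
  have hcW0 : 0 < constCW W := hη0.trans_le hcW1
  refine ⟨Vt, hVc, 1 / 16, ![constCW W, constCW W, 1, R, Z⁻¹ * l, Z⁻¹ * v], by norm_num,
    fun i => ?_, W, hWi, ?_, ?_, ?_, π₀, hinv, ?_, fun z => ⟨hlow z, hup z⟩⟩
  · fin_cases i
    · exact hcW0
    · exact hcW0
    · exact one_pos
    · exact hR0
    · exact (by positivity : 0 < Z⁻¹ * l)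
    · exact (by positivity : 0 < Z⁻¹ * v)
  · rw [hW, deriv_gaussCos, ← hW]
    refine (ciSup_le (abs_gaussCos'_le' hη0.le le_rfl)).trans_lt ?_
    refine Real.lt_sqrt_of_sq_lt ?_
    have h1 : (2 * η * (1 + 0)) ^ 2 = 4 * η * η := by ring
    have h2 : 4 * η * η ≤ 4 * (α / 16) * (1 / 2) := by gcongr
    rw [h1]
    linarith
  · have h1 : ⨅ x, iteratedDeriv 2 W x = -constCW W := by rw [constCW, neg_neg]
    rw [h1]
    exact ⟨le_rfl, le_rfl⟩
  · change limsup (tailFun (1 / 16) (deriv W)) atTop ≤ _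
    rw [hW, deriv_gaussCos, (tendsto_tailFun_of_le_exp (by norm_num)
      (abs_gaussCos'_le hη0.le le_rfl)).limsup_eq]
    exact zero_le
  · rw [hW, deriv_gaussCos]
    exact hR

end

/-- For every smoothness `J ≥ 2` and every `α > 0`: there are non-smooth confinement potentials for
which the class is non-empty, and for every such potential the lower bound holds for some `(p, r)`,
with constants that do not depend on `N`. -/
theorem theorem3p5 (J : ℕ) (hJ : 2 ≤ J) (α : ℝ) (hα : 0 < α) :
    (∃ Vt : ℝ → ℝ, IsNonsmoothConfinement J α Vt ∧
      ∃ (p : ℝ) (r : Fin 6 → ℝ), 0 < p ∧ (∀ i, 0 < r i) ∧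
        (interactionClass α Vt r p J).Nonempty) ∧
    ∀ Vt : ℝ → ℝ, IsNonsmoothConfinement J α Vt →
      (∃ (p : ℝ) (r : Fin 6 → ℝ), 0 < p ∧ (∀ i, 0 < r i) ∧
        (interactionClass α Vt r p J).Nonempty) →
      ∃ (p : ℝ) (r : Fin 6 → ℝ), 0 < p ∧ (∀ i, 0 < r i) ∧
        ∃ c₀ : ℝ, 0 < c₀ ∧ ∃ κ : ℝ≥0∞, 0 < κ ∧
          ∀ N : ℕ, 1 ≤ N →
            κ ≤ minimaxProb α Vt r p J N (c₀ * (N : ℝ) ^ (-(1 / 4 : ℝ))) := by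
  exact ⟨exists_confinement_nonempty hJ hα, fun _ hV hne => exists_le_minimaxProb hV hne⟩
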